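/- Let $\mathcal W_1$ be a finite alphabet and $\Sigma^+\subset\mathcal W_1^{\mathbb N}$ a one-sided Markov shift (a compact one), with shift $\sigma$. A word $w$ is admissible if its cylinder $[w]\subset\Sigma^+$ is non-empty, and $\mathcal W_n^{A,a}$ is the set of admissible words of length $n$ with first letter $A$ and last letter $a$. Let $R:\Sigma^+\to(0,\infty)$ be such that, for some $\theta\in(0,1)$ and $K\ge 0$, $|\log R(y)-\log R(z)|\le K\theta^n$ whenever $n>1$ and $y,z\in\Sigma^+$ have the same first $n$ letters; put $R_n=\prod_{i<n}R\circ\sigma^i$. Let $G$ be a countable discrete group, $\mathfrak s:\mathcal W_1\to G$, $\underline{\mathfrak s}(w_1\cdots w_n)=\mathfrak s(w_1)\cdots\mathfrak s(w_n)$, and assume that the skew product $T_{\mathfrak s}(y,g)=(\sigma y,\mathfrak s(y_0)^{-1}g)$ on $\Sigma^+\times G$ is topologically transitive. Let $\rho$ be a countable direct sum of quotient representations of $G$ in $\mathcal H=\bigoplus_i\ell^2(G/K_i,\mathbb R)$ ($K_i\le G$), and let $0\ne f\in\mathcal H$ be a non-negative function. Fix $A,a\in\mathcal W_1$ with $[A]\neq\emptyset$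 and $x\in\sigma[a]$. For $c:\mathbb N\to(0,\infty)$, $t>0$ and $N\in\mathbb N$ set $$\phi_{c;\le N}[t](g)=\sum_{n=1}^N t^{-n}c_n\sum_{w\in\mathcal W_n^{A,a}:\,\underline{\mathfrak s}(w)=g}R_n(wx),\qquad \phi^*(g)=\phi(g^{-1}),\qquad \phi\ast_\rho f=\sum_{h\in G}\phi(h)\rho(h)f,$$ write $\phi_{\le N}[t]$ for $c\equiv1$, and let $$\gamma(f)=\inf\Big\{t>0:\ \sup_N\sum_{h\in G}\phi_{\le N}[t](h)\,\langle\rho(h)f,f\rangle<\infty\Big\}.$$ Call $c$ slowly increasing if it is positive and non-decreasing, $c_n\to\infty$, and $c_{n+k}/c_n\to1$ as $n\to\infty$ for every $k$. For a word $w$ let $w\wedge x$ be the length of the longest common prefix of $w$ and $x$. Then there are a slowly increasing $c$ and a sequence $t_k>\gamma(f)$ with $t_k\to\gamma(f)$ such that the function $\Upsilon_{c,\ast}:G\to\mathbb R$, $$\Upsilon_{c,\ast}(g)=\limsup_{k\to\infty}\lim_{N\to\infty}\frac{\langle\rho(g)(\phi_{c;\le N}[t_k]\ast_\rho f),\ \phi^*_{c;\le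 N}[t_k]\ast_\rho f\rangle}{\langle\phi_{c;\le N}[t_k]\ast_\rho f,\ \phi^*_{c;\le N}[t_k]\ast_\rho f\rangle},$$ is well defined (for each $k$ the denominators are positive for all large $N$, the inner limits exist, and for each $g$ they are bounded in $k$), and there are a finite $\sigma$-invariant Borel measure $\mu$ on $\Sigma^+$ and a constant $C>1$ such that: (i) for every word $w$ (of any length $n\ge0$) for which $awA$ is admissible, $$C^{-\theta^{w\wedge x}}\,\Upsilon_{c,\ast}(\underline{\mathfrak s}(w))\ \le\ \gamma(f)^n\int_{[awA]}(R_n\circ\sigma)^{-1}\,d\mu\ \le\ C^{\theta^{w\wedge x}}\,\Upsilon_{c,\ast}(\underline{\mathfrak s}(w));$$ (ii) for every admissible word $w$ of length $n\ge1$, $$C^{-1}\,\Upsilon_{c,\ast}(\underline{\mathfrak s}(w))\ \le\ \gamma(f)^n\int_{[w]}R_n^{-1}\,d\mu\ \le\ C\,\Upsilon_{c,\ast}(\underline{\mathfrak s}(w)).$$ -/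

import Mathlib

open Filter Topology MeasureTheory

noncomputable section

namespace ThermoDensity

/-! ### One-sided Markov shifts -/

section Shift

variable {S : Type*}

/-- The left shift `σ` on one-sided sequences. -/
def shift (y : ℕ → S) : ℕ → S := fun i => y (i + 1)

/-- The one-sided Markov shift `Σ⁺` with transition relation `τ`, as a set of sequences. -/
def markovShift (τ : S → S → Prop) : Set (ℕ → S) := {y | ∀ i, τ (y i) (y (i + 1))}

/-- The set of sequences that begin with the word `w`. -/
def cyl (w : List S) : Set (ℕ → S) := {y | ∀ (i : ℕ) (h : i < w.length), y i = w[i]}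

/-- The concatenation `w y` of a finite word and a one-sided sequence. -/
def concat : List S → (ℕ → S) → ℕ → S
  | [], y => y
  | b :: w, y => fun i => Nat.casesOn i b (fun j => concat w y j)

/-- A word is admissible if it occurs in a point of `Σ⁺`; since `Σ⁺` is mapped into itself by the
shift, this means that its cylinder in `Σ⁺` is not empty. -/
def Admissible (τ : S → S → Prop) (w : List S) : Prop := (cyl w ∩ markovShift τ).Nonempty

open Classical in
/-- `w ∧ x`: the length of the longest common prefix of the word `w` and the sequence `x`. -/
def wedge : List S → (ℕ → S) → ℕ
  | [], _ => 0
  | b :: w, x => if b = x 0 then wedge w (shift x) + 1 else 0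

/-- The multiplicative Birkhoff product `R_n(y) = R(y) R(σ y) ⋯ R(σ^{n-1} y)`. -/
def birkhoffProd (R : (ℕ → S) → ℝ) (n : ℕ) (y : ℕ → S) : ℝ :=
  ∏ i ∈ Finset.range n, R (shift^[i] y)

/-- `log R` is locally Hölder on `Σ⁺` with parameter `θ`: `Var_n (log R) ≤ K θ^n` for `n > 1`. -/
def LogHolder (τ : S → S → Prop) (R : (ℕ → S) → ℝ) (θ : ℝ) : Prop :=
  ∃ K : ℝ, ∀ n : ℕ, 1 < n → ∀ y ∈ markovShift τ, ∀ z ∈ markovShift τ,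
    (∀ i < n, y i = z i) → |Real.log (R y) - Real.log (R z)| ≤ K * θ ^ n

open Classical in
/-- The finite set `𝒲_n^{A,a}` of admissible words of length `n` with first letter `A` and last
letter `a`. -/
def wordsBetween [Finite S] (τ : S → S → Prop) (A a : S) (n : ℕ) : Finset (List S) :=
  (List.finite_length_eq S n).toFinset.filter
    fun w => Admissible τ w ∧ w.head? = some A ∧ w.getLast? = some a

end Shift

/-! ### Skew products -/

section Skew

variable {S G : Type*} [Group G]

/-- `𝔰(w) = 𝔰(w₁) ⋯ 𝔰(w_n)`. -/
def wordProd (s : S → G) (w : List S) : G := (w.map s).prod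

/-- The skew product `T_𝔰 (y, g) = (σ y, 𝔰(y₀)⁻¹ g)`. -/
def skewProduct (s : S → G) (p : (ℕ → S) × G) : (ℕ → S) × G :=
  (shift p.1, (s (p.1 0))⁻¹ * p.2)

/-- Topological transitivity of the restriction of `T` to a set `X` (with its subspace topology)
that `T` maps into itself. -/
def TransitiveOn {Z : Type*} [TopologicalSpace Z] (T : Z → Z) (X : Set Z) : Prop :=
  ∀ U V : Set Z, IsOpen U → IsOpen V → (U ∩ X).Nonempty → (V ∩ X).Nonempty →
    ∃ n : ℕ, (T^[n] '' (U ∩ X) ∩ V).Nonempty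

end Skew

/-! ### Sums of quotient representations -/

section Rep

variable {G : Type*} [Group G]

/-- The real Hilbert space `ℓ²(X)`. -/
abbrev Ell2 (X : Type*) := lp (fun _ : X => ℝ) 2

variable {X : Type*} [MulAction G X]

theorem memlp_smul (g : G) (f : Ell2 X) :
    Memℓp (fun p : X => (f : X → ℝ) (g⁻¹ • p)) 2 := by
  have h2 : 0 < (2 : ENNReal).toReal := by norm_num
  have hf := (memℓp_gen_iff h2).1 (lp.memℓp f)
  exact (memℓp_gen_iff h2).2 ((MulAction.toPerm (α := G) (β := X) g⁻¹).summable_iff.2 hf)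

/-- Translation by `g` on `ℓ²(X)`: `(ρ(g) f)(p) = f(g⁻¹ p)`. -/
def translate (g : G) (f : Ell2 X) : Ell2 X := ⟨fun p => (f : X → ℝ) (g⁻¹ • p), memlp_smul g f⟩

theorem translate_apply (g : G) (f : Ell2 X) (p : X) :
    (translate g f : X → ℝ) p = (f : X → ℝ) (g⁻¹ • p) := rfl

theorem norm_translate (g : G) (f : Ell2 X) : ‖translate g f‖ = ‖f‖ := by
  have h2 : 0 < (2 : ENNReal).toReal := by norm_num
  rw [lp.norm_eq_tsum_rpow h2, lp.norm_eq_tsum_rpow h2]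
  congr 1
  exact (MulAction.toPerm (α := G) (β := X) g⁻¹).tsum_eq
    (fun p => ‖(f : X → ℝ) p‖ ^ (2 : ENNReal).toReal)

/-- The orthogonal (real unitary) representation of `G` in `ℓ²(X)` that permutes the standard
orthonormal basis. -/
def permRep : G →* (Ell2 X ≃ₗᵢ[ℝ] Ell2 X) where
  toFun g :=
    { toFun := translate g
      invFun := translate g⁻¹
      map_add' := fun _ _ => rfl
      map_smul' := fun _ _ => rfl
      left_inv := fun f => by
        refine lp.ext (funext fun p => ?_)
        simp [translate_apply]
      right_inv := fun f => by
        refine lp.ext (funext fun p => ?_)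
        simp [translate_apply]
      norm_map' := norm_translate g }
  map_one' := by
    refine LinearIsometryEquiv.ext fun f => lp.ext (funext fun p => ?_)
    change (f : X → ℝ) ((1 : G)⁻¹ • p) = (f : X → ℝ) p
    simp
  map_mul' g h := by
    refine LinearIsometryEquiv.ext fun f => lp.ext (funext fun p => ?_)
    change (f : X → ℝ) ((g * h)⁻¹ • p) = (f : X → ℝ) (h⁻¹ • g⁻¹ • p)
    simp [mul_smul]

/-- The Hilbert space `ℋ = ⨁ᵢ ℓ²(G/Kᵢ)`, realised as `ℓ²` of the disjoint union of the coset
spaces `G/Kᵢ`, on which `G` acts by left multiplication. -/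
abbrev CosetSpace {ι : Type*} (K : ι → Subgroup G) := Ell2 (Σ i, G ⧸ K i)

/-- The sum `ρ` of the quotient representations `λ_{Kᵢ}` of `G`. -/
abbrev cosetRep {ι : Type*} (K : ι → Subgroup G) :
    G →* (CosetSpace K ≃ₗᵢ[ℝ] CosetSpace K) := permRep

/-- `φ ∗_ρ f = ∑_h φ(h) ρ(h) f`. -/
def convVec {ι : Type*} {K : ι → Subgroup G} (φ : G → ℝ) (f : CosetSpace K) : CosetSpace K :=
  ∑' h : G, φ h • cosetRep K h f

/-- `φ^*(g) = φ(g⁻¹)`. -/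
def reflect (φ : G → ℝ) : G → ℝ := fun g => φ g⁻¹

end Rep

/-! ### Thermodynamic densities -/

section Density

variable {S G : Type*} [Finite S] [Group G]

open Classical in
/-- The partial sum
`φ_{c;≤N}^{A,a}[t](g) = ∑_{n=1}^N t^{-n} c_n ∑_{w ∈ 𝒲_n^{A,a}, 𝔰(w) = g} R_n(w x)`. -/
def density (τ : S → S → Prop) (R : (ℕ → S) → ℝ) (s : S → G) (A a : S) (x : ℕ → S)
    (c : ℕ → ℝ) (N : ℕ) (t : ℝ) (g : G) : ℝ :=
  ∑ n ∈ Finset.Icc 1 N, (t ^ n)⁻¹ * c n *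
    ∑ w ∈ (wordsBetween τ A a n).filter (fun w => wordProd s w = g),
      birkhoffProd R n (concat w x)

variable {ι : Type*} {K : ι → Subgroup G}

/-- The convergence parameter
`γ(f) = inf {t > 0 : sup_N ∫ ⟨ρ(h) f, f⟩ dφ_{≤N}[t](h) < ∞}`, where `c = 1`. -/
def convParam (τ : S → S → Prop) (R : (ℕ → S) → ℝ) (s : S → G) (A a : S) (x : ℕ → S)
    (f : CosetSpace K) : ℝ :=
  sInf {t : ℝ | 0 < t ∧ BddAbove (Set.range fun N : ℕ =>
    ∑' h : G, density τ R s A a x (fun _ => 1) N t h * inner ℝ (cosetRep K h f) f)}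

/-- The coefficient `⟨ρ(g) (φ_{c;≤N}[t] ∗_ρ f), φ^*_{c;≤N}[t] ∗_ρ f⟩`. -/
def starCoeff (τ : S → S → Prop) (R : (ℕ → S) → ℝ) (s : S → G) (A a : S) (x : ℕ → S)
    (f : CosetSpace K) (c : ℕ → ℝ) (N : ℕ) (t : ℝ) (g : G) : ℝ :=
  inner ℝ (cosetRep K g (convVec (density τ R s A a x c N t) f))
    (convVec (reflect (density τ R s A a x c N t)) f)

/-- `c` is slowly increasing: positive, nondecreasing, with limit `∞`, and `c_{n+k} / c_n → 1` for
every `k`. -/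
def SlowlyIncreasing (c : ℕ → ℝ) : Prop :=
  (∀ n, 0 < c n) ∧ Monotone c ∧ Tendsto c atTop atTop ∧
    ∀ k : ℕ, Tendsto (fun n => c (n + k) / c n) atTop (𝓝 1)

/-- The function `Υ_{c,*}(g) = limsup_k lim_N starCoeff(g) / starCoeff(1)` at the parameters `t_k`
is well defined, with value `Υ`: the quotients have positive denominators for large `N`, the inner
limits exist in `ℝ`, and they are bounded in `k`, so that the `limsup` is finite. -/
def IsUpsilon (τ : S → S → Prop) (R : (ℕ → S) → ℝ) (s : S → G) (A a : S) (x : ℕ → S)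
    (f : CosetSpace K) (c : ℕ → ℝ) (t : ℕ → ℝ) (Υ : G → ℝ) : Prop :=
  (∀ k, ∀ᶠ N in atTop, 0 < starCoeff τ R s A a x f c N (t k) 1) ∧
  ∃ L : ℕ → G → ℝ,
    (∀ k g, Tendsto (fun N => starCoeff τ R s A a x f c N (t k) g /
      starCoeff τ R s A a x f c N (t k) 1) atTop (𝓝 (L k g))) ∧
    ∀ g, Bornology.IsBounded (Set.range fun k => L k g) ∧
      Υ g = limsup (fun k => L k g) atTop

end Density

end ThermoDensity

end

open ThermoDensity

/-! This is a Patterson–Sullivan construction. Put ψ(g) = ⟨ρ(g)f, f⟩; it is bounded, non-negative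
because f is, and ψ(1) > 0. As ρ is orthogonal, ⟨ρ(g)ρ(h)f, ρ(k⁻¹)f⟩ = ψ(kgh). Hence the star
coefficients converge as N → ∞ to `pairSum`, the sum over pairs (u, v) of words from A to a of
c_{|u|} c_{|v|} t^{-|u|-|v|} R(ux) R(vx) ψ(s(u) g s(v)), where R(ux) is the Birkhoff product along
u. Likewise γ(f) is the abscissa of convergence `gam` of the single series `wordSum` with c = 1.

The measures: for every word v = p b q from A to a with a marked letter b, put the mass c_{|p|+1}
c_{|q|} t^{-|v|} R(vx) ψ(s(v)) at the point b q x of the orbit of vx (`cutSum`, `cutMeasure`). If a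
long tail b q begins with a w A, then v splits as u w v' with u and v' again words from A to a;
conversely every such pair can be joined through w. The Birkhoff product factorises over u, w, v'.
The integrand (R_n ∘ σ)⁻¹ removes the factor of w and t^n its power of t, which leaves the term of
`pairSum` at s(w) up to two defects. The product along u is evaluated in front of w v' x instead of
x; these points share w ∧ x letters, so bounded distortion costs D^{θ^{w∧x}}. And c_{|wv'|} stands
in place of c_{|v'|}, which is harmless for long v' since c is slowly increasing; the remaining cuts
cost a multiple of `wordSum` (`midWeight_lower`, `midWeight_upper`). For a general cylinder [w] the
two outer parts have wrong end letters. Transitivity provides finitely many connecting words with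
trivial group element, and inserting them costs a constant (`exists_tsum_split_le`,
`exists_cylWeight_lower`).

The error is negligible by Patterson's trick: c is chosen so that `wordSum` diverges at γ. A long
word carries many cuts, each at least a fixed multiple of its term in `wordSum`, so `wordSum` is
o(`cutSum` 1), hence o(`pairSum` 1) (`exists_mul_wordSum_le`, `tendsto_wordSum_div_pairSum`). Moving
the mark by one letter shows shift invariance up to a factor 1 + ε and the same error
(`cutSum_shift_le`). The measure μ is a weak limit, as t ↓ γ along a sequence, of the cut measures
divided by `pairSum` at 1. Cylinders are clopen, so all comparisons pass to the limit. -/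

noncomputable section

namespace ThermoDensity

/-! ### Concatenation, Birkhoff products and bounded distortion -/

section Words

variable {S : Type*}

@[simp] theorem concat_nil (y : ℕ → S) : concat [] y = y := rfl

@[simp] theorem concat_cons_zero (b : S) (w : List S) (y : ℕ → S) : concat (b :: w) y 0 = b := rfl

@[simp] theorem concat_cons_succ (b : S) (w : List S) (y : ℕ → S) (i : ℕ) :
    concat (b :: w) y (i + 1) = concat w y i := rfl

@[simp] theorem shift_concat_cons (b : S) (w : List S) (y : ℕ → S) :
    shift (concat (b :: w) y) = concat w y := rfl

theorem concat_append (u v : List S) (y : ℕ → S) : concat (u ++ v) y = concat u (concat v y) := by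
  induction u with
  | nil => rfl
  | cons b u ih =>
    funext i
    cases i with
    | zero => rfl
    | succ i => simp [ih]

theorem concat_singleton_shift (y : ℕ → S) : concat [y 0] (shift y) = y := by
  funext i
  cases i <;> rfl

theorem shift_iterate_length_concat (u : List S) (y : ℕ → S) :
    shift^[u.length] (concat u y) = y := by
  induction u with
  | nil => rfl
  | cons b u ih => simpa [Function.iterate_succ_apply] using ih

theorem shift_mem {τ : S → S → Prop} {y : ℕ → S} (hy : y ∈ markovShift τ) :
    shift y ∈ markovShift τ := fun i => hy (i + 1)

theorem shift_iterate_mem {τ : S → S → Prop} {y : ℕ → S} (hy : y ∈ markovShift τ) (n : ℕ) :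
    shift^[n] y ∈ markovShift τ := by
  induction n with
  | zero => exact hy
  | succ n ih => rw [Function.iterate_succ_apply']; exact shift_mem ih

theorem concat_cons_mem_iff {τ : S → S → Prop} {b : S} {w : List S} {y : ℕ → S} :
    concat (b :: w) y ∈ markovShift τ ↔ τ b (concat w y 0) ∧ concat w y ∈ markovShift τ := by
  constructor
  · intro h
    exact ⟨h 0, shift_mem h⟩
  · rintro ⟨h0, h⟩ i
    cases i with
    | zero => exact h0
    | succ i => exact h i

theorem mem_of_concat_mem {τ : S → S → Prop} {u : List S} {y : ℕ → S}
    (h : concat u y ∈ markovShift τ) : y ∈ markovShift τ := by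
  have := shift_iterate_mem h u.length
  rwa [shift_iterate_length_concat] at this

theorem concat_mem_of_append {τ : S → S → Prop} {u v : List S} {y : ℕ → S}
    (h : concat (u ++ v) y ∈ markovShift τ) : concat v y ∈ markovShift τ := by
  rw [concat_append] at h
  exact mem_of_concat_mem h

/-- The tail after a word may be replaced by any other tail that may follow its last letter. -/
theorem concat_replace {τ : S → S → Prop} {u : List S} {b : S} {y z : ℕ → S}
    (hu : u.getLast? = some b) (h : concat u y ∈ markovShift τ)
    (hz : concat [b] z ∈ markovShift τ) : concat u z ∈ markovShift τ := by
  induction u with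
  | nil => simp at hu
  | cons d u ih =>
    cases u with
    | nil => simp at hu; subst hu; exact hz
    | cons e u =>
      rw [List.getLast?_cons_cons] at hu
      rw [concat_cons_mem_iff] at h ⊢
      exact ⟨h.1, ih hu h.2⟩

theorem concat_apply_lt (w : List S) (y : ℕ → S) (i : ℕ) (h : i < w.length) :
    concat w y i = w[i] := by
  induction w generalizing i with
  | nil => simp at h
  | cons b w ih =>
    cases i with
    | zero => rfl
    | succ i => simpa using ih i (by simpa using h)

theorem concat_mem_cyl (w : List S) (y : ℕ → S) : concat w y ∈ cyl w :=
  fun i h => concat_apply_lt w y i h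

theorem concat_of_mem_cyl {w : List S} {y : ℕ → S} (h : y ∈ cyl w) :
    concat w (shift^[w.length] y) = y := by
  induction w generalizing y with
  | nil => rfl
  | cons b w ih =>
    have h' : shift y ∈ cyl w := fun i hi => by
      have := h (i + 1) (by simpa using hi)
      rw [List.getElem_cons_succ] at this
      exact this
    funext i
    cases i with
    | zero => exact (h 0 (by simp)).symm
    | succ i =>
      simp only [concat_cons_succ, List.length_cons, Function.iterate_succ_apply]
      rw [ih h']
      rfl

theorem admissible_iff {τ : S → S → Prop} {w : List S} :
    Admissible τ w ↔ ∃ z, concat w z ∈ markovShift τ := by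
  constructor
  · rintro ⟨y, hy, hy'⟩
    exact ⟨shift^[w.length] y, by rwa [concat_of_mem_cyl hy]⟩
  · rintro ⟨z, hz⟩
    exact ⟨_, concat_mem_cyl w z, hz⟩

theorem concat_mem_cyl_iff {u w : List S} {y : ℕ → S} (h : w.length ≤ u.length) :
    concat u y ∈ cyl w ↔ w <+: u := by
  constructor
  · intro hc
    rw [List.prefix_iff_eq_take]
    apply List.ext_getElem
    · simp [h]
    · intro i h1 h2
      rw [List.getElem_take, ← hc i h1, concat_apply_lt u y i (by omega)]
  · rintro ⟨v, rfl⟩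
    rw [concat_append]
    exact concat_mem_cyl _ _

/-- Source of the exponent θ^{w∧x}: whatever follows w, the resulting sequence agrees with x on the
first w ∧ x places, so distortion applies with m = `wedge w x`. -/
theorem concat_eq_of_lt_wedge (w : List S) (x z : ℕ → S) (i : ℕ) (hi : i < wedge w x) :
    concat w z i = x i := by
  induction w generalizing x i with
  | nil => simp [wedge] at hi
  | cons b w ih =>
    by_cases hb : b = x 0
    · cases i with
      | zero => exact hb
      | succ i =>
        simp only [wedge, hb, if_true] at hi
        exact ih (shift x) i (by omega)
    · simp [wedge, hb] at hi

/-- The product of `R` along the word `u`, evaluated on the sequence `u y`. -/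
def wordWeight (R : (ℕ → S) → ℝ) (u : List S) (y : ℕ → S) : ℝ :=
  birkhoffProd R u.length (concat u y)

theorem birkhoffProd_add (R : (ℕ → S) → ℝ) (m n : ℕ) (y : ℕ → S) :
    birkhoffProd R (m + n) y = birkhoffProd R m y * birkhoffProd R n (shift^[m] y) := by
  simp only [birkhoffProd, Finset.prod_range_add]
  congr 1
  refine Finset.prod_congr rfl fun i _ => ?_
  rw [add_comm, Function.iterate_add_apply]

@[simp] theorem wordWeight_nil (R : (ℕ → S) → ℝ) (y : ℕ → S) : wordWeight R [] y = 1 := by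
  simp [wordWeight, birkhoffProd]

theorem wordWeight_append (R : (ℕ → S) → ℝ) (u v : List S) (y : ℕ → S) :
    wordWeight R (u ++ v) y = wordWeight R u (concat v y) * wordWeight R v y := by
  simp only [wordWeight, List.length_append, birkhoffProd_add, concat_append,
    shift_iterate_length_concat]

theorem wordWeight_cons (R : (ℕ → S) → ℝ) (b : S) (v : List S) (y : ℕ → S) :
    wordWeight R (b :: v) y = R (concat (b :: v) y) * wordWeight R v y := by
  have := wordWeight_append R [b] v y
  rw [List.singleton_append] at this
  rw [this]
  congr 1
  simp [wordWeight, birkhoffProd, ← concat_append]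

theorem birkhoffProd_pos {R : (ℕ → S) → ℝ} (hR : ∀ y, 0 < R y) (n : ℕ) (y : ℕ → S) :
    0 < birkhoffProd R n y := Finset.prod_pos fun _ _ => hR _

theorem wordWeight_pos {R : (ℕ → S) → ℝ} (hR : ∀ y, 0 < R y) (u : List S) (y : ℕ → S) :
    0 < wordWeight R u y := birkhoffProd_pos hR _ _

theorem pow_le_birkhoffProd {R : (ℕ → S) → ℝ} {lo : ℝ} (h0 : 0 ≤ lo) (hR : ∀ y, lo ≤ R y) (n : ℕ)
    (y : ℕ → S) : lo ^ n ≤ birkhoffProd R n y := by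
  simpa [birkhoffProd] using Finset.prod_le_prod (s := Finset.range n) (f := fun _ => lo)
    (g := fun i => R (shift^[i] y)) (fun _ _ => h0) (fun _ _ => hR _)

theorem birkhoffProd_le_pow {R : (ℕ → S) → ℝ} {hi : ℝ} (h0 : ∀ y, 0 ≤ R y) (hR : ∀ y, R y ≤ hi)
    (n : ℕ) (y : ℕ → S) : birkhoffProd R n y ≤ hi ^ n := by
  simpa [birkhoffProd] using Finset.prod_le_prod (s := Finset.range n) (g := fun _ => hi)
    (f := fun i => R (shift^[i] y)) (fun _ _ => h0 _) (fun _ _ => hR _)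

theorem birkhoffProd_congr {τ : S → S → Prop} {R R' : (ℕ → S) → ℝ}
    (h : ∀ y ∈ markovShift τ, R y = R' y) (n : ℕ) {y : ℕ → S} (hy : y ∈ markovShift τ) :
    birkhoffProd R n y = birkhoffProd R' n y :=
  Finset.prod_congr rfl fun i _ => h _ (shift_iterate_mem hy i)

/-- The logarithm of a log-Hölder function on a shift over a finite alphabet is bounded. -/
theorem LogHolder.exists_bound [Finite S] {τ : S → S → Prop} {R : (ℕ → S) → ℝ} {θ : ℝ}
    (hHol : LogHolder τ R θ) : ∃ B : ℝ, 0 ≤ B ∧ ∀ y ∈ markovShift τ, |Real.log (R y)| ≤ B := by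
  classical
  obtain ⟨K, hK⟩ := hHol
  -- One representative for each two-letter prefix; two letters are needed because the Hölder bound
  -- is assumed only for n > 1.
  let pick : S × S → ℕ → S := fun p =>
    if h : ∃ y ∈ markovShift τ, y 0 = p.1 ∧ y 1 = p.2 then h.choose else fun _ => p.1
  obtain ⟨B, hB⟩ := (Set.finite_range fun p => |Real.log (R (pick p))|).bddAbove
  have key : ∀ y ∈ markovShift τ, |Real.log (R y)| ≤ K * θ ^ 2 + B := by
    intro y hy
    have hex : ∃ z ∈ markovShift τ, z 0 = (y 0, y 1).1 ∧ z 1 = (y 0, y 1).2 := ⟨y, hy, rfl, rfl⟩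
    have hp : pick (y 0, y 1) = hex.choose := dif_pos hex
    have hs := hex.choose_spec
    rw [← hp] at hs
    have h1 := hK 2 (by norm_num) y hy _ hs.1 (by
      intro i hi
      interval_cases i
      · exact hs.2.1.symm
      · exact hs.2.2.symm)
    have h2 : |Real.log (R (pick (y 0, y 1)))| ≤ B := hB ⟨_, rfl⟩
    calc |Real.log (R y)| = |(Real.log (R y) - Real.log (R (pick (y 0, y 1))))
          + Real.log (R (pick (y 0, y 1)))| := by ring_nf
      _ ≤ _ := (abs_add_le _ _).trans (add_le_add h1 h2)
  exact ⟨max 0 (K * θ ^ 2 + B), le_max_left _ _, fun y hy => (key y hy).trans (le_max_right _ _)⟩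

/-- Boundedness of log R allows n = 1 at the price of a larger constant. This case occurs in the
distortion estimate, where the sequences may share only the last letter of the word. -/
theorem LogHolder.exists_pos_const [Finite S] {τ : S → S → Prop} {R : (ℕ → S) → ℝ} {θ : ℝ}
    (hθ0 : 0 < θ) (hHol : LogHolder τ R θ) : ∃ K : ℝ, 0 ≤ K ∧ ∀ n : ℕ, 1 ≤ n →
      ∀ y ∈ markovShift τ, ∀ z ∈ markovShift τ, (∀ i < n, y i = z i) →
        |Real.log (R y) - Real.log (R z)| ≤ K * θ ^ n := by
  obtain ⟨B, hB0, hB⟩ := hHol.exists_bound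
  obtain ⟨K, hK⟩ := hHol
  refine ⟨max (max K 0) (2 * B / θ), le_max_of_le_left (le_max_right _ _), ?_⟩
  intro n hn y hy z hz h
  rcases hn.lt_or_eq with hn | hn
  · refine (hK n hn y hy z hz h).trans ?_
    gcongr
    exact (le_max_left _ _).trans (le_max_left _ _)
  · subst hn
    calc |Real.log (R y) - Real.log (R z)| ≤ |Real.log (R y)| + |Real.log (R z)| := abs_sub _ _
      _ ≤ B + B := add_le_add (hB y hy) (hB z hz)
      _ = 2 * B / θ * θ ^ 1 := by field_simp; ring
      _ ≤ _ := by gcongr; exact le_max_right _ _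

/-- Bounded distortion of Birkhoff products. -/
theorem LogHolder.exists_distortion [Finite S] {τ : S → S → Prop} {R : (ℕ → S) → ℝ} {θ : ℝ}
    (hR : ∀ y, 0 < R y) (hθ0 : 0 < θ) (hθ1 : θ < 1) (hHol : LogHolder τ R θ) :
    ∃ D : ℝ, 1 ≤ D ∧ ∀ (m : ℕ) (u : List S) (y z : ℕ → S), concat u y ∈ markovShift τ →
      concat u z ∈ markovShift τ → (∀ i < m, y i = z i) →
        wordWeight R u y ≤ D ^ (θ ^ m) * wordWeight R u z := by
  obtain ⟨K, hK0, hK⟩ := hHol.exists_pos_const hθ0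
  have h1θ : 0 < 1 - θ := by linarith
  have agree : ∀ (m : ℕ) (u : List S) (y z : ℕ → S), (∀ i < m, y i = z i) →
      ∀ i < u.length + m, concat u y i = concat u z i := by
    intro m u y z h
    induction u with
    | nil => simpa using h
    | cons b u ih =>
      intro i hi
      cases i with
      | zero => rfl
      | succ i => exact ih i (by simp at hi; omega)
  have key : ∀ (m : ℕ) (u : List S) (y z : ℕ → S), concat u y ∈ markovShift τ →
      concat u z ∈ markovShift τ → (∀ i < m, y i = z i) →
        Real.log (wordWeight R u y) - Real.log (wordWeight R u z) ≤
          K * θ ^ m * (∑ i ∈ Finset.range u.length, θ ^ (i + 1)) := by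
    intro m u y z hy hz h
    induction u with
    | nil => simp
    | cons b u ih =>
      have hy' := (concat_cons_mem_iff.1 hy).2
      have hz' := (concat_cons_mem_iff.1 hz).2
      have h1 := ih hy' hz'
      have h2 := le_of_abs_le (hK ((b :: u).length + m) (by simp; omega) _ hy _ hz
        (agree m (b :: u) y z h))
      rw [wordWeight_cons, wordWeight_cons, Real.log_mul (hR _).ne' (wordWeight_pos hR _ _).ne',
        Real.log_mul (hR _).ne' (wordWeight_pos hR _ _).ne', List.length_cons,
        Finset.sum_range_succ, mul_add]
      have e : K * θ ^ ((b :: u).length + m) = K * θ ^ m * θ ^ (u.length + 1) := by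
        rw [List.length_cons, pow_add]; ring
      rw [e] at h2
      linarith
  -- A letter of u followed inside u by i letters contributes at most Kθ^{m+i+1}. The geometric
  -- series leaves a common factor θ^m, which becomes the exponent of a single constant D.
  refine ⟨Real.exp (K * (θ / (1 - θ))), Real.one_le_exp (by positivity), ?_⟩
  intro m u y z hy hz h
  have h1 := key m u y z hy hz h
  have hs : (∑ i ∈ Finset.range u.length, θ ^ (i + 1)) ≤ θ / (1 - θ) := by
    simp only [pow_succ, ← Finset.sum_mul]
    rw [div_eq_inv_mul]
    gcongr
    rw [← tsum_geometric_of_lt_one hθ0.le hθ1]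
    exact (summable_geometric_of_lt_one hθ0.le hθ1).sum_le_tsum _ (fun _ _ => by positivity)
  have h2 : Real.log (wordWeight R u y) ≤
      K * (θ / (1 - θ)) * θ ^ m + Real.log (wordWeight R u z) := by
    have : K * θ ^ m * (∑ i ∈ Finset.range u.length, θ ^ (i + 1)) ≤
      K * θ ^ m * (θ / (1 - θ)) := by gcongr
    nlinarith
  have hpy : 0 < wordWeight R u y := birkhoffProd_pos hR _ _
  have hpz : 0 < wordWeight R u z := birkhoffProd_pos hR _ _
  calc wordWeight R u y = Real.exp (Real.log (wordWeight R u y)) := (Real.exp_log hpy).symm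
    _ ≤ Real.exp (K * (θ / (1 - θ)) * θ ^ m + Real.log (wordWeight R u z)) := Real.exp_le_exp.2 h2
    _ = _ := by rw [Real.exp_add, Real.exp_log hpz, Real.exp_mul]

end Words

/-! ### Connecting words from transitivity of the skew product -/

section Transitive

variable {S G : Type*} [Group G]

@[simp] theorem wordProd_nil (s : S → G) : wordProd s [] = 1 := rfl

theorem wordProd_append (s : S → G) (u v : List S) :
    wordProd s (u ++ v) = wordProd s u * wordProd s v := by simp [wordProd]

theorem wordProd_cons (s : S → G) (b : S) (v : List S) :
    wordProd s (b :: v) = s b * wordProd s v := by simp [wordProd]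

theorem skewProduct_iterate_concat (s : S → G) (u : List S) (y : ℕ → S) (g : G) :
    (skewProduct s)^[u.length] (concat u y, g) = (y, (wordProd s u)⁻¹ * g) := by
  induction u generalizing g with
  | nil => simp
  | cons b u ih =>
    rw [List.length_cons, Function.iterate_succ_apply]
    have : skewProduct s (concat (b :: u) y, g) = (concat u y, (s b)⁻¹ * g) := rfl
    rw [this, ih, wordProd_cons]
    simp [mul_assoc]

theorem exists_word_concat (y : ℕ → S) (n : ℕ) : ∃ u : List S, u.length = n ∧
    concat u (shift^[n] y) = y := by
  refine ⟨List.ofFn fun i : Fin n => y i, by simp, ?_⟩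
  have h : y ∈ cyl (List.ofFn fun i : Fin n => y i) := fun i hi => by simp
  have := concat_of_mem_cyl h
  simpa using this

variable [TopologicalSpace S] [DiscreteTopology S] [TopologicalSpace G] [DiscreteTopology G]

/-- Transitivity is applied to the open sets fixing the first letter and the group coordinate (1 and
g⁻¹ respectively); u consists of the letters read along the orbit. Time 0 is possible, so u may be
empty. -/
theorem TransitiveOn.exists_word_aux {τ : S → S → Prop} {s : S → G}
    (h : TransitiveOn (skewProduct s) (markovShift τ ×ˢ Set.univ)) {b b' : S}
    (hb : Admissible τ [b]) (hb' : Admissible τ [b']) (g : G) :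
    ∃ (u : List S) (z : ℕ → S), concat u z ∈ markovShift τ ∧ concat u z 0 = b ∧ z 0 = b' ∧
      wordProd s u = g := by
  have hop : ∀ (d : S) (k : G), IsOpen ({p | p.1 0 = d ∧ p.2 = k} : Set ((ℕ → S) × G)) := by
    intro d k
    have h1 : IsOpen ((fun p : (ℕ → S) × G => (p.1 0, p.2)) ⁻¹' {(d, k)}) :=
      (isOpen_discrete _).preimage (by fun_prop)
    convert h1 using 1
    ext p
    simp [Prod.ext_iff]
  obtain ⟨y, hy⟩ := admissible_iff.1 hb
  obtain ⟨y', hy'⟩ := admissible_iff.1 hb'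
  obtain ⟨n, p, ⟨⟨q, k⟩, ⟨⟨hq1, hq2⟩, hq3⟩, hq4⟩, hp1, hp2⟩ :=
    h _ _ (hop b 1) (hop b' g⁻¹) ⟨(concat [b] y, 1), ⟨rfl, rfl⟩, hy, trivial⟩
      ⟨(concat [b'] y', g⁻¹), ⟨rfl, rfl⟩, hy', trivial⟩
  obtain ⟨u, hu, hu'⟩ := exists_word_concat q n
  have hq2' : k = 1 := hq2
  subst hq2'
  have h4 := skewProduct_iterate_concat s u (shift^[n] q) 1
  rw [hu', hu, hq4] at h4
  subst h4
  refine ⟨u, shift^[n] q, by rw [hu']; exact hq3.1, by rw [hu']; exact hq1, hp1, ?_⟩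
  simpa using hp2

/-- Transitivity of the skew product: any two letters are joined by a word with prescribed group
element. -/
theorem TransitiveOn.exists_word {τ : S → S → Prop} {s : S → G}
    (h : TransitiveOn (skewProduct s) (markovShift τ ×ˢ Set.univ)) {b b' : S}
    (hb : Admissible τ [b]) (hb' : Admissible τ [b']) (g : G) :
    ∃ (e : List S) (z : ℕ → S), concat (b :: e) z ∈ markovShift τ ∧ z 0 = b' ∧
      wordProd s (b :: e) = g := by
  obtain ⟨y, hy⟩ := admissible_iff.1 hb
  -- The auxiliary lemma starts from a letter d that may follow b, which keeps the resulting word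
  -- non-empty even when transitivity returns time 0.
  set d := y 0 with hd
  have hd' : Admissible τ [d] :=
    admissible_iff.2 ⟨shift y, by rw [hd, concat_singleton_shift]; exact mem_of_concat_mem hy⟩
  obtain ⟨u, z, h1, h2, h3, h4⟩ := h.exists_word_aux hd' hb' ((s b)⁻¹ * g)
  refine ⟨u, z, ?_, h3, ?_⟩
  · rw [concat_cons_mem_iff]
    refine ⟨?_, h1⟩
    rw [h2]
    exact (concat_cons_mem_iff.1 hy).1
  · rw [wordProd_cons, h4]; simp

end Transitive

/-! ### Comparison of sums -/

section Sums

/-- Every comparison between the series over words, pairs and cuts is an injection of index sets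
with a termwise bound; values in `ENNReal` avoid summability questions. -/
theorem tsum_le_tsum_of_injOn {α β : Type*} {s : Set α} {t : Set β} {f : α → ENNReal}
    {g : β → ENNReal} (φ : α → β) (hmap : Set.MapsTo φ s t) (hinj : Set.InjOn φ s)
    (hle : ∀ z ∈ s, f z ≤ g (φ z)) : ∑' z : s, f z ≤ ∑' z : t, g z := by
  calc ∑' z : s, f z ≤ ∑' z : s, g ((hmap.restrict φ s t z : t)) :=
        ENNReal.tsum_le_tsum fun z => hle z z.2
    _ ≤ ∑' z : t, g z :=
        ENNReal.tsum_comp_le_tsum_of_injective ((hmap.restrict_inj).2 hinj) (fun z : t => g z)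

theorem tsum_subtype_le_of_support {α : Type*} {s t : Set α} {f : α → ENNReal}
    (h : ∀ z ∈ s, f z ≠ 0 → z ∈ t) : ∑' z : s, f z ≤ ∑' z : t, f z := by
  rw [tsum_subtype, tsum_subtype]
  refine ENNReal.tsum_le_tsum fun z => ?_
  by_cases hz : z ∈ s
  · by_cases h0 : f z = 0
    · simp [Set.indicator, h0]
    · simp [hz, h z hz h0]
  · simp [hz]

theorem SlowlyIncreasing.exists_le {c : ℕ → ℝ} (hc : SlowlyIncreasing c) (n : ℕ) {ε : ℝ}
    (hε : 0 < ε) : ∃ m, ∀ k, m ≤ k → c (k + n) ≤ (1 + ε) * c k := by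
  obtain ⟨hpos, -, -, h⟩ := hc
  have := (h n).eventually (gt_mem_nhds (show (1 : ℝ) < 1 + ε by linarith))
  obtain ⟨m, hm⟩ := eventually_atTop.1 this
  exact ⟨m, fun k hk => ((div_lt_iff₀ (hpos k)).1 (hm k hk)).le⟩

end Sums

/-! ### Weighted series over words, pairs of words and cuts -/

/-- A Markov shift with a potential of bounded distortion, a cocycle whose skew product is
transitive, and a non-negative function on the group. The words `post b` and `pre b` join the
letter `b` to `a` and `A` to `b`, with trivial group element. -/
structure WordSystem (S G : Type*) [Group G] where
  τ : S → S → Prop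
  R : (ℕ → S) → ℝ
  s : S → G
  A : S
  a : S
  x : ℕ → S
  -- In the application this is the coefficient g ↦ ⟨ρ(g)f, f⟩; the estimates use only that it is
  -- non-negative, bounded and positive at 1.
  ψ : G → ℝ
  lo : ℝ
  hi : ℝ
  D : ℝ
  θ : ℝ
  lo_pos : 0 < lo
  -- The bounds hold on the whole sequence space, so that weights are positive without membership
  -- conditions; R is altered off the Markov shift to achieve this.
  lo_le : ∀ y, lo ≤ R y
  le_hi : ∀ y, R y ≤ hi
  one_le_D : 1 ≤ D
  distortion : ∀ (m : ℕ) (u : List S) (y z : ℕ → S), concat u y ∈ markovShift τ →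
      concat u z ∈ markovShift τ → (∀ i < m, y i = z i) →
        wordWeight R u y ≤ D ^ (θ ^ m) * wordWeight R u z
  mem_ax : concat [a] x ∈ markovShift τ
  post : S → List S
  pre : S → List S
  post_mem : ∀ b, Admissible τ [b] → concat (b :: post b) x ∈ markovShift τ
  post_last : ∀ b, Admissible τ [b] → (post b).getLast? = some a
  post_prod : ∀ b, Admissible τ [b] → wordProd s (post b) = 1
  pre_mem : ∀ b z, concat [b] z ∈ markovShift τ → concat (pre b ++ [b]) z ∈ markovShift τ
  pre_head : ∀ b, Admissible τ [b] → (pre b).head? = some A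
  pre_prod : ∀ b, Admissible τ [b] → wordProd s (pre b) = 1
  conn : ∀ g, ∃ w, wordProd s w = g ∧ Admissible τ (a :: (w ++ [A]))
  ψ_nonneg : ∀ g, 0 ≤ ψ g
  ψ_one_pos : 0 < ψ 1
  ψbound : ℝ
  ψ_le : ∀ g, ψ g ≤ ψbound

namespace WordSystem

variable {S G : Type*} [Group G] (M : WordSystem S G)

theorem R_pos (y : ℕ → S) : 0 < M.R y := M.lo_pos.trans_le (M.lo_le y)

theorem weight_pos (u : List S) (y : ℕ → S) : 0 < wordWeight M.R u y :=
  wordWeight_pos M.R_pos u y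

theorem pow_le_weight (u : List S) (y : ℕ → S) : M.lo ^ u.length ≤ wordWeight M.R u y :=
  pow_le_birkhoffProd M.lo_pos.le M.lo_le _ _

theorem weight_le_pow (u : List S) (y : ℕ → S) : wordWeight M.R u y ≤ M.hi ^ u.length :=
  birkhoffProd_le_pow (fun y => (M.R_pos y).le) M.le_hi _ _

theorem weight_le (u : List S) {y z : ℕ → S} (hy : concat u y ∈ markovShift M.τ)
    (hz : concat u z ∈ markovShift M.τ) : wordWeight M.R u y ≤ M.D * wordWeight M.R u z := by
  simpa using M.distortion 0 u y z hy hz (by simp)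

/-- The admissible words from `A` to `a`. -/
def Words : Set (List S) :=
  {v | concat v M.x ∈ markovShift M.τ ∧ v.head? = some M.A ∧ v.getLast? = some M.a}

/-- The words from `A` to `a` with a marked letter. -/
def Cuts : Set (List S × S × List S) := {z | z.1 ++ z.2.1 :: z.2.2 ∈ M.Words}

/-- The weight `t^{-|v|} R_{|v|}(v x) ψ(𝔰(v))`. -/
def gibbs (t : ℝ) (v : List S) : ℝ :=
  (t ^ v.length)⁻¹ * wordWeight M.R v M.x * M.ψ (wordProd M.s v)

/-- The weight of a word u w v with s(w) = g once w is deleted and u, v are each followed directly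
by x. -/
def pairWeight (t : ℝ) (g : G) (u v : List S) : ℝ :=
  (t ^ u.length)⁻¹ * (t ^ v.length)⁻¹ * wordWeight M.R u M.x * wordWeight M.R v M.x *
    M.ψ (wordProd M.s u * g * wordProd M.s v)

/-- What is left of `gibbs t (p ++ (w ++ q))` when the factors of w are divided out. Unlike in
`pairWeight`, the product along p still sees its true continuation w q x. -/
def splitWeight (t : ℝ) (w p q : List S) : ℝ :=
  (t ^ p.length)⁻¹ * (t ^ q.length)⁻¹ * wordWeight M.R p (concat (w ++ q) M.x) *
    wordWeight M.R q M.x * M.ψ (wordProd M.s p * wordProd M.s w * wordProd M.s q)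

/-- The marked letter counts to the left in c: when it is the letter a of a cylinder [a w A], the
left word is p a, of length |p| + 1, and c agrees with `pairTerm`. -/
def cutWeight (c : ℕ → ℝ) (t : ℝ) (z : List S × S × List S) : ENNReal :=
  ENNReal.ofReal (M.gibbs t (z.1 ++ z.2.1 :: z.2.2) * (c (z.1.length + 1) * c z.2.2.length))

def wordTerm (c : ℕ → ℝ) (t : ℝ) (v : List S) : ENNReal :=
  ENNReal.ofReal (M.gibbs t v * c v.length)

def pairTerm (c : ℕ → ℝ) (t : ℝ) (g : G) (z : List S × List S) : ENNReal :=
  ENNReal.ofReal (M.pairWeight t g z.1 z.2 * (c z.1.length * c z.2.length))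

def splitTerm (c : ℕ → ℝ) (t : ℝ) (w : List S) (z : List S × List S) : ENNReal :=
  ENNReal.ofReal (M.splitWeight t w z.1 z.2 * (c (z.1.length + 1) * c z.2.length))

/-- The series `∑_v c_{|v|} t^{-|v|} R_{|v|}(v x) ψ(𝔰(v))`. -/
def wordSum (c : ℕ → ℝ) (t : ℝ) : ENNReal :=
  ∑' v : M.Words, M.wordTerm c t v

/-- The limit of the coefficients `⟨ρ(g) (φ_{c;≤N}[t] ∗ f), φ^*_{c;≤N}[t] ∗ f⟩`. -/
def pairSum (c : ℕ → ℝ) (t : ℝ) (g : G) : ENNReal :=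
  ∑' z : M.Words ×ˢ M.Words, M.pairTerm c t g z

def cutTerm (c : ℕ → ℝ) (t : ℝ) (F : (ℕ → S) → ENNReal) (z : List S × S × List S) : ENNReal :=
  M.cutWeight c t z * F (concat (z.2.1 :: z.2.2) M.x)

/-- The integral of `F` for the sum of weighted point masses along the orbits of the points
`v x`. -/
def cutSum (c : ℕ → ℝ) (t : ℝ) (F : (ℕ → S) → ENNReal) : ENNReal :=
  ∑' z : M.Cuts, M.cutTerm c t F z

variable {M}

theorem gibbs_nonneg {t : ℝ} (ht : 0 < t) (v : List S) : 0 ≤ M.gibbs t v :=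
  mul_nonneg (mul_nonneg (by positivity) (M.weight_pos _ _).le) (M.ψ_nonneg _)

theorem pairWeight_nonneg {t : ℝ} (ht : 0 < t) (g : G) (u v : List S) :
    0 ≤ M.pairWeight t g u v :=
  mul_nonneg (mul_nonneg (mul_nonneg (by positivity) (M.weight_pos _ _).le)
    (M.weight_pos _ _).le) (M.ψ_nonneg _)

theorem splitWeight_nonneg {t : ℝ} (ht : 0 < t) (w p q : List S) :
    0 ≤ M.splitWeight t w p q :=
  mul_nonneg (mul_nonneg (mul_nonneg (by positivity) (M.weight_pos _ _).le)
    (M.weight_pos _ _).le) (M.ψ_nonneg _)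

theorem gibbs_split (t : ℝ) (p w q : List S) : M.gibbs t (p ++ (w ++ q)) =
    (t ^ w.length)⁻¹ * wordWeight M.R w (concat q M.x) * M.splitWeight t w p q := by
  simp only [gibbs, splitWeight, wordWeight_append, wordProd_append, List.length_append, pow_add,
    mul_inv]
  rw [mul_assoc (wordProd M.s p)]
  ring

theorem pow_mul_gibbs_split {t : ℝ} (ht : 0 < t) (p w q : List S) :
    t ^ w.length * M.gibbs t (p ++ (w ++ q)) * (wordWeight M.R w (concat q M.x))⁻¹ =
      M.splitWeight t w p q := by
  have h1 := (M.weight_pos w (concat q M.x)).ne'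
  have h2 : t ^ w.length ≠ 0 := by positivity
  rw [gibbs_split]
  field_simp

theorem concat_singleton_mem_of_getLast {τ : S → S → Prop} {u : List S} {b : S} {y : ℕ → S}
    (hu : u.getLast? = some b) (h : concat u y ∈ markovShift τ) :
    concat [b] y ∈ markovShift τ := by
  obtain ⟨u', rfl⟩ := List.getLast?_eq_some_iff.1 hu
  exact concat_mem_of_append h

/-- A word and the length of the tail determine the cut, so each length below m costs at most one
copy of `wordSum`, with the tail factor bounded by c m. -/
theorem tsum_short_tail_le {c : ℕ → ℝ} (hc : SlowlyIncreasing c) {t : ℝ} (ht : 0 < t) (m : ℕ) :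
    ∑' z : {z | z ∈ M.Cuts ∧ z.2.2.length < m}, M.cutWeight c t z ≤
      ENNReal.ofReal (m * c m) * M.wordSum c t := by
  obtain ⟨hpos, hmono, -, -⟩ := hc
  have hsub : {z : List S × S × List S | z ∈ M.Cuts ∧ z.2.2.length < m} ⊆
      ⋃ i ∈ Finset.range m, {z | z ∈ M.Cuts ∧ z.2.2.length = i} := by
    intro z hz
    simp only [Set.mem_iUnion, Finset.mem_range]
    exact ⟨_, hz.2, hz.1, rfl⟩
  refine (ENNReal.tsum_mono_subtype _ hsub).trans ((ENNReal.tsum_biUnion_le _ _ _).trans ?_)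
  have key : ∀ i ∈ Finset.range m, ∑' z : {z | z ∈ M.Cuts ∧ z.2.2.length = i}, M.cutWeight c t z ≤
      ENNReal.ofReal (c m) * M.wordSum c t := by
    intro i hi
    rw [wordSum, ← ENNReal.tsum_mul_left]
    refine tsum_le_tsum_of_injOn (t := M.Words) (g := fun v => ENNReal.ofReal (c m) *
      M.wordTerm c t v) (fun z => z.1 ++ z.2.1 :: z.2.2)
      (fun z hz => hz.1) ?_ ?_
    · rintro ⟨p, b, q⟩ hz ⟨p', b', q'⟩ hz' h
      have hl : q.length = q'.length := hz.2.trans hz'.2.symm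
      have := List.append_inj' h (by simp [hl])
      simp at this
      simp [this]
    · rintro ⟨p, b, q⟩ hz
      rw [wordTerm, ← ENNReal.ofReal_mul (hpos m).le]
      refine ENNReal.ofReal_le_ofReal ?_
      have h1 : c (p.length + 1) ≤ c (p ++ b :: q).length := hmono (by simp)
      have h2 : c q.length ≤ c m := hmono (by
        have := hz.2; simp at this; have := Finset.mem_range.1 hi; omega)
      calc _ ≤ M.gibbs t (p ++ b :: q) * (c (p ++ b :: q).length * c m) := by
            have := gibbs_nonneg (M := M) ht (p ++ b :: q)
            have := (hpos q.length).le
            have := (hpos (p ++ b :: q).length).le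
            dsimp only
            gcongr
        _ = _ := by ring
  calc _ ≤ ∑ i ∈ Finset.range m, ENNReal.ofReal (c m) * M.wordSum c t := Finset.sum_le_sum key
    _ = _ := by
      rw [Finset.sum_const, Finset.card_range, nsmul_eq_mul, ENNReal.ofReal_mul (by positivity),
        ENNReal.ofReal_natCast, mul_assoc]

theorem tsum_nil_head_le {c : ℕ → ℝ} (hc : SlowlyIncreasing c) {t : ℝ} (ht : 0 < t) :
    ∑' z : {z | z ∈ M.Cuts ∧ z.1 = []}, M.cutWeight c t z ≤
      ENNReal.ofReal (c 1) * M.wordSum c t := by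
  obtain ⟨hpos, hmono, -, -⟩ := hc
  rw [wordSum, ← ENNReal.tsum_mul_left]
  refine tsum_le_tsum_of_injOn (t := M.Words) (g := fun v => ENNReal.ofReal (c 1) *
    M.wordTerm c t v) (fun z => z.1 ++ z.2.1 :: z.2.2)
    (fun z hz => hz.1) ?_ ?_
  · rintro ⟨p, b, q⟩ ⟨hz1, rfl : p = []⟩ ⟨p', b', q'⟩ ⟨hz1', rfl : p' = []⟩ h
    simpa using h
  · rintro ⟨p, b, q⟩ ⟨hz1, rfl : p = []⟩
    rw [wordTerm, ← ENNReal.ofReal_mul (hpos 1).le]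
    refine ENNReal.ofReal_le_ofReal ?_
    have h1 : c q.length ≤ c ([] ++ b :: q).length := hmono (by simp)
    calc _ ≤ M.gibbs t ([] ++ b :: q) * (c 1 * c ([] ++ b :: q).length) := by
          have := gibbs_nonneg (M := M) ht ([] ++ b :: q)
          have := (hpos 1).le
          dsimp only [List.length_nil]
          gcongr
      _ = _ := by ring

/-- Inserting words of lengths `k` and `l` changes the weights by bounded factors. -/
theorem insertion_bound {t t₁ lo D X X' Y Y' X₂ P : ℝ} (ht : 0 < t) (htt : t ≤ t₁) (hlo : 0 < lo)
    (i j k l : ℕ) (hX : X ≤ D * X') (hX' : 0 ≤ X') (hD : 0 ≤ D) (hY : lo ^ k ≤ Y)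
    (hY' : lo ^ l ≤ Y') (hX2 : 0 ≤ X₂) (hP : 0 ≤ P) :
    (t ^ i)⁻¹ * (t ^ j)⁻¹ * X * X₂ * P ≤ D * (t₁ / lo) ^ k * (t₁ / lo) ^ l *
      ((t ^ (i + k))⁻¹ * (t ^ (l + j))⁻¹ * (X' * Y) * (Y' * X₂) * P) := by
  -- An inserted word of length n has weight at least lo^n and t^n ≤ t₁^n, so the factor (t₁/lo)^n
  -- pays for it.
  have one_le : ∀ (n : ℕ) (Z : ℝ), lo ^ n ≤ Z → 1 ≤ (t₁ / lo) ^ n * (t ^ n)⁻¹ * Z := by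
    intro n Z hZ
    have h1 : t ^ n ≤ t₁ ^ n := by gcongr
    have h3 : 0 < t ^ n := by positivity
    have h4 : 0 < lo ^ n := by positivity
    rw [div_pow, div_mul_eq_mul_div, div_mul_eq_mul_div, le_div_iff₀ h4, one_mul]
    have : 1 ≤ t₁ ^ n * (t ^ n)⁻¹ := by
      rw [← div_eq_mul_inv, le_div_iff₀ h3, one_mul]; exact h1
    nlinarith
  have hA := one_le k Y hY
  have hB := one_le l Y' hY'
  set a := (t₁ / lo) ^ k * (t ^ k)⁻¹ * Y
  set b := (t₁ / lo) ^ l * (t ^ l)⁻¹ * Y'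
  have hab : 1 ≤ a * b := one_le_mul_of_one_le_of_one_le hA hB
  have h0 : 0 ≤ (t ^ i)⁻¹ * (t ^ j)⁻¹ * (D * X') * X₂ * P := by positivity
  calc (t ^ i)⁻¹ * (t ^ j)⁻¹ * X * X₂ * P ≤ (t ^ i)⁻¹ * (t ^ j)⁻¹ * (D * X') * X₂ * P := by gcongr
    _ ≤ (t ^ i)⁻¹ * (t ^ j)⁻¹ * (D * X') * X₂ * P * (a * b) := le_mul_of_one_le_right h0 hab
    _ = _ := by
      simp only [a, b, pow_add, mul_inv]
      ring

theorem mem_words_append_post {p y : List S} {β : S} (hp : p.getLast? = some β)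
    (h : p ++ y ∈ M.Words) : p ++ M.post β ∈ M.Words := by
  have hβ : Admissible M.τ [β] := admissible_iff.2 ⟨concat y M.x,
    concat_singleton_mem_of_getLast hp (by rw [← concat_append]; exact h.1)⟩
  have hne : p ≠ [] := by rintro rfl; simp at hp
  refine ⟨?_, ?_, ?_⟩
  · rw [concat_append]
    have h1 := h.1
    rw [concat_append] at h1
    refine concat_replace hp h1 ?_
    rw [← concat_append]
    exact M.post_mem β hβ
  · have := h.2.1
    rw [List.head?_append_of_ne_nil _ hne] at this ⊢
    exact this
  · rw [List.getLast?_append, M.post_last β hβ]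
    rfl

theorem mem_words_pre_append {q y : List S} {β : S} (hq : q.head? = some β)
    (h : y ++ q ∈ M.Words) : M.pre β ++ q ∈ M.Words := by
  obtain ⟨q', rfl⟩ := List.head?_eq_some_iff.1 hq
  have h1 : concat [β] (concat q' M.x) ∈ markovShift M.τ := by
    rw [← concat_append]
    exact concat_mem_of_append h.1
  have hβ : Admissible M.τ [β] := admissible_iff.2 ⟨_, h1⟩
  refine ⟨?_, ?_, ?_⟩
  · rw [List.append_cons, concat_append]
    exact M.pre_mem β _ h1
  · rw [List.head?_append, M.pre_head β hβ]
    rfl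
  · have := h.2.2
    rw [List.getLast?_append] at this ⊢
    simpa using this

/-- Sums over the splittings of words of `Words` around a factor `w` are controlled by
`pairSum`. -/
theorem exists_tsum_split_le [Finite S] (M : WordSystem S G) (t₁ : ℝ) (ht₁ : 0 < t₁) :
    ∃ C : ℝ, 1 ≤ C ∧ ∀ c : ℕ → ℝ, SlowlyIncreasing c → ∀ t, 0 < t → t ≤ t₁ → ∀ w : List S,
      ∑' z : {z : List S × List S | z.1 ≠ [] ∧ z.2 ≠ [] ∧ z.1 ++ (w ++ z.2) ∈ M.Words},
        M.splitTerm c t w z ≤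
        ENNReal.ofReal C * M.pairSum c t (wordProd M.s w) := by
  have := Fintype.ofFinite S
  -- β records the last letter of p and the first letter of q. For fixed β the completion (p, q) ↦
  -- (p post β₁, pre β₂ q) is injective and costs E β; the finitely many β are summed, so the
  -- constant does not depend on w.
  let E : S × S → ℝ := fun β =>
    M.D * (t₁ / M.lo) ^ (M.post β.1).length * (t₁ / M.lo) ^ (M.pre β.2).length
  have hD := M.one_le_D
  have hlo := M.lo_pos
  have hE : ∀ β, 0 ≤ E β := fun β => by positivity
  refine ⟨∑ β, E β + 1, by have := Finset.sum_nonneg fun β (_ : β ∈ Finset.univ) => hE β; linarith,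
    ?_⟩
  intro c hc t ht htt w
  obtain ⟨hpos, hmono, -, -⟩ := hc
  have hsub : {z : List S × List S | z.1 ≠ [] ∧ z.2 ≠ [] ∧ z.1 ++ (w ++ z.2) ∈ M.Words} ⊆
      ⋃ β : S × S, {z | (z.1.getLast? = some β.1 ∧ z.2.head? = some β.2) ∧
        z.1 ++ (w ++ z.2) ∈ M.Words} := by
    rintro ⟨p, q⟩ ⟨h1, h2, h3⟩
    exact Set.mem_iUnion.2 ⟨(p.getLast h1, q.head h2),
      ⟨List.getLast?_eq_some_getLast h1, List.head?_eq_some_head h2⟩, h3⟩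
  refine (ENNReal.tsum_mono_subtype _ hsub).trans ((ENNReal.tsum_iUnion_le _ _).trans ?_)
  have key : ∀ β : S × S, ∑' z : {z : List S × List S | (z.1.getLast? = some β.1 ∧
      z.2.head? = some β.2) ∧ z.1 ++ (w ++ z.2) ∈ M.Words},
        M.splitTerm c t w z ≤
        ENNReal.ofReal (E β) * M.pairSum c t (wordProd M.s w) := by
    intro β
    rw [pairSum, ← ENNReal.tsum_mul_left]
    refine tsum_le_tsum_of_injOn (t := M.Words ×ˢ M.Words)
      (g := fun z => ENNReal.ofReal (E β) * M.pairTerm c t (wordProd M.s w) z)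
      (fun z => (z.1 ++ M.post β.1, M.pre β.2 ++ z.2)) ?_ ?_ ?_
    · rintro ⟨p, q⟩ ⟨⟨h1, h2⟩, h3⟩
      exact ⟨mem_words_append_post h1 h3,
        mem_words_pre_append h2 (y := p ++ w) (by rw [List.append_assoc]; exact h3)⟩
    · rintro ⟨p, q⟩ _ ⟨p', q'⟩ _ h
      simpa using h
    · rintro ⟨p, q⟩ ⟨⟨h1, h2⟩, h3⟩
      dsimp only at h1 h2 h3 ⊢
      have hW := mem_words_append_post h1 h3
      have hβ1 : Admissible M.τ [β.1] := admissible_iff.2 ⟨_,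
        concat_singleton_mem_of_getLast h1 (by rw [← concat_append]; exact h3.1)⟩
      obtain ⟨q', hq'⟩ := List.head?_eq_some_iff.1 h2
      have hβ2 : Admissible M.τ [β.2] := admissible_iff.2 ⟨concat q' M.x, by
        rw [← concat_append]
        refine concat_mem_of_append (u := p ++ w) ?_
        rw [List.singleton_append, ← hq', List.append_assoc]
        exact h3.1⟩
      rw [splitTerm, pairTerm, ← ENNReal.ofReal_mul (hE β)]
      refine ENNReal.ofReal_le_ofReal ?_
      have hw : M.splitWeight t w p q ≤
          E β * M.pairWeight t (wordProd M.s w) (p ++ M.post β.1) (M.pre β.2 ++ q) := by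
        have hk := insertion_bound (P := M.ψ (wordProd M.s p * wordProd M.s w * wordProd M.s q)) ht
          htt hlo p.length q.length (M.post β.1).length (M.pre β.2).length
          (M.weight_le p (y := concat (w ++ q) M.x) (z := concat (M.post β.1) M.x)
            (by rw [← concat_append]; exact h3.1) (by rw [← concat_append]; exact hW.1))
          (M.weight_pos _ _).le (by linarith) (M.pow_le_weight (M.post β.1) M.x)
          (M.pow_le_weight (M.pre β.2) (concat q M.x)) (M.weight_pos q M.x).le (M.ψ_nonneg _)
        simp only [splitWeight, pairWeight, wordWeight_append, List.length_append, wordProd_append,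
          M.post_prod _ hβ1, M.pre_prod _ hβ2, mul_one, one_mul]
        exact hk
      -- The length |p| + 1 in `splitTerm` is absorbed by the appended word, which is non-empty.
      have hne : 1 ≤ (M.post β.1).length := by
        have := M.post_last _ hβ1
        rcases hpost : M.post β.1 with _ | ⟨d, l⟩
        · rw [hpost] at this; simp at this
        · simp
      have hc1 : c (p.length + 1) ≤ c (p ++ M.post β.1).length := hmono (by simp; omega)
      have hc2 : c q.length ≤ c (M.pre β.2 ++ q).length := hmono (by simp)
      have hnn := splitWeight_nonneg (M := M) ht w p q
      have := (hpos q.length).le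
      have := (hpos (p ++ M.post β.1).length).le
      have := (hpos (p.length + 1)).le
      calc _ ≤ (E β * M.pairWeight t (wordProd M.s w) (p ++ M.post β.1) (M.pre β.2 ++ q)) *
            (c (p ++ M.post β.1).length * c (M.pre β.2 ++ q).length) := by
            have := hnn.trans hw
            gcongr
        _ = _ := by ring
  calc _ ≤ ∑ β : S × S, ENNReal.ofReal (E β) * M.pairSum c t (wordProd M.s w) :=
        Finset.sum_le_sum fun β _ => key β
    _ = ENNReal.ofReal (∑ β, E β) * M.pairSum c t (wordProd M.s w) := by
        rw [← Finset.sum_mul, ENNReal.ofReal_sum_of_nonneg fun β _ => hE β]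
    _ ≤ _ := by gcongr; linarith

end WordSystem

/-! ### Cut sums of cylinder weights against pair sums -/

namespace WordSystem

variable {S G : Type*} [Group G] {M : WordSystem S G}

/-- The cuts with non-empty initial segment and long tail at which `F` does not vanish. -/
def LongCuts (M : WordSystem S G) (m : ℕ) (F : (ℕ → S) → ENNReal) : Set (List S × S × List S) :=
  {z | z ∈ M.Cuts ∧ z.1 ≠ [] ∧ m ≤ z.2.2.length ∧ F (concat (z.2.1 :: z.2.2) M.x) ≠ 0}

/-- Only the long cuts contribute to `cutSum`, up to a multiple of `wordSum`. -/
theorem cutSum_le_long {c : ℕ → ℝ} (hc : SlowlyIncreasing c) {t : ℝ} (ht : 0 < t) (m : ℕ)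
    {F : (ℕ → S) → ENNReal} {B : ℝ} (hB : 0 ≤ B) (hF : ∀ y, F y ≤ ENNReal.ofReal B) :
    M.cutSum c t F ≤ ENNReal.ofReal (B * (m * c m + c 1)) * M.wordSum c t +
      ∑' z : M.LongCuts m F, M.cutTerm c t F z := by
  have hsub : ∀ z ∈ M.Cuts, M.cutTerm c t F z ≠ 0 →
      z ∈ ({z | z ∈ M.Cuts ∧ z.2.2.length < m} ∪ {z | z ∈ M.Cuts ∧ z.1 = []}) ∪
        M.LongCuts m F := by
    intro z hz h0
    by_cases h1 : z.2.2.length < m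
    · exact Or.inl (Or.inl ⟨hz, h1⟩)
    by_cases h2 : z.1 = []
    · exact Or.inl (Or.inr ⟨hz, h2⟩)
    refine Or.inr ⟨hz, h2, not_lt.1 h1, fun h => h0 ?_⟩
    rw [cutTerm, h, mul_zero]
  have hle : ∀ T : Set (List S × S × List S), ∑' z : T, M.cutTerm c t F z ≤
      ENNReal.ofReal B * ∑' z : T, M.cutWeight c t z := by
    intro T
    rw [← ENNReal.tsum_mul_left]
    refine ENNReal.tsum_le_tsum fun z => ?_
    rw [cutTerm, mul_comm]
    gcongr
    exact hF _
  have hpos := hc.1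
  calc M.cutSum c t F ≤ _ := tsum_subtype_le_of_support hsub
    _ ≤ _ := ENNReal.tsum_union_le _ _ _
    _ ≤ _ := add_le_add_left ((ENNReal.tsum_union_le _ _ _).trans
        (add_le_add ((hle _).trans (mul_le_mul_right (tsum_short_tail_le hc ht m) _))
          ((hle _).trans (mul_le_mul_right (tsum_nil_head_le hc ht) _)))) _
    _ = _ := by
      congr 1
      rw [← mul_add, ← add_mul, ← ENNReal.ofReal_add (by have := (hpos m).le; positivity)
        (hpos 1).le, ENNReal.ofReal_mul hB, mul_assoc]

/-- A cut is a splitting around the empty word. With m = 0 no tail is short, so only the cuts at the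
first letter are lost to `wordSum`. -/
theorem cutSum_one_le_pairSum {C : ℝ} {c : ℕ → ℝ} (hc : SlowlyIncreasing c) {t : ℝ}
    (ht : 0 < t)
    (hC : ∑' z : {z : List S × List S | z.1 ≠ [] ∧ z.2 ≠ [] ∧ z.1 ++ ([] ++ z.2) ∈ M.Words},
        M.splitTerm c t [] z ≤ ENNReal.ofReal C * M.pairSum c t 1) :
    M.cutSum c t (fun _ => 1) ≤ ENNReal.ofReal C * M.pairSum c t 1 +
      ENNReal.ofReal (c 1) * M.wordSum c t := by
  have h1 := cutSum_le_long (M := M) hc ht 0 (F := fun _ => 1) zero_le_one (by simp)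
  obtain ⟨hpos, hmono, -, -⟩ := hc
  simp only [one_mul, Nat.cast_zero, zero_mul, zero_add] at h1
  rw [add_comm]
  refine h1.trans (add_le_add_right (le_trans ?_ hC) _)
  refine tsum_le_tsum_of_injOn (fun z => (z.1, z.2.1 :: z.2.2)) ?_ ?_ ?_
  · rintro ⟨p, b, q⟩ ⟨hz, hp, -⟩
    exact ⟨hp, by simp, hz⟩
  · rintro ⟨p, b, q⟩ - ⟨p', b', q'⟩ - h
    simpa using h
  · rintro ⟨p, b, q⟩ ⟨hz, hp, -⟩
    rw [cutTerm, mul_one, cutWeight, splitTerm]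
    refine ENNReal.ofReal_le_ofReal ?_
    have h := gibbs_split (M := M) t p [] (b :: q)
    simp only [List.nil_append, List.length_nil, pow_zero, inv_one, wordWeight_nil, one_mul] at h
    dsimp only
    rw [h]
    have := splitWeight_nonneg (M := M) ht [] p (b :: q)
    have := (hpos (p.length + 1)).le
    gcongr
    exact hmono (by simp)

/-- The inverse Birkhoff product on a cylinder. -/
def cylWeight (R : (ℕ → S) → ℝ) (w : List S) : (ℕ → S) → ENNReal :=
  (cyl w).indicator fun y => ENNReal.ofReal (birkhoffProd R w.length y)⁻¹

/-- The inverse Birkhoff product along the middle word of a cylinder `[a w A]`. -/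
def midWeight (R : (ℕ → S) → ℝ) (a : S) (w : List S) (A : S) : (ℕ → S) → ENNReal :=
  (cyl (a :: (w ++ [A]))).indicator fun y => ENNReal.ofReal (birkhoffProd R w.length (shift y))⁻¹

theorem inv_birkhoffProd_le (M : WordSystem S G) (n : ℕ) (y : ℕ → S) :
    (birkhoffProd M.R n y)⁻¹ ≤ (M.lo ^ n)⁻¹ :=
  inv_anti₀ (pow_pos M.lo_pos n) (pow_le_birkhoffProd M.lo_pos.le M.lo_le n y)

theorem cylWeight_le (M : WordSystem S G) (w : List S) (y : ℕ → S) :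
    cylWeight M.R w y ≤ ENNReal.ofReal (M.lo ^ w.length)⁻¹ :=
  Set.indicator_le' (fun _ _ => ENNReal.ofReal_le_ofReal (M.inv_birkhoffProd_le _ _))
    (fun _ _ => zero_le) y

theorem midWeight_le (M : WordSystem S G) (a : S) (w : List S) (A : S) (y : ℕ → S) :
    midWeight M.R a w A y ≤ ENNReal.ofReal (M.lo ^ w.length)⁻¹ :=
  Set.indicator_le' (fun _ _ => ENNReal.ofReal_le_ofReal (M.inv_birkhoffProd_le _ _))
    (fun _ _ => zero_le) y

theorem cylWeight_concat (R : (ℕ → S) → ℝ) (w : List S) (y : ℕ → S) :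
    cylWeight R w (concat w y) = ENNReal.ofReal (wordWeight R w y)⁻¹ :=
  Set.indicator_of_mem (concat_mem_cyl w y) _

theorem midWeight_concat (R : (ℕ → S) → ℝ) (a : S) (w : List S) (A : S) (y : ℕ → S)
    (hy : y 0 = A) :
    midWeight R a w A (concat (a :: w) y) = ENNReal.ofReal (wordWeight R w y)⁻¹ := by
  have h : concat (a :: w) y = concat (a :: (w ++ [A])) (shift y) := by
    rw [← List.cons_append, concat_append, ← hy, concat_singleton_shift]
  rw [midWeight, Set.indicator_of_mem]
  · rfl
  · rw [h]; exact concat_mem_cyl _ _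

/-- The cylinder weight cancels the product of R along w, and t^{|w|} cancels the corresponding
power of t. -/
theorem pow_mul_cutWeight {c : ℕ → ℝ} (hc : SlowlyIncreasing c) {t : ℝ} (ht : 0 < t)
    {p q w r : List S} {b : S} (h : p ++ b :: q = p ++ (w ++ r)) :
    ENNReal.ofReal (t ^ w.length) * (M.cutWeight c t (p, b, q) *
      ENNReal.ofReal (wordWeight M.R w (concat r M.x))⁻¹) =
      ENNReal.ofReal (M.splitWeight t w p r * (c (p.length + 1) * c q.length)) := by
  have hpos := hc.1
  rw [cutWeight, ← ENNReal.ofReal_mul, ← ENNReal.ofReal_mul (by positivity),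
    ← pow_mul_gibbs_split ht p w r, ← h]
  · congr 1; ring
  · have := gibbs_nonneg (M := M) ht (p ++ b :: q)
    have := (hpos (p.length + 1)).le
    have := (hpos q.length).le
    positivity

/-- A long tail in [w] factors as w r, and c at the tail is at most twice c at r by slow increase;
this is the factor 2. The dependence on w of what counts as long goes into B, in front of the
negligible `wordSum`. -/
theorem cylWeight_upper (M : WordSystem S G) {t₁ C : ℝ} (ht₁ : 0 < t₁) {c : ℕ → ℝ}
    (hc : SlowlyIncreasing c) {w : List S}
    (hC : ∀ t, 0 < t → t ≤ t₁ → ∑' z : {z : List S × List S | z.1 ≠ [] ∧ z.2 ≠ [] ∧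
      z.1 ++ (w ++ z.2) ∈ M.Words}, M.splitTerm c t w z ≤
        ENNReal.ofReal C * M.pairSum c t (wordProd M.s w)) :
    ∃ B : ℝ, 0 ≤ B ∧ ∀ t, 0 < t → t ≤ t₁ →
      ENNReal.ofReal (t ^ w.length) * M.cutSum c t (cylWeight M.R w) ≤
        ENNReal.ofReal (2 * C) * M.pairSum c t (wordProd M.s w) +
          ENNReal.ofReal B * M.wordSum c t := by
  obtain ⟨m, hm⟩ := hc.exists_le w.length zero_lt_one
  have hpos := hc.1
  have hmono := hc.2.1
  have hlo := M.lo_pos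
  set B := (M.lo ^ w.length)⁻¹ * ((w.length + m : ℕ) * c (w.length + m) + c 1) with hBdef
  have hB : 0 ≤ B := by
    have := (hpos (w.length + m)).le
    have := (hpos 1).le
    positivity
  refine ⟨t₁ ^ w.length * B, by positivity, fun t ht htt => ?_⟩
  have h1 := cutSum_le_long (M := M) hc ht (w.length + m) (F := cylWeight M.R w)
    (B := (M.lo ^ w.length)⁻¹) (by positivity) (M.cylWeight_le w)
  rw [← hBdef] at h1
  refine (mul_le_mul_right h1 _).trans ?_
  rw [mul_add, add_comm]
  refine add_le_add ?_ ?_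
  · rw [← ENNReal.tsum_mul_left, ENNReal.ofReal_mul zero_le_two, mul_assoc]
    refine le_trans ?_ (mul_le_mul_right (hC t ht htt) _)
    rw [← ENNReal.tsum_mul_left]
    have hdec : ∀ z ∈ M.LongCuts (w.length + m) (cylWeight M.R w),
        w ++ (z.2.1 :: z.2.2).drop w.length = z.2.1 :: z.2.2 := by
      rintro ⟨p, b, q⟩ ⟨-, -, hl, hF⟩
      have : concat (b :: q) M.x ∈ cyl w := by
        by_contra h
        exact hF (Set.indicator_of_notMem h _)
      rw [concat_mem_cyl_iff (by simp at hl ⊢; omega)] at this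
      obtain ⟨r, hr⟩ := this
      simp only [← hr, List.drop_left]
    refine tsum_le_tsum_of_injOn
      (f := fun z => ENNReal.ofReal (t ^ w.length) * M.cutTerm c t (cylWeight M.R w) z)
      (g := fun z => ENNReal.ofReal 2 * M.splitTerm c t w z)
      (fun z => (z.1, (z.2.1 :: z.2.2).drop w.length)) ?_ ?_ ?_
    · rintro ⟨p, b, q⟩ hz
      refine ⟨hz.2.1, ?_, ?_⟩
      · have := hz.2.2.1
        intro h
        have := congrArg List.length h
        simp at *
        omega
      · dsimp only
        rw [hdec _ hz]
        exact hz.1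
    · rintro ⟨p, b, q⟩ hz ⟨p', b', q'⟩ hz' h
      have e1 := hdec _ hz
      have e2 := hdec _ hz'
      simp only [Prod.mk.injEq] at h e1 e2
      rw [h.2, e2] at e1
      simp at e1
      simp [h.1, e1]
    · rintro ⟨p, b, q⟩ hz
      have e1 := hdec _ hz
      dsimp only at e1 ⊢
      have hlen := hz.2.2.1
      set r := (b :: q).drop w.length with hr
      have hl : w.length + r.length = q.length + 1 := by
        rw [← List.length_append, e1]; simp
      rw [cutTerm]
      dsimp only
      rw [← e1, concat_append, cylWeight_concat,
        pow_mul_cutWeight hc ht (by rw [e1]), splitTerm, ← ENNReal.ofReal_mul zero_le_two]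
      refine ENNReal.ofReal_le_ofReal ?_
      have h2 : c q.length ≤ 2 * c r.length := by
        refine (hmono (show q.length ≤ r.length + w.length by omega)).trans ?_
        have := hm r.length (by simp at hlen; omega)
        linarith
      have := splitWeight_nonneg (M := M) ht w p r
      have := (hpos (p.length + 1)).le
      calc _ ≤ M.splitWeight t w p r * (c (p.length + 1) * (2 * c r.length)) := by gcongr
        _ = _ := by ring
  · rw [← mul_assoc, ← ENNReal.ofReal_mul (by positivity)]
    gcongr

theorem getLast?_prefix_mem {u r : List S} (hu : u.getLast? = some M.a) (h : u ++ r ∈ M.Words) :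
    u ∈ M.Words := by
  have hne : u ≠ [] := by rintro rfl; simp at hu
  refine ⟨?_, ?_, hu⟩
  · have := h.1
    rw [concat_append] at this
    exact concat_replace hu this M.mem_ax
  · have := h.2.1
    rwa [List.head?_append_of_ne_nil _ hne] at this

theorem head?_suffix_mem {v r : List S} (hv : v.head? = some M.A) (h : r ++ v ∈ M.Words) :
    v ∈ M.Words := by
  have hne : v ≠ [] := by rintro rfl; simp at hv
  refine ⟨concat_mem_of_append h.1, hv, ?_⟩
  have := h.2.2
  rwa [List.getLast?_append_of_ne_nil _ hne] at this

/-- Words from `A` to `a` may be joined through any word `w` such that `a w A` is admissible. -/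
theorem join_mem {u w v : List S} (hu : u ∈ M.Words) (hw : Admissible M.τ (M.a :: (w ++ [M.A])))
    (hv : v ∈ M.Words) : u ++ (w ++ v) ∈ M.Words := by
  obtain ⟨z, hz⟩ := admissible_iff.1 hw
  obtain ⟨v', rfl⟩ := List.head?_eq_some_iff.1 hv.2.1
  have hne : u ≠ [] := by rintro rfl; have := hu.2.1; simp at this
  have h1 : concat (M.a :: (w ++ [M.A])) (concat v' M.x) ∈ markovShift M.τ := by
    refine concat_replace (b := M.A) ?_ hz ?_
    · rw [← List.cons_append, List.getLast?_append]; rfl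
    · rw [← concat_append]; exact hv.1
  refine ⟨?_, ?_, ?_⟩
  · rw [concat_append]
    refine concat_replace hu.2.2 hu.1 ?_
    rw [← concat_append] at h1 ⊢
    simpa using h1
  · rw [List.head?_append_of_ne_nil _ hne]; exact hu.2.1
  · rw [List.getLast?_append_of_ne_nil _ (by simp), List.getLast?_append_of_ne_nil _ (by simp)]
    exact hv.2.2

/-- Join u and v through w and mark the last letter of u. There is no error term, since monotonicity
gives c_{|v|} ≤ c_{|wv|} in the required direction; only the product along u is distorted. -/
theorem midWeight_lower {c : ℕ → ℝ} (hc : SlowlyIncreasing c) {t : ℝ} (ht : 0 < t) {w : List S}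
    (hw : Admissible M.τ (M.a :: (w ++ [M.A]))) :
    M.pairSum c t (wordProd M.s w) ≤ ENNReal.ofReal (M.D ^ (M.θ ^ wedge w M.x)) *
      (ENNReal.ofReal (t ^ w.length) * M.cutSum c t (midWeight M.R M.a w M.A)) := by
  obtain ⟨hpos, hmono, -, -⟩ := id hc
  have hD := zero_le_one.trans M.one_le_D
  rw [cutSum, ← ENNReal.tsum_mul_left, ← ENNReal.tsum_mul_left]
  refine tsum_le_tsum_of_injOn (f := M.pairTerm c t (wordProd M.s w))
    (g := fun z => ENNReal.ofReal (M.D ^ (M.θ ^ wedge w M.x)) *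
      (ENNReal.ofReal (t ^ w.length) * M.cutTerm c t (midWeight M.R M.a w M.A) z))
    (fun z => (z.1.dropLast, M.a, w ++ z.2)) ?_ ?_ ?_
  · rintro ⟨u, v⟩ ⟨hu, hv⟩
    obtain ⟨u', rfl⟩ := List.getLast?_eq_some_iff.1 hu.2.2
    have := join_mem hu hw hv
    simpa [Cuts] using this
  · rintro ⟨u, v⟩ ⟨hu, hv⟩ ⟨u₂, v₂⟩ ⟨hu₂, hv₂⟩ h
    obtain ⟨u', hu'⟩ := List.getLast?_eq_some_iff.1 hu.2.2
    obtain ⟨u₂', hu₂'⟩ := List.getLast?_eq_some_iff.1 hu₂.2.2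
    simp only at hu' hu₂'
    subst hu' hu₂'
    simpa using h
  · rintro ⟨u, v⟩ ⟨hu, hv⟩
    obtain ⟨u', hu'⟩ := List.getLast?_eq_some_iff.1 hu.2.2
    simp only at hu'
    subst hu'
    have hj := join_mem hu hw hv
    dsimp only at hu hv hj ⊢
    have hv0 : concat v M.x 0 = M.A := by
      obtain ⟨v', rfl⟩ := List.head?_eq_some_iff.1 hv.2.1
      rfl
    have hsplit : u' ++ M.a :: (w ++ v) = u' ++ ([M.a] ++ w ++ v) := by simp
    rw [cutTerm]
    dsimp only
    rw [List.dropLast_concat, ← List.cons_append, concat_append, midWeight_concat _ _ _ _ _ hv0]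
    have hg : M.cutWeight c t (u', M.a, w ++ v) = ENNReal.ofReal
        (M.gibbs t ((u' ++ [M.a]) ++ (w ++ v)) * (c (u'.length + 1) * c (w ++ v).length)) := by
      rw [cutWeight]; simp
    have hx : wordWeight M.R (u' ++ [M.a]) M.x ≤ M.D ^ (M.θ ^ wedge w M.x) *
        wordWeight M.R (u' ++ [M.a]) (concat (w ++ v) M.x) := by
      refine M.distortion _ _ _ _ hu.1 (by rw [← concat_append]; exact hj.1) fun i hi => ?_
      rw [concat_append, concat_eq_of_lt_wedge _ _ _ _ hi]
    have hgn := gibbs_nonneg (M := M) ht (u' ++ [M.a] ++ (w ++ v))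
    have hc1 := (hpos (u'.length + 1)).le
    have hc2 := (hpos (w ++ v).length).le
    have hc3 := (hpos v.length).le
    rw [hg, ← ENNReal.ofReal_mul (by positivity), ← ENNReal.ofReal_mul (by positivity),
      ← ENNReal.ofReal_mul (by positivity), pairTerm]
    refine ENNReal.ofReal_le_ofReal ?_
    have e : t ^ w.length * (M.gibbs t (u' ++ [M.a] ++ (w ++ v)) *
        (c (u'.length + 1) * c (w ++ v).length) * (wordWeight M.R w (concat v M.x))⁻¹) =
        M.splitWeight t w (u' ++ [M.a]) v * (c (u'.length + 1) * c (w ++ v).length) := by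
      rw [← pow_mul_gibbs_split ht]; ring
    rw [e]
    have hp : M.pairWeight t (wordProd M.s w) (u' ++ [M.a]) v ≤
        M.D ^ (M.θ ^ wedge w M.x) * M.splitWeight t w (u' ++ [M.a]) v := by
      have h1 := (M.weight_pos v M.x).le
      have h2 := M.ψ_nonneg (wordProd M.s (u' ++ [M.a]) * wordProd M.s w * wordProd M.s v)
      simp only [pairWeight, splitWeight]
      calc _ ≤ (t ^ (u' ++ [M.a]).length)⁻¹ * (t ^ v.length)⁻¹ * (M.D ^ (M.θ ^ wedge w M.x) *
        wordWeight M.R (u' ++ [M.a]) (concat (w ++ v) M.x)) * wordWeight M.R v M.x *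
          M.ψ (wordProd M.s (u' ++ [M.a]) * wordProd M.s w * wordProd M.s v) := by gcongr
        _ = _ := by ring
    have hcl : c v.length ≤ c (w ++ v).length := hmono (by simp)
    have hpn := (pairWeight_nonneg (M := M) ht (wordProd M.s w) (u' ++ [M.a]) v).trans hp
    have hul : (u' ++ [M.a]).length = u'.length + 1 := by simp
    rw [hul]
    dsimp only
    calc _ ≤ M.D ^ (M.θ ^ wedge w M.x) * M.splitWeight t w (u' ++ [M.a]) v *
          (c (u'.length + 1) * c (w ++ v).length) := by gcongr
      _ = _ := by ring

/-- Inverse of the joining map: a long tail in [a w A] determines a left word ending at the marked a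
and a right word beginning at A. Arbitrary ε, instead of a factor 2, leaves only the distortion
constant in the limit. -/
theorem midWeight_upper (M : WordSystem S G) {t₁ : ℝ} (ht₁ : 0 < t₁) {c : ℕ → ℝ}
    (hc : SlowlyIncreasing c) {w : List S} {ε : ℝ} (hε : 0 < ε) :
    ∃ B : ℝ, 0 ≤ B ∧ ∀ t, 0 < t → t ≤ t₁ →
      ENNReal.ofReal (t ^ w.length) * M.cutSum c t (midWeight M.R M.a w M.A) ≤
        ENNReal.ofReal ((1 + ε) * M.D ^ (M.θ ^ wedge w M.x)) * M.pairSum c t (wordProd M.s w) +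
          ENNReal.ofReal B * M.wordSum c t := by
  obtain ⟨m, hm⟩ := hc.exists_le w.length hε
  have hpos := hc.1
  have hmono := hc.2.1
  have hlo := M.lo_pos
  have hD := zero_le_one.trans M.one_le_D
  -- Such tails contain w A entirely, and what follows w is long enough for the 1 + ε bound on c.
  set k := w.length + 1 + m with hk
  set B := (M.lo ^ w.length)⁻¹ * (k * c k + c 1) with hBdef
  have hB : 0 ≤ B := by
    have := (hpos k).le
    have := (hpos 1).le
    positivity
  refine ⟨t₁ ^ w.length * B, by positivity, fun t ht htt => ?_⟩
  have h1 := cutSum_le_long (M := M) hc ht k (F := midWeight M.R M.a w M.A)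
    (B := (M.lo ^ w.length)⁻¹) (by positivity) (M.midWeight_le M.a w M.A)
  rw [← hBdef] at h1
  refine (mul_le_mul_right h1 _).trans ?_
  rw [mul_add, add_comm]
  refine add_le_add ?_ ?_
  · rw [pairSum, ← ENNReal.tsum_mul_left, ← ENNReal.tsum_mul_left]
    have hdec : ∀ z ∈ M.LongCuts k (midWeight M.R M.a w M.A), z.2.1 = M.a ∧
        w ++ z.2.2.drop w.length = z.2.2 ∧ (z.2.2.drop w.length).head? = some M.A := by
      rintro ⟨p, b, q⟩ ⟨-, -, hl, hF⟩
      have : concat (b :: q) M.x ∈ cyl (M.a :: (w ++ [M.A])) := by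
        by_contra h
        exact hF (Set.indicator_of_notMem h _)
      rw [concat_mem_cyl_iff (by simp at hl ⊢; omega)] at this
      obtain ⟨r, hr⟩ := this
      simp only [List.cons_append, List.append_assoc, List.cons.injEq] at hr
      obtain ⟨h1, h2⟩ := hr
      simp [← h1, ← h2]
    refine tsum_le_tsum_of_injOn
      (f := fun z => ENNReal.ofReal (t ^ w.length) * M.cutTerm c t (midWeight M.R M.a w M.A) z)
      (g := fun z => ENNReal.ofReal ((1 + ε) * M.D ^ (M.θ ^ wedge w M.x)) *
        M.pairTerm c t (wordProd M.s w) z)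
      (fun z => (z.1 ++ [M.a], z.2.2.drop w.length)) ?_ ?_ ?_
    · rintro ⟨p, b, q⟩ hz
      obtain ⟨e1, e2, e3⟩ := hdec _ hz
      have hz1 := hz.1
      simp only [Cuts, Set.mem_ofPred_eq] at hz1 e1 e2 e3
      rw [e1, ← e2] at hz1
      refine ⟨getLast?_prefix_mem (r := w ++ q.drop w.length) (by simp) (by simpa using hz1),
        head?_suffix_mem (r := p ++ M.a :: w) e3 (by simpa using hz1)⟩
    · rintro ⟨p, b, q⟩ hz ⟨p', b', q'⟩ hz' h
      obtain ⟨e1, e2, -⟩ := hdec _ hz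
      obtain ⟨e1', e2', -⟩ := hdec _ hz'
      simp only [Prod.mk.injEq, List.append_cancel_right_eq] at h e1 e2 e1' e2'
      rw [h.2, e2'] at e2
      simp [h.1, e1, e1', e2]
    · rintro ⟨p, b, q⟩ hz
      obtain ⟨e1, e2, e3⟩ := hdec _ hz
      have hz1 : p ++ b :: q ∈ M.Words := hz.1
      have hlen : k ≤ q.length := hz.2.2.1
      simp only at e1 e2 e3
      subst e1
      dsimp only
      set r := q.drop w.length with hr
      have hl : w.length + r.length = q.length := by
        rw [← List.length_append, e2]
      have hr0 : concat r M.x 0 = M.A := by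
        obtain ⟨v', hv'⟩ := List.head?_eq_some_iff.1 e3
        rw [hv']
        rfl
      have hcut : M.cutWeight c t (p, M.a, q) = ENNReal.ofReal
          (M.gibbs t ((p ++ [M.a]) ++ (w ++ r)) * (c (p.length + 1) * c q.length)) := by
        rw [cutWeight, e2]; simp
      have hpw : (p ++ [M.a]) ++ (w ++ r) ∈ M.Words := by rw [e2]; simpa using hz1
      have hu := getLast?_prefix_mem (M := M) (by simp) hpw
      have hx : wordWeight M.R (p ++ [M.a]) (concat (w ++ r) M.x) ≤ M.D ^ (M.θ ^ wedge w M.x) *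
          wordWeight M.R (p ++ [M.a]) M.x := by
        refine M.distortion _ _ _ _ (by rw [← concat_append]; exact hpw.1) hu.1 fun i hi => ?_
        rw [concat_append, concat_eq_of_lt_wedge _ _ _ _ hi]
      rw [cutTerm]
      dsimp only
      have hgn := gibbs_nonneg (M := M) ht (p ++ [M.a] ++ (w ++ r))
      have hc1 := (hpos (p.length + 1)).le
      have hc2 := (hpos q.length).le
      have hc3 := (hpos r.length).le
      have hmw : midWeight M.R M.a w M.A (concat (M.a :: q) M.x) =
          ENNReal.ofReal (wordWeight M.R w (concat r M.x))⁻¹ := by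
        rw [← midWeight_concat _ _ _ _ _ hr0, ← concat_append, List.cons_append, e2]
      rw [hmw, hcut, ← ENNReal.ofReal_mul (by positivity), ← ENNReal.ofReal_mul (by positivity),
        pairTerm, ← ENNReal.ofReal_mul (by positivity)]
      refine ENNReal.ofReal_le_ofReal ?_
      have e : t ^ w.length * (M.gibbs t (p ++ [M.a] ++ (w ++ r)) *
          (c (p.length + 1) * c q.length) * (wordWeight M.R w (concat r M.x))⁻¹) =
          M.splitWeight t w (p ++ [M.a]) r * (c (p.length + 1) * c q.length) := by
        rw [← pow_mul_gibbs_split ht]; ring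
      rw [e]
      have hp : M.splitWeight t w (p ++ [M.a]) r ≤
          M.D ^ (M.θ ^ wedge w M.x) * M.pairWeight t (wordProd M.s w) (p ++ [M.a]) r := by
        have h1 := (M.weight_pos r M.x).le
        have h2 := M.ψ_nonneg (wordProd M.s (p ++ [M.a]) * wordProd M.s w * wordProd M.s r)
        simp only [pairWeight, splitWeight]
        calc _ ≤ (t ^ (p ++ [M.a]).length)⁻¹ * (t ^ r.length)⁻¹ * (M.D ^ (M.θ ^ wedge w M.x) *
          wordWeight M.R (p ++ [M.a]) M.x) * wordWeight M.R r M.x *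
            M.ψ (wordProd M.s (p ++ [M.a]) * wordProd M.s w * wordProd M.s r) := by gcongr
          _ = _ := by ring
      have hcl : c q.length ≤ (1 + ε) * c r.length := by
        rw [← hl, add_comm]
        exact hm _ (by omega)
      have hpn := (splitWeight_nonneg (M := M) ht w (p ++ [M.a]) r).trans hp
      have hul : (p ++ [M.a]).length = p.length + 1 := by simp
      rw [hul]
      calc _ ≤ M.D ^ (M.θ ^ wedge w M.x) * M.pairWeight t (wordProd M.s w) (p ++ [M.a]) r *
            (c (p.length + 1) * ((1 + ε) * c r.length)) := by gcongr
        _ = _ := by ring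
  · rw [← mul_assoc, ← ENNReal.ofReal_mul (by positivity)]
    gcongr

end WordSystem

/-! ### Lower bound for cylinders, near invariance, negligibility of `wordSum` -/

namespace WordSystem

variable {S G : Type*} [Group G] {M : WordSystem S G}

/-- Send (u, v) to u κ pre(b) w post(β) κ v, marked at the first letter of w. Here b and β are the
end letters of w, κ has trivial group element and a κ A is admissible. The insertions do not change
the argument of ψ and depend on (b, β) only, whence a constant uniform in w. -/
theorem exists_cylWeight_lower [Finite S] (M : WordSystem S G) {t₁ : ℝ} (ht₁ : 0 < t₁) :
    ∃ C : ℝ, 1 ≤ C ∧ ∀ c : ℕ → ℝ, SlowlyIncreasing c → ∀ t, 0 < t → t ≤ t₁ → ∀ w : List S, w ≠ [] →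
      Admissible M.τ w → M.pairSum c t (wordProd M.s w) ≤ ENNReal.ofReal C *
        (ENNReal.ofReal (t ^ w.length) * M.cutSum c t (cylWeight M.R w)) := by
  obtain ⟨κ, hκ1, hκ⟩ := M.conn 1
  have hD := M.one_le_D
  have hlo := M.lo_pos
  let E : S × S → ℝ := fun β => M.D * (t₁ / M.lo) ^ (κ ++ M.pre β.1).length *
    (t₁ / M.lo) ^ (M.post β.2 ++ κ).length
  obtain ⟨C, hC⟩ := Finite.exists_le E
  refine ⟨max 1 C, le_max_left _ _, fun c hc t ht htt w hne hw => ?_⟩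
  obtain ⟨hpos, hmono, -, -⟩ := id hc
  obtain ⟨b, w', rfl⟩ := List.exists_cons_of_ne_nil hne
  obtain ⟨β, hβ⟩ : ∃ β, (b :: w').getLast? = some β := ⟨_, List.getLast?_eq_some_getLast hne⟩
  obtain ⟨y, hy⟩ := admissible_iff.1 hw
  have hbA : Admissible M.τ [b] := admissible_iff.2 ⟨concat w' y, by rw [← concat_append]; exact hy⟩
  have hβA : Admissible M.τ [β] := admissible_iff.2 ⟨y, concat_singleton_mem_of_getLast hβ hy⟩
  have hE : E (b, β) ≤ max 1 C := (hC _).trans (le_max_right _ _)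
  have hmid : ∀ u ∈ M.Words, ∀ v ∈ M.Words,
      (u ++ (κ ++ M.pre b)) ++ ((b :: w') ++ ((M.post β ++ κ) ++ v)) ∈ M.Words := by
    intro u hu v hv
    have h2 : concat ((b :: w') ++ M.post β) M.x ∈ markovShift M.τ := by
      rw [concat_append]
      refine concat_replace hβ hy ?_
      rw [← concat_append]
      exact M.post_mem β hβA
    have h3 : M.pre b ++ ((b :: w') ++ M.post β) ∈ M.Words := by
      refine ⟨?_, ?_, ?_⟩
      · rw [List.cons_append, List.append_cons, concat_append]
        refine M.pre_mem b _ ?_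
        rw [← concat_append]
        exact h2
      · rw [List.head?_append, M.pre_head b hbA]; rfl
      · rw [← List.append_assoc, List.getLast?_append, M.post_last β hβA]; rfl
    have := join_mem (join_mem hu hκ h3) hκ hv
    simpa using this
  have hE0 : 0 ≤ E (b, β) := by positivity
  refine le_trans ?_ (mul_le_mul_left (ENNReal.ofReal_le_ofReal hE) _)
  rw [cutSum, ← ENNReal.tsum_mul_left, ← ENNReal.tsum_mul_left]
  refine tsum_le_tsum_of_injOn (f := M.pairTerm c t (wordProd M.s (b :: w')))
    (g := fun z => ENNReal.ofReal (E (b, β)) *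
      (ENNReal.ofReal (t ^ (b :: w').length) * M.cutTerm c t (cylWeight M.R (b :: w')) z))
    (fun z => (z.1 ++ (κ ++ M.pre b), b, w' ++ ((M.post β ++ κ) ++ z.2))) ?_ ?_ ?_
  · rintro ⟨u, v⟩ ⟨hu, hv⟩
    exact hmid u hu v hv
  · rintro ⟨u, v⟩ ⟨hu, hv⟩ ⟨u₂, v₂⟩ ⟨hu₂, hv₂⟩ h
    simp only [Prod.mk.injEq, List.append_cancel_right_eq, List.append_cancel_left_eq] at h
    simp [h.1, h.2.2]
  · rintro ⟨u, v⟩ ⟨hu, hv⟩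
    have hm := hmid u hu v hv
    set P := κ ++ M.pre b with hP
    set Q := M.post β ++ κ with hQ
    have hPp : wordProd M.s P = 1 := by rw [hP, wordProd_append, hκ1, M.pre_prod b hbA, one_mul]
    have hQp : wordProd M.s Q = 1 := by rw [hQ, wordProd_append, hκ1, M.post_prod β hβA, one_mul]
    rw [cutTerm]
    dsimp only
    rw [← List.cons_append, concat_append, cylWeight_concat,
      pow_mul_cutWeight (p := u ++ P) (b := b) (q := w' ++ (Q ++ v)) hc ht (w := b :: w')
        (r := Q ++ v) rfl, pairTerm,
      ← ENNReal.ofReal_mul hE0]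
    refine ENNReal.ofReal_le_ofReal ?_
    have hk := insertion_bound
      (P := M.ψ (wordProd M.s u * wordProd M.s (b :: w') * wordProd M.s v)) ht
      htt hlo u.length v.length P.length Q.length
      (M.weight_le u (y := M.x) (z := concat P (concat ((b :: w') ++ (Q ++ v)) M.x)) hu.1
        (by rw [← concat_append, ← concat_append]
            simpa using hm.1))
      (M.weight_pos _ _).le (by linarith)
      (M.pow_le_weight P (concat ((b :: w') ++ (Q ++ v)) M.x))
      (M.pow_le_weight Q (concat v M.x)) (M.weight_pos v M.x).le (M.ψ_nonneg _)
    have hp : M.pairWeight t (wordProd M.s (b :: w')) u v ≤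
        E (b, β) * M.splitWeight t (b :: w') (u ++ P) (Q ++ v) := by
      simp only [splitWeight, pairWeight, wordWeight_append, List.length_append, wordProd_append,
        hPp, hQp, mul_one, one_mul]
      simp only [E, ← hP, ← hQ]
      exact hk
    have hpn := (pairWeight_nonneg (M := M) ht (wordProd M.s (b :: w')) u v).trans hp
    have hc1 : c u.length ≤ c ((u ++ P).length + 1) := hmono (by simp; omega)
    have hc2 : c v.length ≤ c (w' ++ (Q ++ v)).length := hmono (by simp; omega)
    have := (hpos ((u ++ P).length + 1)).le
    have := (hpos v.length).le
    have := (hpos u.length).le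
    calc _ ≤ E (b, β) * M.splitWeight t (b :: w') (u ++ P) (Q ++ v) *
          (c ((u ++ P).length + 1) * c (w' ++ (Q ++ v)).length) := by
          dsimp only
          gcongr
      _ = _ := by ring

/-- Approximate invariance under the shift. -/
theorem cutSum_shift_le (M : WordSystem S G) {c : ℕ → ℝ} (hc : SlowlyIncreasing c)
    {F : (ℕ → S) → ENNReal} {B : ℝ} (hB : 0 ≤ B) (hF : ∀ y, F y ≤ ENNReal.ofReal B)
    {ε : ℝ} (hε : 0 < ε) :
    ∃ C : ℝ, 0 ≤ C ∧ ∀ t, 0 < t → M.cutSum c t (fun y => F (shift y)) ≤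
        ENNReal.ofReal (1 + ε) * M.cutSum c t F + ENNReal.ofReal C * M.wordSum c t := by
  obtain ⟨m, hm⟩ := hc.exists_le 1 hε
  have hpos := hc.1
  have hmono := hc.2.1
  refine ⟨B * ((m + 1 : ℕ) * c (m + 1) + c 1), ?_, fun t ht => ?_⟩
  · have := (hpos (m + 1)).le
    have := (hpos 1).le
    positivity
  rw [add_comm]
  refine (cutSum_le_long (M := M) hc ht (m + 1) hB (fun y => hF (shift y))).trans
    (add_le_add_right ?_ _)
  rw [cutSum, ← ENNReal.tsum_mul_left]
  -- The mark moves one letter to the right: the left factor of c can only grow and the right one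
  -- loses at most a factor 1 + ε. Long tails are non-empty, so the default in `getD` is never
  -- taken.
  refine tsum_le_tsum_of_injOn (t := M.Cuts)
    (g := fun z => ENNReal.ofReal (1 + ε) * M.cutTerm c t F z)
    (fun z => (z.1 ++ [z.2.1], z.2.2.head?.getD z.2.1, z.2.2.tail)) ?_ ?_ ?_
  · rintro ⟨p, b, q⟩ ⟨hz, -, hl, -⟩
    rcases q with _ | ⟨d, q⟩
    · simp at hl
    · simpa [Cuts] using hz
  · rintro ⟨p, b, q⟩ ⟨hz, -, hl, -⟩ ⟨p', b', q'⟩ ⟨hz', -, hl', -⟩ h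
    rcases q with _ | ⟨d, q⟩
    · simp at hl
    rcases q' with _ | ⟨d', q'⟩
    · simp at hl'
    simp at h
    simp [h]
  · rintro ⟨p, b, q⟩ ⟨hz, -, hl, -⟩
    rcases q with _ | ⟨d, q⟩
    · simp at hl
    simp only [cutTerm, cutWeight, shift_concat_cons, List.head?_cons, Option.getD_some,
      List.tail_cons, List.append_assoc, List.singleton_append]
    rw [← mul_assoc (ENNReal.ofReal (1 + ε)), ← ENNReal.ofReal_mul (by positivity)]
    gcongr ?_ * _
    refine ENNReal.ofReal_le_ofReal ?_
    have hgn := gibbs_nonneg (M := M) ht (p ++ b :: d :: q)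
    have h1 : c (p.length + 1) ≤ c ((p ++ [b]).length + 1) := hmono (by simp)
    have h2 : c (d :: q).length ≤ (1 + ε) * c q.length := hm _ (by simpa using hl)
    have := (hpos (p.length + 1)).le
    have := (hpos ((p ++ [b]).length + 1)).le
    have := (hpos (d :: q).length).le
    calc _ ≤ M.gibbs t (p ++ b :: d :: q) *
          (c ((p ++ [b]).length + 1) * ((1 + ε) * c q.length)) := by gcongr
      _ = _ := by ring

/-- The word sum is negligible with respect to the total mass `cutSum 1`, up to finitely many
words. -/
theorem exists_mul_wordSum_le [Finite S] (M : WordSystem S G) {c : ℕ → ℝ}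
    (hc : SlowlyIncreasing c) {t₀ : ℝ} (ht₀ : 0 < t₀) (k : ℕ) :
    ∃ C : ℝ, 0 ≤ C ∧ ∀ t, t₀ ≤ t →
      (k : ENNReal) * M.wordSum c t ≤ M.cutSum c t (fun _ => 1) + ENNReal.ofReal C := by
  have hpos := hc.1
  have hmono := hc.2.1
  -- Marking one of the first j letters of a long word gives j cuts, each at least c₀/2 times the
  -- term of the word in `wordSum`; their total is then at least k times that term.
  obtain ⟨j, hj⟩ : ∃ j : ℕ, 2 * k ≤ j * c 0 := by
    obtain ⟨j, hj⟩ := exists_nat_ge (2 * k / c 0)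
    exact ⟨j, (div_le_iff₀ (hpos 0)).1 hj⟩
  obtain ⟨m, hm⟩ := hc.exists_le j (zero_lt_one)
  have hfin : {v : List S | v.length < m + j}.Finite := List.finite_length_lt S _
  -- The short words are finitely many and their weights decrease in t, so their values at t₀
  -- suffice.
  let C : ℝ := ∑ v ∈ hfin.toFinset, k * (M.gibbs t₀ v * c v.length)
  have hgn : ∀ t, 0 < t → ∀ v, 0 ≤ M.gibbs t v := fun t ht v => gibbs_nonneg ht v
  have hC : 0 ≤ C := Finset.sum_nonneg fun v _ =>
    mul_nonneg (by positivity) (mul_nonneg (hgn _ ht₀ _) (hpos _).le)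
  refine ⟨C, hC, fun t htt => ?_⟩
  have ht : 0 < t := ht₀.trans_le htt
  rw [wordSum, ← ENNReal.tsum_mul_left]
  have hsub : M.Words ⊆ {v | v ∈ M.Words ∧ m + j ≤ v.length} ∪ {v | v.length < m + j} := by
    intro v hv
    rcases lt_or_ge v.length (m + j) with h | h
    · exact Or.inr h
    · exact Or.inl ⟨hv, h⟩
  refine (ENNReal.tsum_mono_subtype (fun v => (k : ENNReal) * M.wordTerm c t v) hsub).trans
    ((ENNReal.tsum_union_le (fun v => (k : ENNReal) * M.wordTerm c t v) _ _).trans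
      (add_le_add ?_ ?_))
  · rcases Nat.eq_zero_or_pos j with hj0 | hj0
    · subst hj0
      have : k = 0 := by
        have : (k : ℝ) ≤ 0 := by simp at hj; linarith
        exact Nat.le_zero.1 (by exact_mod_cast this)
      simp [this]
    have hjR : (0 : ℝ) < j := by exact_mod_cast hj0
    have h1 : ∑' v : {v | v ∈ M.Words ∧ m + j ≤ v.length}, (k : ENNReal) * M.wordTerm c t v =
        ∑' z : (Set.univ ×ˢ {v | v ∈ M.Words ∧ m + j ≤ v.length} : Set (Fin j × List S)),
          ENNReal.ofReal (k / j) * M.wordTerm c t (z : Fin j × List S).2 := by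
      rw [← (Equiv.Set.prod (Set.univ : Set (Fin j))
        {v | v ∈ M.Words ∧ m + j ≤ v.length}).symm.tsum_eq, ENNReal.tsum_prod']
      change _ = ∑' (i : (Set.univ : Set (Fin j))) (v : {v | v ∈ M.Words ∧ m + j ≤ v.length}),
        ENNReal.ofReal (k / j) * M.wordTerm c t v
      rw [tsum_univ fun i : Fin j => ∑' v : {v | v ∈ M.Words ∧ m + j ≤ v.length},
        ENNReal.ofReal (k / j) * M.wordTerm c t v]
      rw [tsum_fintype (β := Fin j), Finset.sum_const, Finset.card_univ, Fintype.card_fin,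
        nsmul_eq_mul,
        ENNReal.tsum_mul_left, ENNReal.tsum_mul_left, ← mul_assoc]
      congr 1
      rw [← ENNReal.ofReal_natCast j, ← ENNReal.ofReal_mul (by positivity),
        mul_div_cancel₀ _ hjR.ne', ENNReal.ofReal_natCast]
    rw [h1, cutSum]
    have hlen : ∀ z ∈ (Set.univ ×ˢ {v | v ∈ M.Words ∧ m + j ≤ v.length} : Set (Fin j × List S)),
        z.2.take z.1 ++ (z.2[(z.1 : ℕ)]?.getD M.a) :: z.2.drop (z.1 + 1) = z.2 := by
      rintro ⟨i, v⟩ ⟨-, hv, hl⟩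
      have hi : (i : ℕ) < v.length := by have := i.2; simp at hl; omega
      simp [hi]
    refine tsum_le_tsum_of_injOn
      (f := fun z : Fin j × List S => ENNReal.ofReal (k / j) * M.wordTerm c t z.2)
      (fun z => (z.2.take z.1, z.2[(z.1 : ℕ)]?.getD M.a, z.2.drop (z.1 + 1))) ?_ ?_ ?_
    · rintro z hz
      change _ ∈ M.Words
      rw [hlen z hz]
      exact hz.2.1
    · rintro z hz z' hz' h
      have e1 := hlen z hz
      have e2 := hlen z' hz'
      simp only [Prod.mk.injEq] at h
      rw [h.1, h.2.1, h.2.2, e2] at e1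
      have hl := congrArg List.length h.1
      have b1 := hz.2.2
      have b2 := hz'.2.2
      have := z.1.2
      have := z'.1.2
      simp only [List.length_take] at hl
      refine Prod.ext (Fin.ext ?_) e1.symm
      omega
    · rintro z hz
      have e1 := hlen z hz
      obtain ⟨i, v⟩ := z
      rw [cutTerm, mul_one, cutWeight]
      dsimp only at e1 ⊢
      rw [e1, wordTerm, ← ENNReal.ofReal_mul (by positivity)]
      refine ENNReal.ofReal_le_ofReal ?_
      have hv : m + j ≤ v.length := hz.2.2
      have hi := i.2
      have h2 : c v.length ≤ 2 * c (v.drop (i + 1)).length := by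
        have h3 : c v.length ≤ 2 * c (v.length - j) := by
          have := hm (v.length - j) (by omega)
          rw [Nat.sub_add_cancel (by omega)] at this
          linarith
        have h4 : c (v.length - j) ≤ c (v.drop (i + 1)).length := hmono (by simp; omega)
        linarith
      have h5 : c 0 ≤ c ((v.take i).length + 1) := hmono (by omega)
      have h6 := hgn t ht v
      have h7 := (hpos (v.drop (i + 1)).length).le
      have h8 := (hpos 0).le
      calc (k / j : ℝ) * (M.gibbs t v * c v.length)
          ≤ (c 0 / 2) * (M.gibbs t v * (2 * c (v.drop (i + 1)).length)) := by
            have : (k / j : ℝ) ≤ c 0 / 2 := by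
              rw [div_le_div_iff₀ hjR two_pos]; linarith
            have := (hpos v.length).le
            gcongr
        _ = M.gibbs t v * (c 0 * c (v.drop (i + 1)).length) := by ring
        _ ≤ _ := by gcongr
  · have : ∑' v : {v : List S | v.length < m + j}, (k : ENNReal) * M.wordTerm c t v =
        ∑ v ∈ hfin.toFinset, (k : ENNReal) * M.wordTerm c t v := by
      rw [← Finset.tsum_subtype' hfin.toFinset (fun v => (k : ENNReal) * M.wordTerm c t v),
        hfin.coe_toFinset]
    rw [this, ENNReal.ofReal_sum_of_nonneg fun v _ =>
      mul_nonneg (by positivity) (mul_nonneg (hgn _ ht₀ _) (hpos _).le)]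
    refine Finset.sum_le_sum fun v _ => ?_
    rw [ENNReal.ofReal_mul (by positivity), ENNReal.ofReal_natCast, wordTerm]
    gcongr
    · exact (hpos _).le
    · rw [gibbs, gibbs]
      have := (M.weight_pos v M.x).le
      have := M.ψ_nonneg (wordProd M.s v)
      gcongr

end WordSystem

/-! ### Construction and growth of slowly increasing sequences -/

section Slow

/-- A slowly increasing sequence that is large along a prescribed sequence of indices. -/
theorem exists_slowlyIncreasing_ge (N : ℕ → ℕ) : ∃ c : ℕ → ℝ, SlowlyIncreasing c ∧
    ∀ j, (N j + 1 : ℝ) * Real.exp (N j / (j + 1)) ≤ c (N j) := by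
  -- L n = sup_j min(n, N_j)/(j+1) is at least N_j/(j+1) at n = N_j, yet its increments tend to 0:
  -- the terms with j < J are eventually constant and the others grow by at most 1/(J+1). The factor
  -- n + 1 in c = (n+1) exp L forces divergence.
  let m : ℕ → ℕ → ℝ := fun n j => (min n (N j) : ℕ) / (j + 1 : ℝ)
  have hm_le : ∀ n j, m n j ≤ n := by
    intro n j
    have h1 : ((min n (N j) : ℕ) : ℝ) ≤ n := by exact_mod_cast min_le_left _ _
    exact (div_le_self (by positivity) (by simp)).trans h1
  have hbdd : ∀ n, BddAbove (Set.range (m n)) := by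
    intro n
    exact ⟨n, by rintro _ ⟨j, rfl⟩; exact hm_le n j⟩
  let L : ℕ → ℝ := fun n => ⨆ j, m n j
  have hLmono : Monotone L := by
    intro n k hnk
    refine ciSup_mono (hbdd k) fun j => ?_
    simp only [m]
    gcongr
  have hinc : Tendsto (fun n => L (n + 1) - L n) atTop (𝓝 0) := by
    rw [Metric.tendsto_atTop]
    intro ε hε
    obtain ⟨J, hJ⟩ := exists_nat_one_div_lt (half_pos hε)
    refine ⟨∑ j ∈ Finset.range J, N j, fun n hn => ?_⟩
    have hle : L (n + 1) ≤ L n + ε / 2 := by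
      refine ciSup_le fun j => ?_
      have h1 : m n j ≤ L n := le_ciSup (hbdd n) j
      suffices m (n + 1) j ≤ m n j + ε / 2 by linarith
      rcases lt_or_ge j J with hj | hj
      · have : N j ≤ n := (Finset.single_le_sum (f := N) (fun _ _ => Nat.zero_le _)
          (Finset.mem_range.2 hj)).trans hn
        have e : m (n + 1) j = m n j := by
          simp only [m]
          rw [min_eq_right this, min_eq_right (by omega)]
        rw [e]; linarith
      · have h2 : ((min (n + 1) (N j) : ℕ) : ℝ) ≤ (min n (N j) : ℕ) + 1 := by
          exact_mod_cast (by omega : min (n + 1) (N j) ≤ min n (N j) + 1)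
        have h3 : 1 / (j + 1 : ℝ) ≤ 1 / (J + 1 : ℝ) := by gcongr
        calc m (n + 1) j ≤ ((min n (N j) : ℕ) + 1 : ℝ) / (j + 1) := by
              simp only [m]; gcongr
          _ = m n j + 1 / (j + 1) := by simp only [m]; rw [add_div]
          _ ≤ _ := by linarith
    have hge := hLmono (Nat.le_succ n)
    rw [Real.dist_eq, sub_zero, abs_of_nonneg (by simpa using hge)]
    linarith
  let c : ℕ → ℝ := fun n => (n + 1) * Real.exp (L n)
  have hL0 : ∀ n, 0 ≤ L n := fun n => Real.iSup_nonneg fun j => by positivity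
  have hcpos : ∀ n, 0 < c n := fun n => by positivity
  have hratio : Tendsto (fun n => c (n + 1) / c n) atTop (𝓝 1) := by
    have h1 : Tendsto (fun n : ℕ => 1 + 1 / ((n : ℝ) + 1)) atTop (𝓝 (1 + 0)) :=
      tendsto_const_nhds.add tendsto_one_div_add_atTop_nhds_zero_nat
    have h2 := (Real.continuous_exp.tendsto 0).comp hinc
    have h3 := h1.mul h2
    simp only [add_zero, Real.exp_zero, mul_one] at h3
    refine h3.congr fun n => ?_
    simp only [c, Function.comp, Real.exp_sub]
    push_cast
    field_simp
  refine ⟨c, ⟨hcpos, ?_, ?_, ?_⟩, ?_⟩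
  · intro n k hnk
    have : L n ≤ L k := hLmono hnk
    simp only [c]
    gcongr
  · refine tendsto_atTop_mono (fun n => ?_) tendsto_natCast_atTop_atTop
    have := Real.one_le_exp (hL0 n)
    simp only [c]
    nlinarith
  · intro k
    induction k with
    | zero => simp [div_self (hcpos _).ne']
    | succ k ih =>
      have h := (hratio.comp (tendsto_add_atTop_nat k)).mul ih
      rw [one_mul] at h
      refine h.congr fun n => ?_
      simp only [Function.comp]
      rw [div_mul_div_cancel₀ (hcpos _).ne', add_assoc]
  · intro j
    have : (N j : ℝ) / (j + 1) ≤ L (N j) := by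
      have h := le_ciSup (hbdd (N j)) j
      have e : m (N j) j = N j / (j + 1) := by simp [m]
      rwa [e] at h
    simp only [c]
    gcongr

/-- Slow increase implies subexponential growth, so the weights c do not destroy convergence above
the abscissa. -/
theorem SlowlyIncreasing.exists_le_mul_pow {c : ℕ → ℝ} (hc : SlowlyIncreasing c) {r : ℝ}
    (hr : 1 < r) : ∃ C : ℝ, 0 < C ∧ ∀ n, c n ≤ C * r ^ n := by
  obtain ⟨m, hm⟩ := hc.exists_le 1 (sub_pos.2 hr)
  obtain ⟨hpos, hmono, -, -⟩ := hc
  refine ⟨c m, hpos m, fun n => ?_⟩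
  induction n with
  | zero => simpa using hmono (Nat.zero_le m)
  | succ n ih =>
    rcases le_or_gt m n with h | h
    · have := hm n h
      rw [add_sub_cancel] at this
      calc c (n + 1) ≤ r * c n := this
        _ ≤ r * (c m * r ^ n) := by gcongr
        _ = _ := by ring
    · exact (hmono (by omega)).trans (le_mul_of_one_le_right (hpos m).le (one_le_pow₀ hr.le))

end Slow

/-! ### The abscissa of convergence and divergence at it -/

namespace WordSystem

variable {S G : Type*} [Group G] {M : WordSystem S G}

theorem gibbs_rescale {t t₀ : ℝ} (ht : 0 < t) (ht₀ : 0 < t₀) (v : List S) :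
    M.gibbs t v = ((t / t₀) ^ v.length)⁻¹ * M.gibbs t₀ v := by
  simp only [gibbs, div_pow]
  field_simp

/-- The parameters at which the series `∑_v t^{-|v|} R_{|v|}(v x) ψ(𝔰(v))` converges. -/
def convSet (M : WordSystem S G) : Set ℝ := {t | 0 < t ∧ M.wordSum (fun _ => 1) t ≠ ⊤}

/-- The abscissa of convergence. -/
def gam (M : WordSystem S G) : ℝ := sInf M.convSet

theorem exists_loop (M : WordSystem S G) : ∃ u ∈ M.Words, wordProd M.s u = 1 := by
  have haA : Admissible M.τ [M.a] := admissible_iff.2 ⟨_, M.mem_ax⟩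
  have hu : M.pre M.a ++ [M.a] ∈ M.Words :=
    ⟨M.pre_mem _ _ M.mem_ax, by rw [List.head?_append, M.pre_head _ haA]; rfl, by simp⟩
  -- The word pre(a) a has group element s(a); two copies joined through a word with element s(a)⁻²
  -- have trivial product.
  obtain ⟨w, hw1, hw⟩ := M.conn ((M.s M.a)⁻¹ * (M.s M.a)⁻¹)
  refine ⟨_, join_mem hu hw hu, ?_⟩
  simp only [wordProd_append, M.pre_prod _ haA, hw1]
  simp [wordProd]

theorem exists_long_loops (M : WordSystem S G) : ∃ v : ℕ → List S, Function.Injective v ∧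
    ∀ k, v k ∈ M.Words ∧ wordProd M.s (v k) = 1 := by
  obtain ⟨u, hu, hu1⟩ := M.exists_loop
  obtain ⟨w, hw1, hw⟩ := M.conn 1
  have hne : u ≠ [] := by rintro rfl; have := hu.2.1; simp at this
  let F : List S → List S := fun v => u ++ (w ++ v)
  refine ⟨fun k => F^[k] u, ?_, fun k => ?_⟩
  · have : StrictMono fun k => (F^[k] u).length := by
      refine strictMono_nat_of_lt_succ fun k => ?_
      rw [Function.iterate_succ_apply']
      have := List.length_pos_iff.2 hne
      simp only [F, List.length_append]
      omega
    exact fun i j h => this.injective (congrArg List.length h)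
  · induction k with
    | zero => exact ⟨hu, hu1⟩
    | succ k ih =>
      simp only [Function.iterate_succ_apply']
      exact ⟨join_mem hu hw ih.1, by simp [F, wordProd_append, hu1, hw1, ih.2]⟩

/-- For t < lo each of infinitely many loops with trivial group element contributes at least ψ(1) >
0. -/
theorem lo_le_of_mem_convSet {t : ℝ} (ht : t ∈ M.convSet) : M.lo ≤ t := by
  by_contra hlt
  push Not at hlt
  obtain ⟨v, hinj, hv⟩ := M.exists_long_loops
  refine ht.2 (top_le_iff.1 ?_)
  have hψ : ENNReal.ofReal (M.ψ 1) ≠ 0 := by simpa using M.ψ_one_pos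
  rw [← ENNReal.tsum_const_eq_top_of_ne_zero (α := ℕ) hψ, ← tsum_univ]
  refine tsum_le_tsum_of_injOn (f := fun _ => ENNReal.ofReal (M.ψ 1)) v (fun k _ => (hv k).1)
    hinj.injOn fun k _ => ?_
  rw [wordTerm, mul_one]
  refine ENNReal.ofReal_le_ofReal ?_
  rw [gibbs, (hv k).2]
  have ht0 := ht.1
  have h1 : 1 ≤ (t ^ (v k).length)⁻¹ * wordWeight M.R (v k) M.x := by
    rw [← div_eq_inv_mul, one_le_div (by positivity)]
    exact (pow_le_pow_left₀ ht0.le hlt.le _).trans (M.pow_le_weight _ _)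
  exact le_mul_of_one_le_left (M.ψ_nonneg _) h1

theorem convSet_nonempty [Finite S] (M : WordSystem S G) : M.convSet.Nonempty := by
  have := Fintype.ofFinite S
  have : Nonempty S := ⟨M.a⟩
  have hhi : 0 < M.hi := (M.R_pos M.x).trans_le (M.le_hi _)
  have hS : (0 : ℝ) < Fintype.card S := by exact_mod_cast Fintype.card_pos
  have hψb : 0 ≤ M.ψbound := (M.ψ_nonneg 1).trans (M.ψ_le 1)
  -- There are at most |S|^n words of length n, of weight at most hi^n, so at this t the series is
  -- dominated by a geometric one of ratio 1/2.
  set t : ℝ := 2 * Fintype.card S * M.hi with ht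
  have ht0 : 0 < t := by positivity
  refine ⟨t, ht0, ne_top_of_le_ne_top ?_
    (b := ∑' n : ℕ, ENNReal.ofReal (M.ψbound * (1 / 2) ^ n)) ?_⟩
  · rw [← ENNReal.ofReal_tsum_of_nonneg (fun n => by positivity)
      ((summable_geometric_of_lt_one (by norm_num) (by norm_num)).mul_left _)]
    exact ENNReal.ofReal_ne_top
  have hsub : M.Words ⊆ ⋃ n : ℕ, {v : List S | v.length = n} := fun v _ => Set.mem_iUnion.2 ⟨_, rfl⟩
  refine (ENNReal.tsum_mono_subtype _ hsub).trans ((ENNReal.tsum_iUnion_le_tsum _ _).trans ?_)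
  refine ENNReal.tsum_le_tsum fun n => ?_
  have hle : ∀ v : {v : List S | v.length = n}, M.wordTerm (fun _ => 1) t v ≤
      ENNReal.ofReal (M.ψbound * ((2 * Fintype.card S : ℝ)⁻¹) ^ n) := by
    rintro ⟨v, hv : v.length = n⟩
    refine ENNReal.ofReal_le_ofReal ?_
    rw [mul_one, gibbs, hv]
    have h1 := M.weight_le_pow v M.x
    rw [hv] at h1
    calc (t ^ n)⁻¹ * wordWeight M.R v M.x * M.ψ (wordProd M.s v)
        ≤ (t ^ n)⁻¹ * M.hi ^ n * M.ψbound := by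
          have := M.ψ_nonneg (wordProd M.s v)
          gcongr
          exact M.ψ_le _
      _ = _ := by
          rw [ht, mul_pow, mul_inv, inv_pow]
          field_simp
  refine (ENNReal.tsum_le_tsum hle).trans ?_
  have : Fintype {v : List S | v.length = n} := inferInstanceAs (Fintype (List.Vector S n))
  have e : Fintype.card {v : List S | v.length = n} = Fintype.card S ^ n := by
    rw [← card_vector (α := S) n]
    exact Fintype.card_congr (Equiv.refl _)
  rw [tsum_fintype, Finset.sum_const, Finset.card_univ, e, nsmul_eq_mul,
    ← ENNReal.ofReal_natCast, ← ENNReal.ofReal_mul (by positivity)]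
  refine ENNReal.ofReal_le_ofReal (le_of_eq ?_)
  push_cast
  rw [mul_inv, mul_pow, inv_pow _ n, inv_pow _ n, one_div, inv_pow _ n]
  field_simp

theorem gam_pos [Finite S] (M : WordSystem S G) : 0 < M.gam :=
  M.lo_pos.trans_le (le_csInf M.convSet_nonempty fun _ => lo_le_of_mem_convSet)

theorem exists_mem_convSet_lt [Finite S] {t : ℝ} (ht : M.gam < t) : ∃ t₀ ∈ M.convSet, t₀ < t :=
  exists_lt_of_csInf_lt M.convSet_nonempty ht

theorem wordSum_one_eq_top {t : ℝ} (h0 : 0 < t) (ht : t < M.gam) :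
    M.wordSum (fun _ => 1) t = ⊤ := by
  by_contra h
  exact absurd (csInf_le ⟨0, fun _ hx => hx.1.le⟩ (show t ∈ M.convSet from ⟨h0, h⟩)) (not_le.2 ht)

theorem wordSum_ne_top [Finite S] {c : ℕ → ℝ} (hc : SlowlyIncreasing c) {t : ℝ} (ht : M.gam < t) :
    M.wordSum c t ≠ ⊤ := by
  obtain ⟨t₀, ⟨ht₀, hfin⟩, hlt⟩ := exists_mem_convSet_lt ht
  have htp := ht₀.trans hlt
  obtain ⟨C, hC0, hC⟩ := hc.exists_le_mul_pow ((one_lt_div ht₀).2 hlt)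
  refine ne_top_of_le_ne_top (ENNReal.mul_ne_top ENNReal.ofReal_ne_top hfin)
    (b := ENNReal.ofReal C * M.wordSum (fun _ => 1) t₀) ?_
  rw [wordSum, wordSum, ← ENNReal.tsum_mul_left]
  refine ENNReal.tsum_le_tsum fun v => ?_
  rw [wordTerm, wordTerm, ← ENNReal.ofReal_mul hC0.le]
  refine ENNReal.ofReal_le_ofReal ?_
  rw [mul_one, gibbs_rescale htp ht₀]
  have h1 := gibbs_nonneg (M := M) ht₀ v
  have h2 := hC (v : List S).length
  have h3 : 0 < (t / t₀) ^ (v : List S).length := by positivity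
  calc _ ≤ ((t / t₀) ^ (v : List S).length)⁻¹ * M.gibbs t₀ v *
        (C * (t / t₀) ^ (v : List S).length) := by gcongr
    _ = _ := by field_simp

theorem cutSum_one_ne_top [Finite S] {c : ℕ → ℝ} (hc : SlowlyIncreasing c) {t : ℝ}
    (ht : M.gam < t) : M.cutSum c t (fun _ => 1) ≠ ⊤ := by
  obtain ⟨t₀, ⟨ht₀, hfin⟩, hlt⟩ := exists_mem_convSet_lt ht
  have htp := ht₀.trans hlt
  have hx := (one_lt_div ht₀).2 hlt
  -- With r³ = t/t₀, two of the three factors r^n pay for the two values of c and the third makes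
  -- the sum over the position of the cut converge.
  set r := (t / t₀) ^ (1 / 3 : ℝ) with hr
  have hr1 : 1 < r := Real.one_lt_rpow hx (by norm_num)
  have hr0 : 0 < r := by linarith
  have hr3 : r ^ 3 = t / t₀ := by
    rw [hr, ← Real.rpow_natCast, ← Real.rpow_mul (by positivity)]
    norm_num
  obtain ⟨C, hC0, hC⟩ := hc.exists_le_mul_pow hr1
  obtain ⟨hpos, hmono, -, -⟩ := hc
  have hsub : M.Cuts ⊆ ⋃ i : ℕ, {z | z ∈ M.Cuts ∧ z.1.length = i} :=
    fun z hz => Set.mem_iUnion.2 ⟨_, hz, rfl⟩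
  have hri : r⁻¹ < 1 := inv_lt_one_of_one_lt₀ hr1
  refine ne_top_of_le_ne_top ?_ ((ENNReal.tsum_mono_subtype _ hsub).trans
    ((ENNReal.tsum_iUnion_le_tsum _ _).trans (ENNReal.tsum_le_tsum (g := fun i : ℕ =>
      ENNReal.ofReal (C ^ 2 * r⁻¹ ^ i) * M.wordSum (fun _ => 1) t₀) fun i => ?_)))
  · rw [ENNReal.tsum_mul_right]
    refine ENNReal.mul_ne_top ?_ hfin
    rw [← ENNReal.ofReal_tsum_of_nonneg (fun n => by positivity)
      ((summable_geometric_of_lt_one (by positivity) hri).mul_left _)]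
    exact ENNReal.ofReal_ne_top
  · rw [wordSum, ← ENNReal.tsum_mul_left]
    refine tsum_le_tsum_of_injOn (t := M.Words) (g := fun v => ENNReal.ofReal (C ^ 2 * r⁻¹ ^ i) *
      M.wordTerm (fun _ => 1) t₀ v) (fun z => z.1 ++ z.2.1 :: z.2.2) (fun z hz => hz.1) ?_ ?_
    · rintro ⟨p, b, q⟩ hz ⟨p', b', q'⟩ hz' h
      have hl : p.length = p'.length := hz.2.trans hz'.2.symm
      have := List.append_inj h hl
      simp at this
      simp [this]
    · rintro ⟨p, b, q⟩ ⟨hz, rfl⟩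
      rw [cutTerm, mul_one, cutWeight, wordTerm, ← ENNReal.ofReal_mul (by positivity), mul_one]
      refine ENNReal.ofReal_le_ofReal ?_
      dsimp only
      set n := (p ++ b :: q).length with hn
      have hnl : n = p.length + (q.length + 1) := by simp [hn]
      have hgn := gibbs_nonneg (M := M) ht₀ (p ++ b :: q)
      have h1 : c (p.length + 1) ≤ C * r ^ n := (hmono (by omega)).trans (hC n)
      have h2 : c q.length ≤ C * r ^ n := (hmono (by omega)).trans (hC n)
      have h3 : r⁻¹ ^ n ≤ r⁻¹ ^ p.length :=
        pow_le_pow_of_le_one (by positivity) hri.le (by omega)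
      rw [gibbs_rescale htp ht₀, ← hr3]
      have := (hpos q.length).le
      calc _ ≤ ((r ^ 3) ^ n)⁻¹ * M.gibbs t₀ (p ++ b :: q) * ((C * r ^ n) * (C * r ^ n)) := by
            rw [← hn]
            gcongr
        _ = C ^ 2 * r⁻¹ ^ n * M.gibbs t₀ (p ++ b :: q) := by
            rw [inv_pow, ← pow_mul, mul_comm 3 n, pow_mul]
            field_simp
        _ ≤ _ := by gcongr

/-- The contribution of the words of length `n` at the critical parameter. -/
def level (M : WordSystem S G) (n : ℕ) : ENNReal :=
  ∑' v : {v | v ∈ M.Words ∧ v.length = n}, ENNReal.ofReal (M.gibbs M.gam v)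

theorem level_ne_top [Finite S] (n : ℕ) : M.level n ≠ ⊤ := by
  have hfin : {v | v ∈ M.Words ∧ v.length = n}.Finite :=
    (List.finite_length_eq S n).subset fun v hv => hv.2
  have := hfin.fintype
  rw [level, tsum_fintype]
  exact ENNReal.sum_ne_top.2 fun _ _ => ENNReal.ofReal_ne_top

/-- Root test: a bound r^n on all late levels would make the series converge at γq for r < q < 1,
below the abscissa. -/
theorem frequently_le_level [Finite S] {r : ℝ} (hr0 : 0 < r) (hr1 : r < 1) (k : ℕ) :
    ∃ n, k ≤ n ∧ ENNReal.ofReal (r ^ n) ≤ M.level n := by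
  by_contra hcon
  push Not at hcon
  have hγ := M.gam_pos
  obtain ⟨q, hrq, hq1⟩ := exists_between hr1
  have hq0 := hr0.trans hrq
  have htop := wordSum_one_eq_top (M := M) (t := M.gam * q) (by positivity)
    (mul_lt_of_lt_one_right hγ hq1)
  have hsub : M.Words ⊆ ⋃ n : ℕ, {v | v ∈ M.Words ∧ v.length = n} :=
    fun v hv => Set.mem_iUnion.2 ⟨_, hv, rfl⟩
  have hle : M.wordSum (fun _ => 1) (M.gam * q) ≤
      ∑' n : ℕ, ENNReal.ofReal (q⁻¹ ^ n) * M.level n := by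
    refine (ENNReal.tsum_mono_subtype _ hsub).trans
      ((ENNReal.tsum_iUnion_le_tsum _ _).trans (ENNReal.tsum_le_tsum fun n => ?_))
    rw [level, ← ENNReal.tsum_mul_left]
    refine ENNReal.tsum_le_tsum fun v => ?_
    rw [wordTerm, mul_one, ← ENNReal.ofReal_mul (by positivity),
      gibbs_rescale (t₀ := M.gam) (by positivity) hγ, v.2.2, mul_div_cancel_left₀ _ hγ.ne', inv_pow]
  refine absurd htop (ne_top_of_le_ne_top ?_ hle)
  rw [← ENNReal.summable.sum_add_tsum_nat_add' (k := k)]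
  refine ENNReal.add_ne_top.2 ⟨ENNReal.sum_ne_top.2 fun n _ =>
    ENNReal.mul_ne_top ENNReal.ofReal_ne_top (level_ne_top n), ?_⟩
  have hrq1 : r / q < 1 := (div_lt_one hq0).2 hrq
  refine ne_top_of_le_ne_top (b := ∑' n : ℕ, ENNReal.ofReal ((r / q) ^ n)) ?_
    (le_trans (ENNReal.tsum_le_tsum (g := fun n : ℕ => ENNReal.ofReal ((r / q) ^ (n + k)))
      fun n => ?_) (ENNReal.tsum_comp_le_tsum_of_injective (add_left_injective k)
        fun n => ENNReal.ofReal ((r / q) ^ n)))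
  · rw [← ENNReal.ofReal_tsum_of_nonneg (fun n => by positivity)
      (summable_geometric_of_lt_one (by positivity) hrq1)]
    exact ENNReal.ofReal_ne_top
  · calc _ ≤ ENNReal.ofReal (q⁻¹ ^ (n + k)) * ENNReal.ofReal (r ^ (n + k)) := by
          gcongr
          exact (hcon (n + k) (by omega)).le
      _ = _ := by
          rw [← ENNReal.ofReal_mul (by positivity), ← mul_pow, inv_mul_eq_div]

/-- A slowly increasing sequence that makes the series diverge at the critical parameter. -/
theorem exists_slowlyIncreasing_wordSum_eq_top [Finite S] (M : WordSystem S G) :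
    ∃ c : ℕ → ℝ, SlowlyIncreasing c ∧ M.wordSum c M.gam = ⊤ := by
  -- The rates e^{-1/(j+1)} match the construction of c: at n = N_j the level is at least
  -- e^{-n/(j+1)} and c_n at least (n+1)e^{n/(j+1)}, so their product is at least n + 1 ≥ j + 1.
  have hex : ∀ j : ℕ, ∃ n, j ≤ n ∧ ENNReal.ofReal (Real.exp (-(1 / (j + 1 : ℝ))) ^ n) ≤ M.level n :=
    fun j => frequently_le_level (Real.exp_pos _)
      (Real.exp_lt_one_iff.2 (neg_lt_zero.2 (by positivity))) j
  choose N hN1 hN2 using hex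
  obtain ⟨c, hc, hcN⟩ := exists_slowlyIncreasing_ge N
  refine ⟨c, hc, ENNReal.eq_top_of_forall_nnreal_le fun r => ?_⟩
  obtain ⟨j, hj⟩ := exists_nat_ge (r : ℝ)
  have hγ := M.gam_pos
  have h1 : ENNReal.ofReal (c (N j)) * M.level (N j) ≤ M.wordSum c M.gam := by
    rw [level, ← ENNReal.tsum_mul_left]
    refine tsum_le_tsum_of_injOn (s := {v | v ∈ M.Words ∧ v.length = N j}) (t := M.Words)
      (f := fun v => ENNReal.ofReal (c (N j)) * ENNReal.ofReal (M.gibbs M.gam v)) id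
      (fun v hv => hv.1) Function.injective_id.injOn ?_
    rintro v ⟨hv, hl⟩
    rw [← ENNReal.ofReal_mul (hc.1 _).le, id, wordTerm, hl, mul_comm]
  refine le_trans ?_ h1
  have hjN : (j : ℝ) ≤ N j := by exact_mod_cast hN1 j
  calc (r : ENNReal) = ENNReal.ofReal r := ENNReal.ofReal_coe_nnreal.symm
    _ ≤ ENNReal.ofReal (c (N j) * Real.exp (-(1 / (j + 1 : ℝ))) ^ N j) := by
        refine ENNReal.ofReal_le_ofReal ?_
        rw [← Real.exp_nat_mul]
        calc (r : ℝ) ≤ N j + 1 := by linarith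
          _ = (N j + 1 : ℝ) * Real.exp (N j / (j + 1)) * Real.exp (N j * -(1 / (j + 1 : ℝ))) := by
              rw [mul_assoc, ← Real.exp_add]
              rw [mul_neg, mul_one_div, add_neg_cancel, Real.exp_zero, mul_one]
          _ ≤ _ := by gcongr; exact hcN j
    _ = ENNReal.ofReal (c (N j)) * ENNReal.ofReal (Real.exp (-(1 / (j + 1 : ℝ))) ^ N j) :=
        ENNReal.ofReal_mul (hc.1 _).le
    _ ≤ _ := by gcongr; exact hN2 j

/-- Lower semicontinuity: finite partial sums are continuous in t and already exceed any bound at γ.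
-/
theorem tendsto_wordSum [Finite S] {c : ℕ → ℝ}
    (htop : M.wordSum c M.gam = ⊤) : Tendsto (M.wordSum c) (𝓝[>] M.gam) (𝓝 ⊤) := by
  have hγ := M.gam_pos
  rw [ENNReal.tendsto_nhds_top_iff_nnreal]
  intro r
  have hlt : (r : ENNReal) < M.wordSum c M.gam := htop ▸ ENNReal.coe_lt_top
  rw [wordSum, ENNReal.tsum_eq_iSup_sum, lt_iSup_iff] at hlt
  obtain ⟨F, hF⟩ := hlt
  have hcont : Tendsto (fun t => ∑ v ∈ F, M.wordTerm c t v) (𝓝 M.gam)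
      (𝓝 (∑ v ∈ F, M.wordTerm c M.gam v)) := by
    refine tendsto_finsetSum _ fun v _ => ?_
    refine (ENNReal.continuous_ofReal.tendsto _).comp ?_
    simp only [gibbs]
    have : ContinuousAt (fun t : ℝ => (t ^ (v : List S).length)⁻¹) M.gam :=
      ContinuousAt.inv₀ (by fun_prop) (by positivity)
    exact ((this.tendsto.mul_const _).mul_const _).mul_const _
  have := (hcont.eventually (lt_mem_nhds hF)).filter_mono
    (nhdsWithin_le_nhds (s := Set.Ioi M.gam))
  filter_upwards [this] with t ht
  exact ht.trans_le (ENNReal.sum_le_tsum F)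

end WordSystem

theorem toReal_le_mul_add_mul {X Y W : ENNReal} {a b : ℝ} (ha : 0 ≤ a) (hb : 0 ≤ b) (hY : Y ≠ ⊤)
    (hW : W ≠ ⊤) (h : X ≤ ENNReal.ofReal a * Y + ENNReal.ofReal b * W) :
    X.toReal ≤ a * Y.toReal + b * W.toReal := by
  have h1 := ENNReal.mul_ne_top (ENNReal.ofReal_ne_top (r := a)) hY
  have h2 := ENNReal.mul_ne_top (ENNReal.ofReal_ne_top (r := b)) hW
  refine (ENNReal.toReal_mono (ENNReal.add_ne_top.2 ⟨h1, h2⟩) h).trans_eq ?_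
  rw [ENNReal.toReal_add h1 h2, ENNReal.toReal_mul, ENNReal.toReal_mul, ENNReal.toReal_ofReal ha,
    ENNReal.toReal_ofReal hb]

theorem toReal_le_mul {X Y : ENNReal} {a : ℝ} (ha : 0 ≤ a) (hY : Y ≠ ⊤)
    (h : X ≤ ENNReal.ofReal a * Y) : X.toReal ≤ a * Y.toReal := by
  refine (ENNReal.toReal_mono (ENNReal.mul_ne_top ENNReal.ofReal_ne_top hY) h).trans_eq ?_
  rw [ENNReal.toReal_mul, ENNReal.toReal_ofReal ha]

section Topology

variable {S : Type*} [TopologicalSpace S] [DiscreteTopology S]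

theorem isClosed_markovShift (τ : S → S → Prop) :
    IsClosed (markovShift τ) := by
  have : markovShift τ = ⋂ i, (fun y : ℕ → S => (y i, y (i + 1))) ⁻¹' {p | τ p.1 p.2} := by
    ext y; simp [markovShift]
  rw [this]
  exact isClosed_iInter fun i => (isClosed_discrete _).preimage (by fun_prop)

instance instCompactSpaceMarkovShift [Finite S] (τ : S → S → Prop) :
    CompactSpace (markovShift τ) :=
  isCompact_iff_compactSpace.1 (isClosed_markovShift τ).isCompact

end Topology

/-! ### Normalised cut measures and their weak limits -/

namespace WordSystem

variable {S G : Type*} [Group G] {M : WordSystem S G}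

theorem cutSum_le_mul {c : ℕ → ℝ} {t : ℝ} {F : (ℕ → S) → ENNReal} {B : ENNReal}
    (hF : ∀ y, F y ≤ B) : M.cutSum c t F ≤ B * M.cutSum c t (fun _ => 1) := by
  rw [cutSum, cutSum, ← ENNReal.tsum_mul_left]
  refine ENNReal.tsum_le_tsum fun z => ?_
  rw [cutTerm, cutTerm, mul_one, mul_comm]
  gcongr
  exact hF _

theorem cutSum_ne_top [Finite S] {c : ℕ → ℝ} (hc : SlowlyIncreasing c) {t : ℝ} (ht : M.gam < t)
    {F : (ℕ → S) → ENNReal} {B : ℝ} (hF : ∀ y, F y ≤ ENNReal.ofReal B) : M.cutSum c t F ≠ ⊤ :=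
  ne_top_of_le_ne_top (ENNReal.mul_ne_top ENNReal.ofReal_ne_top (cutSum_one_ne_top hc ht))
    (cutSum_le_mul hF)

/-- Realise g by one word w with a w A admissible and bound its cylinder weight by a constant. This
yields finiteness of `pairSum` and boundedness of the ratios. -/
theorem pairSum_le_cutSum_one {c : ℕ → ℝ} (hc : SlowlyIncreasing c) (g : G) {t₁ : ℝ}
    (ht₁ : 0 < t₁) : ∃ C : ℝ, 0 ≤ C ∧ ∀ t, 0 < t → t ≤ t₁ →
      M.pairSum c t g ≤ ENNReal.ofReal C * M.cutSum c t (fun _ => 1) := by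
  obtain ⟨w, rfl, hw⟩ := M.conn g
  have hD := zero_le_one.trans M.one_le_D
  have hlo := M.lo_pos
  refine ⟨M.D ^ (M.θ ^ wedge w M.x) * (t₁ ^ w.length * (M.lo ^ w.length)⁻¹), by positivity,
    fun t ht htt => ?_⟩
  refine (midWeight_lower hc ht hw).trans ?_
  rw [ENNReal.ofReal_mul (by positivity), ENNReal.ofReal_mul (by positivity), mul_assoc, mul_assoc]
  gcongr
  exact cutSum_le_mul (M.midWeight_le M.a w M.A)

theorem pairSum_ne_top [Finite S] {c : ℕ → ℝ} (hc : SlowlyIncreasing c) {t : ℝ} (ht : M.gam < t)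
    (g : G) : M.pairSum c t g ≠ ⊤ := by
  have ht0 := M.gam_pos.trans ht
  obtain ⟨C, -, hC⟩ := pairSum_le_cutSum_one (M := M) hc g ht0
  exact ne_top_of_le_ne_top (ENNReal.mul_ne_top ENNReal.ofReal_ne_top (cutSum_one_ne_top hc ht))
    (hC t ht0 le_rfl)

theorem pairSum_one_pos {c : ℕ → ℝ} (hc : SlowlyIncreasing c) {t : ℝ} (ht : 0 < t) :
    0 < M.pairSum c t 1 := by
  obtain ⟨u, hu, hu1⟩ := M.exists_loop
  let z : (M.Words ×ˢ M.Words : Set (List S × List S)) := ⟨(u, u), hu, hu⟩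
  refine lt_of_lt_of_le ?_ (ENNReal.le_tsum z)
  rw [pairTerm, ENNReal.ofReal_pos]
  have h1 := M.weight_pos u M.x
  have h2 := hc.1 u.length
  have h3 := M.ψ_one_pos
  simp only [z, pairWeight, hu1, mul_one]
  positivity

theorem toReal_pairSum_one_pos [Finite S] {c : ℕ → ℝ} (hc : SlowlyIncreasing c) {t : ℝ}
    (ht : M.gam < t) : 0 < (M.pairSum c t 1).toReal :=
  ENNReal.toReal_pos (pairSum_one_pos hc (M.gam_pos.trans ht)).ne' (pairSum_ne_top hc ht 1)

/-- The total mass is comparable with `pairSum`, up to a multiple of `wordSum`. -/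
theorem exists_toReal_cutSum_one_le [Finite S] (M : WordSystem S G) {c : ℕ → ℝ}
    (hc : SlowlyIncreasing c) {t₁ : ℝ} (ht₁ : 0 < t₁) :
    ∃ C : ℝ, 1 ≤ C ∧ ∀ t, M.gam < t → t ≤ t₁ → (M.cutSum c t (fun _ => 1)).toReal ≤
      C * (M.pairSum c t 1).toReal + c 1 * (M.wordSum c t).toReal := by
  obtain ⟨C, hC1, hC⟩ := M.exists_tsum_split_le t₁ ht₁
  refine ⟨C, hC1, fun t ht htt => ?_⟩
  have ht0 := M.gam_pos.trans ht
  exact toReal_le_mul_add_mul (by linarith) (hc.1 1).le (pairSum_ne_top hc ht 1)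
    (wordSum_ne_top hc ht) (cutSum_one_le_pairSum hc ht0 (hC c hc t ht0 htt []))

/-- The word sum is negligible with respect to `pairSum` near the critical parameter. -/
theorem tendsto_wordSum_div_pairSum [Finite S] {c : ℕ → ℝ} (hc : SlowlyIncreasing c)
    (htop : M.wordSum c M.gam = ⊤) :
    Tendsto (fun t => (M.wordSum c t).toReal / (M.pairSum c t 1).toReal) (𝓝[>] M.gam) (𝓝 0) := by
  have hγ := M.gam_pos
  obtain ⟨C, hC1, hC⟩ := M.exists_toReal_cutSum_one_le hc (t₁ := M.gam + 1) (by linarith)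
  rw [Metric.tendsto_nhds]
  intro ε hε
  obtain ⟨k, hk⟩ := exists_nat_gt (C / ε + c 1 + 1)
  obtain ⟨E, hE0, hE⟩ := M.exists_mul_wordSum_le hc hγ k
  have h1 : ∀ᶠ t in 𝓝[>] M.gam, ENNReal.ofReal E < M.wordSum c t :=
    (tendsto_wordSum htop).eventually (lt_mem_nhds ENNReal.ofReal_lt_top)
  have h2 : ∀ᶠ t in 𝓝[>] M.gam, t ∈ Set.Ioc M.gam (M.gam + 1) :=
    Ioc_mem_nhdsGT (by linarith)
  filter_upwards [h1, h2] with t hQ ⟨ht, ht1⟩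
  have hQt := wordSum_ne_top (M := M) hc ht
  have hJt := cutSum_one_ne_top (M := M) hc ht
  have hz := toReal_pairSum_one_pos (M := M) hc ht
  have e1 : E < (M.wordSum c t).toReal := (ENNReal.ofReal_lt_iff_lt_toReal hE0 hQt).1 hQ
  have e2 := hC t ht ht1
  have e3 : k * (M.wordSum c t).toReal ≤ (M.cutSum c t fun _ => 1).toReal + E := by
    have := ENNReal.toReal_mono (ENNReal.add_ne_top.2 ⟨hJt, ENNReal.ofReal_ne_top⟩) (hE t ht.le)
    rwa [ENNReal.toReal_add hJt ENNReal.ofReal_ne_top, ENNReal.toReal_ofReal hE0,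
      ENNReal.toReal_mul, ENNReal.toReal_natCast] at this
  set q := (M.wordSum c t).toReal
  set z := (M.pairSum c t 1).toReal
  have hq : 0 < q := hE0.trans_lt e1
  rw [Real.dist_eq, sub_zero, abs_of_nonneg (by positivity), div_lt_iff₀ hz]
  -- From kq ≤ Cz + c₁q + E, E < q and k > C/ε + c₁ + 1.
  have e4 : (C / ε) * q < C * z := by nlinarith
  have e5 : C * q < C * (ε * z) := by
    rw [div_mul_eq_mul_div, div_lt_iff₀ hε] at e4
    linarith
  exact lt_of_mul_lt_mul_left e5 (by linarith)

section Measure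

variable [MeasurableSpace S]

/-- The sum of point masses whose integral is `cutSum`. -/
def cutMeasure (M : WordSystem S G) (c : ℕ → ℝ) (t : ℝ) : Measure (markovShift M.τ) :=
  Measure.sum fun z : M.Cuts => M.cutWeight c t z •
    Measure.dirac (⟨concat ((z : List S × S × List S).2.1 :: (z : List S × S × List S).2.2) M.x,
      concat_mem_of_append z.2.1⟩ : markovShift M.τ)

theorem lintegral_cutMeasure {c : ℕ → ℝ} {t : ℝ} {Φ : markovShift M.τ → ENNReal}
    (hΦ : Measurable Φ) {F : (ℕ → S) → ENNReal} (hF : ∀ y : markovShift M.τ, F y = Φ y) :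
    ∫⁻ y, Φ y ∂(M.cutMeasure c t) = M.cutSum c t F := by
  rw [cutMeasure, lintegral_sum_measure, cutSum]
  refine tsum_congr fun z => ?_
  rw [lintegral_smul_measure, lintegral_dirac' _ hΦ, ← hF, cutTerm, smul_eq_mul]

/-- Weak limits of the normalised measures `cutMeasure` at the critical parameter. -/
theorem exists_limit_measure [Finite S] [TopologicalSpace S] [DiscreteTopology S]
    [MeasurableSingletonClass S] (M : WordSystem S G) :
    ∃ c : ℕ → ℝ, SlowlyIncreasing c ∧ ∃ t : ℕ → ℝ, (∀ k, M.gam < t k ∧ t k ≤ M.gam + 1) ∧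
      Tendsto t atTop (𝓝 M.gam) ∧
      Tendsto (fun k => (M.wordSum c (t k)).toReal / (M.pairSum c (t k) 1).toReal) atTop (𝓝 0) ∧
      (∃ C, ∀ k, (M.cutSum c (t k) (fun _ => 1)).toReal / (M.pairSum c (t k) 1).toReal ≤ C) ∧
      ∃ ν : Measure (markovShift M.τ), IsFiniteMeasure ν ∧
        ∀ (Φ : markovShift M.τ → NNReal), Continuous Φ → ∀ F : (ℕ → S) → ENNReal,
          (∀ y : markovShift M.τ, F y = Φ y) →
            Tendsto (fun k => (M.cutSum c (t k) F).toReal / (M.pairSum c (t k) 1).toReal) atTop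
              (𝓝 (∫⁻ y, Φ y ∂ν).toReal) := by
  obtain ⟨c, hc, htop⟩ := M.exists_slowlyIncreasing_wordSum_eq_top
  have hγ := M.gam_pos
  obtain ⟨C, hC1, hC⟩ := M.exists_toReal_cutSum_one_le hc (t₁ := M.gam + 1) (by linarith)
  have hq := tendsto_wordSum_div_pairSum hc htop
  have hev : ∀ᶠ t in 𝓝[>] M.gam, t ∈ Set.Ioc M.gam (M.gam + 1) ∧
      (M.wordSum c t).toReal / (M.pairSum c t 1).toReal < 1 :=
    (show ∀ᶠ t in 𝓝[>] M.gam, t ∈ Set.Ioc M.gam (M.gam + 1) from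
      Ioc_mem_nhdsGT (by linarith)).and
      (hq.eventually (gt_mem_nhds (zero_lt_one' ℝ)))
  have hseq : Tendsto (fun k : ℕ => M.gam + 1 / ((k : ℝ) + 1)) atTop (𝓝[>] M.gam) := by
    refine tendsto_nhdsWithin_iff.2 ⟨?_, Eventually.of_forall fun k => ?_⟩
    · simpa using (tendsto_one_div_add_atTop_nhds_zero_nat (𝕜 := ℝ)).const_add M.gam
    · have : (0 : ℝ) < 1 / ((k : ℝ) + 1) := by positivity
      exact lt_add_of_pos_right _ this
  obtain ⟨k₀, hk₀⟩ := eventually_atTop.1 (hseq.eventually hev)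
  set s : ℕ → ℝ := fun k => M.gam + 1 / (((k + k₀ : ℕ) : ℝ) + 1) with hs
  have hsl : Tendsto s atTop (𝓝[>] M.gam) := hseq.comp (tendsto_add_atTop_nat k₀)
  have hs1 : ∀ k, M.gam < s k := fun k => (hk₀ (k + k₀) (by omega)).1.1
  have hs2 : ∀ k, s k ≤ M.gam + 1 := fun k => (hk₀ (k + k₀) (by omega)).1.2
  have hs3 : ∀ k, (M.wordSum c (s k)).toReal / (M.pairSum c (s k) 1).toReal < 1 :=
    fun k => (hk₀ (k + k₀) (by omega)).2
  have hJtop : ∀ k, M.cutSum c (s k) (fun _ => 1) ≠ ⊤ := fun k => cutSum_one_ne_top hc (hs1 k)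
  have hJ0 : ∀ k, M.cutSum c (s k) (fun _ => 1) ≠ 0 := by
    intro k h0
    have hsk := hγ.trans (hs1 k)
    obtain ⟨E, -, hE⟩ := pairSum_le_cutSum_one (M := M) hc 1 hsk
    have := hE _ hsk le_rfl
    rw [h0, mul_zero] at this
    exact (pairSum_one_pos hc hsk).ne' (le_zero_iff.1 this)
  have huniv : ∀ k, M.cutMeasure c (s k) Set.univ = M.cutSum c (s k) (fun _ => 1) := by
    intro k
    rw [← lintegral_cutMeasure (Φ := fun _ => 1) measurable_const (fun _ => rfl), lintegral_one]
  -- Weak compactness is available for probability measures, so the ratio of the total mass to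
  -- `pairSum` is recorded separately in a compact interval; the limit measure is the product of the
  -- two subsequential limits.
  let P : ℕ → ProbabilityMeasure (markovShift M.τ) := fun k =>
    ⟨(M.cutSum c (s k) (fun _ => 1))⁻¹ • M.cutMeasure c (s k), ⟨by
      rw [Measure.smul_apply, huniv, smul_eq_mul, ENNReal.inv_mul_cancel (hJ0 k) (hJtop k)]⟩⟩
  have hκ : ∀ k, (M.cutSum c (s k) (fun _ => 1)).toReal / (M.pairSum c (s k) 1).toReal ∈
      Set.Icc 0 (C + c 1) := by
    intro k
    have hz := toReal_pairSum_one_pos (M := M) hc (hs1 k)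
    refine ⟨by positivity, ?_⟩
    have h1 := hC _ (hs1 k) (hs2 k)
    have h2 := hs3 k
    rw [div_lt_one hz] at h2
    rw [div_le_iff₀ hz]
    nlinarith [hc.1 1]
  let K : ℕ → Set.Icc (0 : ℝ) (C + c 1) := fun k => ⟨_, hκ k⟩
  obtain ⟨⟨π, κ⟩, φ, hφ, hlim⟩ := CompactSpace.tendsto_subseq fun k => (P k, K k)
  have hlim1 : Tendsto (fun k => P (φ k)) atTop (𝓝 π) := (continuous_fst.tendsto _).comp hlim
  have hlim2 : Tendsto (fun k => ((K (φ k) : Set.Icc (0 : ℝ) (C + c 1)) : ℝ)) atTop (𝓝 κ) :=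
    ((continuous_subtype_val.comp continuous_snd).tendsto _).comp hlim
  refine ⟨c, hc, s ∘ φ, fun k => ⟨hs1 _, hs2 _⟩, ?_, ?_, ?_, ?_⟩
  · exact (tendsto_nhdsWithin_iff.1 (hsl.comp hφ.tendsto_atTop)).1
  · exact hq.comp (hsl.comp hφ.tendsto_atTop)
  · exact ⟨C + c 1, fun k => (hκ (φ k)).2⟩
  refine ⟨ENNReal.ofReal κ • (π : Measure (markovShift M.τ)),
    Measure.smul_finite _ ENNReal.ofReal_ne_top, ?_⟩
  intro Φ hΦ F hF
  have h1 := ProbabilityMeasure.tendsto_iff_forall_lintegral_tendsto.1 hlim1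
    (BoundedContinuousFunction.mkOfCompact ⟨Φ, hΦ⟩)
  simp only [BoundedContinuousFunction.mkOfCompact_apply, ContinuousMap.coe_mk] at h1
  have hfin : ∫⁻ y, Φ y ∂(π : Measure (markovShift M.τ)) ≠ ⊤ := by
    have := (BoundedContinuousFunction.mkOfCompact ⟨Φ, hΦ⟩).lintegral_lt_top_of_nnreal
      (π : Measure (markovShift M.τ))
    exact this.ne
  have h2 := ((ENNReal.tendsto_toReal hfin).comp h1).mul hlim2
  rw [lintegral_smul_measure, smul_eq_mul, ENNReal.toReal_mul, ENNReal.toReal_ofReal κ.2.1,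
    mul_comm]
  refine h2.congr fun k => ?_
  have hmeas : Measurable fun y : markovShift M.τ => (Φ y : ENNReal) :=
    measurable_coe_nnreal_ennreal.comp hΦ.measurable
  have h3 : ∫⁻ y, Φ y ∂(P (φ k) : Measure (markovShift M.τ)) =
      (M.cutSum c (s (φ k)) (fun _ => 1))⁻¹ * M.cutSum c (s (φ k)) F := by
    change ∫⁻ y, Φ y ∂((M.cutSum c (s (φ k)) (fun _ => 1))⁻¹ • M.cutMeasure c (s (φ k))) = _
    rw [lintegral_smul_measure, lintegral_cutMeasure hmeas hF, smul_eq_mul]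
  have h4 : 0 < (M.cutSum c (s (φ k)) (fun _ => 1)).toReal :=
    ENNReal.toReal_pos (hJ0 _) (hJtop _)
  simp only [Function.comp]
  rw [h3, ENNReal.toReal_mul, ENNReal.toReal_inv]
  simp only [K]
  field_simp

end Measure

end WordSystem

/-- Boundedness of v matters because a real `limsup` takes a default value otherwise. -/
theorem le_limsup_of_tendsto_of_le {u v : ℕ → ℝ} {l : ℝ} (hv : Bornology.IsBounded (Set.range v))
    (hu : Tendsto u atTop (𝓝 l)) (h : ∀ k, u k ≤ v k) : l ≤ limsup v atTop := by
  rw [← hu.limsup_eq]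
  exact limsup_le_limsup (Eventually.of_forall h) hu.isBoundedUnder_ge.isCoboundedUnder_le
    hv.bddAbove.isBoundedUnder_of_range

theorem limsup_le_of_tendsto_of_le {u v : ℕ → ℝ} {l : ℝ} (hv : Bornology.IsBounded (Set.range v))
    (hu : Tendsto u atTop (𝓝 l)) (h : ∀ k, v k ≤ u k) : limsup v atTop ≤ l := by
  rw [← hu.limsup_eq]
  exact limsup_le_limsup (Eventually.of_forall h)
    hv.bddBelow.isBoundedUnder_of_range.isCoboundedUnder_le hu.isBoundedUnder_le

/-! ### The shift on the Markov shift and continuity of the integrands -/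

section Shift

variable {S : Type*}

/-- The shift as a self-map of the Markov shift. -/
def shiftOn (τ : S → S → Prop) (y : markovShift τ) : markovShift τ := ⟨shift y, shift_mem y.2⟩

theorem coe_shiftOn_iterate {τ : S → S → Prop} (n : ℕ) (y : markovShift τ) :
    ((shiftOn τ)^[n] y : ℕ → S) = shift^[n] (y : ℕ → S) := by
  induction n generalizing y with
  | zero => rfl
  | succ n ih => rw [Function.iterate_succ_apply, Function.iterate_succ_apply, ih]; rfl

end Shift

section Topology

variable {S : Type*} [TopologicalSpace S]

theorem isClopen_cyl [DiscreteTopology S] (w : List S) : IsClopen (cyl w) := by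
  have : cyl w = ⋂ i : Fin w.length, (fun y : ℕ → S => y i) ⁻¹' {w[i]} := by
    ext y
    simp only [cyl, Set.mem_ofPred_eq, Set.mem_iInter, Set.mem_preimage, Set.mem_singleton_iff]
    exact ⟨fun h i => h i i.2, fun h i hi => h ⟨i, hi⟩⟩
  rw [this]
  exact isClopen_iInter_of_finite fun i => (isClopen_discrete _).preimage (continuous_apply _)

theorem continuous_shift : Continuous (shift : (ℕ → S) → ℕ → S) :=
  continuous_pi fun i => continuous_apply (i + 1)

theorem continuous_shiftOn (τ : S → S → Prop) : Continuous (shiftOn τ) :=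
  (continuous_shift.comp continuous_subtype_val).subtype_mk _

theorem continuous_birkhoffProd {τ : S → S → Prop} {R : (ℕ → S) → ℝ}
    (hR : Continuous fun y : markovShift τ => R y) (n : ℕ) :
    Continuous fun y : markovShift τ => birkhoffProd R n y := by
  refine continuous_finsetProd _ fun i _ => ?_
  have := hR.comp ((continuous_shiftOn τ).iterate i)
  simpa only [Function.comp_def, coe_shiftOn_iterate] using this

theorem LogHolder.continuous [DiscreteTopology S] {τ : S → S → Prop} {R : (ℕ → S) → ℝ}
    {θ : ℝ} (hθ0 : 0 < θ) (hθ1 : θ < 1) (hR : ∀ y ∈ markovShift τ, 0 < R y) (hHol : LogHolder τ R θ) :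
    Continuous fun y : markovShift τ => R y := by
  obtain ⟨K, hK⟩ := hHol
  have hlog : Continuous fun y : markovShift τ => Real.log (R y) := by
    rw [continuous_iff_continuousAt]
    intro y
    rw [ContinuousAt, Metric.tendsto_nhds]
    intro ε hε
    have hlim : Tendsto (fun n : ℕ => K * θ ^ n) atTop (𝓝 (K * 0)) :=
      (tendsto_pow_atTop_nhds_zero_of_lt_one hθ0.le hθ1).const_mul K
    rw [mul_zero] at hlim
    obtain ⟨n, hn, hn1⟩ := ((hlim.eventually (gt_mem_nhds hε)).and (eventually_gt_atTop 1)).exists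
    have hopen : IsOpen {z : markovShift τ | ∀ i < n, (z : ℕ → S) i = (y : ℕ → S) i} := by
      have : {z : markovShift τ | ∀ i < n, (z : ℕ → S) i = (y : ℕ → S) i} =
          ⋂ i ∈ Finset.range n, (fun z : markovShift τ => (z : ℕ → S) i) ⁻¹' {(y : ℕ → S) i} := by
        ext z; simp
      rw [this]
      exact isOpen_biInter_finset fun i _ => (isOpen_discrete _).preimage
        ((continuous_apply i).comp continuous_subtype_val)
    filter_upwards [hopen.mem_nhds (show y ∈ _ from fun i _ => rfl)] with z hz
    rw [Real.dist_eq]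
    exact (hK n hn1 z z.2 y y.2 hz).trans_lt hn
  refine (Real.continuous_exp.comp hlog).congr fun y => ?_
  exact Real.exp_log (hR y y.2)

end Topology

/-! ### Invariance of the limit measure and the cylinder estimates -/

namespace WordSystem

variable {S G : Type*} [Group G]

/-- The function `lim_N starCoeff(g) / starCoeff(1)` at the parameter `t`. -/
def ratio (M : WordSystem S G) (c : ℕ → ℝ) (t : ℝ) (g : G) : ℝ :=
  (M.pairSum c t g).toReal / (M.pairSum c t 1).toReal

variable {M : WordSystem S G}

theorem isBounded_ratio [Finite S] {c : ℕ → ℝ} (hc : SlowlyIncreasing c) {t : ℕ → ℝ}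
    (ht : ∀ k, M.gam < t k ∧ t k ≤ M.gam + 1)
    (hC : ∃ C, ∀ k, (M.cutSum c (t k) (fun _ => 1)).toReal / (M.pairSum c (t k) 1).toReal ≤ C)
    (g : G) : Bornology.IsBounded (Set.range fun k => M.ratio c (t k) g) := by
  obtain ⟨C, hC⟩ := hC
  have hγ := M.gam_pos
  obtain ⟨E, hE0, hE⟩ := pairSum_le_cutSum_one (M := M) hc g (t₁ := M.gam + 1) (by linarith)
  refine (Metric.isBounded_Icc (0 : ℝ) (E * C)).subset ?_
  rintro _ ⟨k, rfl⟩
  have hz := toReal_pairSum_one_pos (M := M) hc (ht k).1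
  have h1 := toReal_le_mul hE0 (cutSum_one_ne_top hc (ht k).1)
    (hE _ (hγ.trans (ht k).1) (ht k).2)
  refine ⟨div_nonneg ENNReal.toReal_nonneg hz.le, ?_⟩
  calc M.ratio c (t k) g ≤ E * (M.cutSum c (t k) (fun _ => 1)).toReal /
        (M.pairSum c (t k) 1).toReal := by rw [ratio]; gcongr
    _ = E * ((M.cutSum c (t k) (fun _ => 1)).toReal / (M.pairSum c (t k) 1).toReal) := by ring
    _ ≤ _ := by gcongr; exact hC k

variable [TopologicalSpace S] [DiscreteTopology S]

/-- Cylinders are clopen, so the weights are continuous test functions and weak convergence applies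
to them without boundary terms. -/
theorem exists_continuous_cylWeight {w : List S}
    (hR : Continuous fun y : markovShift M.τ => M.R y) : ∃ Φ : markovShift M.τ → NNReal,
      Continuous Φ ∧ ∀ y : markovShift M.τ, cylWeight M.R w y = Φ y := by
  refine ⟨(Subtype.val ⁻¹' cyl w).indicator fun y : markovShift M.τ =>
    Real.toNNReal (birkhoffProd M.R w.length y)⁻¹, ?_, fun y => ?_⟩
  · refine ((isClopen_cyl w).preimage continuous_subtype_val).continuous_indicator ?_
    exact continuous_real_toNNReal.comp ((continuous_birkhoffProd hR _).inv₀
      fun y => (birkhoffProd_pos M.R_pos _ _).ne')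
  · by_cases h : (y : ℕ → S) ∈ cyl w
    · rw [cylWeight, Set.indicator_of_mem h, Set.indicator_of_mem (by exact h)]
      rfl
    · rw [cylWeight, Set.indicator_of_notMem h, Set.indicator_of_notMem (by exact h)]
      rfl

theorem exists_continuous_midWeight {w : List S}
    (hR : Continuous fun y : markovShift M.τ => M.R y) : ∃ Φ : markovShift M.τ → NNReal,
      Continuous Φ ∧ ∀ y : markovShift M.τ, midWeight M.R M.a w M.A y = Φ y := by
  refine ⟨(Subtype.val ⁻¹' cyl (M.a :: (w ++ [M.A]))).indicator fun y : markovShift M.τ =>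
    Real.toNNReal (birkhoffProd M.R w.length (shift y))⁻¹, ?_, fun y => ?_⟩
  · refine ((isClopen_cyl _).preimage continuous_subtype_val).continuous_indicator ?_
    exact continuous_real_toNNReal.comp
      (((continuous_birkhoffProd hR w.length).comp (continuous_shiftOn M.τ)).inv₀
        fun y => (birkhoffProd_pos M.R_pos _ _).ne')
  · by_cases h : (y : ℕ → S) ∈ cyl (M.a :: (w ++ [M.A]))
    · rw [midWeight, Set.indicator_of_mem h, Set.indicator_of_mem (by exact h)]
      rfl
    · rw [midWeight, Set.indicator_of_notMem h, Set.indicator_of_notMem (by exact h)]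
      rfl

variable [MeasurableSpace S] [MeasurableSingletonClass S]

theorem measurePreserving_limit [Finite S] {c : ℕ → ℝ} (hc : SlowlyIncreasing c) {t : ℕ → ℝ}
    (ht : ∀ k, M.gam < t k ∧ t k ≤ M.gam + 1)
    (hq : Tendsto (fun k => (M.wordSum c (t k)).toReal / (M.pairSum c (t k) 1).toReal) atTop (𝓝 0))
    {ν : Measure (markovShift M.τ)} [IsFiniteMeasure ν]
    (hν : ∀ (Φ : markovShift M.τ → NNReal), Continuous Φ → ∀ F : (ℕ → S) → ENNReal,
      (∀ y : markovShift M.τ, F y = Φ y) →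
        Tendsto (fun k => (M.cutSum c (t k) F).toReal / (M.pairSum c (t k) 1).toReal) atTop
          (𝓝 (∫⁻ y, Φ y ∂ν).toReal)) :
    MeasurePreserving (shiftOn M.τ) ν ν := by
  classical
  have hσ := continuous_shiftOn M.τ
  have hγ := M.gam_pos
  have hfin : ∀ Φ : markovShift M.τ → NNReal, Continuous Φ → ∫⁻ y, Φ y ∂ν ≠ ⊤ := fun Φ hΦ =>
    ((BoundedContinuousFunction.mkOfCompact ⟨Φ, hΦ⟩).lintegral_lt_top_of_nnreal ν).ne
  -- The near invariance of cut sums is one-sided and survives in the limit as an inequality, first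
  -- with 1 + ε and then for ε → 0.
  have hle : ∀ Φ : markovShift M.τ → NNReal, Continuous Φ →
      (∫⁻ y, Φ (shiftOn M.τ y) ∂ν).toReal ≤ (∫⁻ y, Φ y ∂ν).toReal := by
    intro Φ hΦ
    obtain ⟨B, hB⟩ := (isCompact_range hΦ).bddAbove
    let F : (ℕ → S) → ENNReal := fun y =>
      if h : y ∈ markovShift M.τ then (Φ ⟨y, h⟩ : ENNReal) else 0
    have hF : ∀ y : markovShift M.τ, F y = Φ y := fun y => dif_pos y.2
    have hFB : ∀ y, F y ≤ ENNReal.ofReal B := by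
      intro y
      simp only [F]
      split_ifs with h
      · rw [ENNReal.ofReal_coe_nnreal]
        exact_mod_cast hB ⟨_, rfl⟩
      · exact zero_le
    have hFs : ∀ y : markovShift M.τ, F (shift y) = Φ (shiftOn M.τ y) :=
      fun y => hF (shiftOn M.τ y)
    have l1 := hν Φ hΦ F hF
    have l2 := hν (fun y => Φ (shiftOn M.τ y)) (hΦ.comp hσ) (fun y => F (shift y)) hFs
    refine le_of_forall_pos_le_add fun δ hδ => ?_
    set I := (∫⁻ y, Φ y ∂ν).toReal
    have hI : 0 ≤ I := ENNReal.toReal_nonneg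
    set ε := δ / (I + 1)
    have hε : 0 < ε := by positivity
    obtain ⟨C, hC0, hC⟩ := M.cutSum_shift_le hc B.2 hFB hε
    have l3 := (l1.const_mul (1 + ε)).add (hq.const_mul C)
    have hineq := le_of_tendsto_of_tendsto' l2 l3 fun k => by
      have hz := toReal_pairSum_one_pos (M := M) hc (ht k).1
      have h1 := toReal_le_mul_add_mul (by positivity) hC0 (cutSum_ne_top hc (ht k).1 hFB)
        (wordSum_ne_top hc (ht k).1) (hC (t k) (hγ.trans (ht k).1))
      rw [← mul_div_assoc, ← mul_div_assoc, ← add_div]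
      gcongr
    have hεI : ε * I ≤ δ := by
      rw [div_mul_eq_mul_div, div_le_iff₀ (by positivity)]
      nlinarith
    linarith
  refine ⟨hσ.measurable, ?_⟩
  have : IsFiniteMeasure (ν.map (shiftOn M.τ)) := inferInstance
  refine ext_of_forall_lintegral_eq_of_IsFiniteMeasure fun Φ => ?_
  have hmeas : ∀ Ψ : markovShift M.τ → NNReal, Continuous Ψ →
      Measurable fun y => (Ψ y : ENNReal) :=
    fun Ψ hΨ => measurable_coe_nnreal_ennreal.comp hΨ.measurable
  rw [lintegral_map (hmeas _ Φ.continuous) hσ.measurable]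
  obtain ⟨B, hB⟩ := (isCompact_range Φ.continuous).bddAbove
  have hB' : ∀ y, Φ y ≤ B := fun y => hB ⟨y, rfl⟩
  -- The same inequality for B - Φ is the reverse one for Φ, since Φ and Φ ∘ σ are compared under
  -- the same finite measure.
  have hcont : Continuous fun y => B - Φ y := continuous_const.sub Φ.continuous
  have hsum : ∀ Ψ : markovShift M.τ → NNReal, Continuous Ψ → (∀ y, Ψ y ≤ B) →
      (∫⁻ y, Ψ y ∂ν).toReal + (∫⁻ y, (B - Ψ y : NNReal) ∂ν).toReal = (∫⁻ _, B ∂ν).toReal := by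
    intro Ψ hΨ hΨB
    rw [← ENNReal.toReal_add (hfin Ψ hΨ) (hfin (fun y => B - Ψ y) (continuous_const.sub hΨ)),
      ← lintegral_add_left (hmeas Ψ hΨ)]
    congr 2
    funext y
    rw [← ENNReal.coe_add, add_tsub_cancel_of_le (hΨB y)]
  have hΦσ : Continuous fun y => Φ (shiftOn M.τ y) := Φ.continuous.comp hσ
  have hs1 := hsum Φ Φ.continuous hB'
  have hs2 := hsum _ hΦσ fun y => hB' _
  have h1 := hle Φ Φ.continuous
  have h2 := hle _ hcont
  rw [← ENNReal.toReal_eq_toReal_iff' (hfin _ hΦσ) (hfin _ Φ.continuous)]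
  refine le_antisymm h1 ?_
  linarith

/-- The estimates of cylinder integrals by the limit superior of the coefficient ratios. -/
theorem exists_invariant_measure [Finite S] (M : WordSystem S G) (hθ : 0 ≤ M.θ)
    (hR : Continuous fun y : markovShift M.τ => M.R y) :
    ∃ c : ℕ → ℝ, SlowlyIncreasing c ∧ ∃ t : ℕ → ℝ, (∀ k, M.gam < t k) ∧
      Tendsto t atTop (𝓝 M.gam) ∧
      (∀ g, Bornology.IsBounded (Set.range fun k => M.ratio c (t k) g)) ∧
      ∃ ν : Measure (markovShift M.τ), IsFiniteMeasure ν ∧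
        MeasurePreserving (shiftOn M.τ) ν ν ∧ ∃ C : ℝ, 1 < C ∧
        (∀ w : List S, Admissible M.τ (M.a :: (w ++ [M.A])) →
          C ^ (-M.θ ^ wedge w M.x) *
              limsup (fun k => M.ratio c (t k) (wordProd M.s w)) atTop ≤
            M.gam ^ w.length * (∫⁻ y, midWeight M.R M.a w M.A y ∂ν).toReal ∧
          M.gam ^ w.length * (∫⁻ y, midWeight M.R M.a w M.A y ∂ν).toReal ≤
            C ^ (M.θ ^ wedge w M.x) *
              limsup (fun k => M.ratio c (t k) (wordProd M.s w)) atTop) ∧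
        (∀ w : List S, w ≠ [] → Admissible M.τ w →
          C⁻¹ * limsup (fun k => M.ratio c (t k) (wordProd M.s w)) atTop ≤
            M.gam ^ w.length * (∫⁻ y, cylWeight M.R w y ∂ν).toReal ∧
          M.gam ^ w.length * (∫⁻ y, cylWeight M.R w y ∂ν).toReal ≤
            C * limsup (fun k => M.ratio c (t k) (wordProd M.s w)) atTop) := by
  obtain ⟨c, hc, t, ht, htl, hq, hbd, ν, hν0, hν⟩ := M.exists_limit_measure
  have hγ := M.gam_pos
  have ht₁ : 0 < M.gam + 1 := by linarith
  have ht0 : ∀ k, 0 < t k := fun k => hγ.trans (ht k).1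
  have hbdd := fun g => isBounded_ratio hc ht hbd g
  have hz := fun k => toReal_pairSum_one_pos (M := M) hc (ht k).1
  obtain ⟨C₁, hC₁1, hC₁⟩ := M.exists_tsum_split_le (M.gam + 1) ht₁
  obtain ⟨C₂, hC₂1, hC₂⟩ := M.exists_cylWeight_lower ht₁
  have hD1 := M.one_le_D
  have hΥ0 : ∀ g, 0 ≤ limsup (fun k => M.ratio c (t k) g) atTop := fun g =>
    le_limsup_of_tendsto_of_le (hbdd g) tendsto_const_nhds
      fun k => div_nonneg ENNReal.toReal_nonneg (hz k).le
  -- a two-sided comparison of finite sums passes to the limit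
  have lower : ∀ (F : (ℕ → S) → ENNReal) (Φ : markovShift M.τ → NNReal) (B E : ℝ) (g : G) (n : ℕ),
      Continuous Φ → (∀ y : markovShift M.τ, F y = Φ y) → (∀ y, F y ≤ ENNReal.ofReal B) → 0 ≤ E →
      (∀ k, M.pairSum c (t k) g ≤
        ENNReal.ofReal E * (ENNReal.ofReal (t k ^ n) * M.cutSum c (t k) F)) →
      limsup (fun k => M.ratio c (t k) g) atTop ≤
        E * (M.gam ^ n * (∫⁻ y : markovShift M.τ, F y ∂ν).toReal) := by
    intro F Φ B E g n hΦ hFΦ hFB hE h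
    have l := ((htl.pow n).mul (hν Φ hΦ F hFΦ)).const_mul E
    simp only [hFΦ]
    refine limsup_le_of_tendsto_of_le (hbdd g) l fun k => ?_
    have hJ := cutSum_ne_top hc (ht k).1 hFB
    have h1 := toReal_le_mul hE (ENNReal.mul_ne_top ENNReal.ofReal_ne_top hJ) (h k)
    rw [ENNReal.toReal_mul, ENNReal.toReal_ofReal (pow_nonneg (ht0 k).le n)] at h1
    rw [ratio, ← mul_div_assoc, ← mul_div_assoc]
    have := (hz k).le
    gcongr
  have upper : ∀ (F : (ℕ → S) → ENNReal) (Φ : markovShift M.τ → NNReal) (E B : ℝ) (g : G) (n : ℕ),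
      Continuous Φ → (∀ y : markovShift M.τ, F y = Φ y) → 0 < E → 0 ≤ B →
      (∀ k, ENNReal.ofReal (t k ^ n) * M.cutSum c (t k) F ≤
        ENNReal.ofReal E * M.pairSum c (t k) g + ENNReal.ofReal B * M.wordSum c (t k)) →
      M.gam ^ n * (∫⁻ y : markovShift M.τ, F y ∂ν).toReal ≤
        E * limsup (fun k => M.ratio c (t k) g) atTop := by
    intro F Φ E B g n hΦ hFΦ hE hB h
    have l := (((htl.pow n).mul (hν Φ hΦ F hFΦ)).sub (hq.const_mul B)).div_const E
    simp only [hFΦ]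
    rw [mul_zero, sub_zero] at l
    rw [← div_le_iff₀' hE]
    refine le_limsup_of_tendsto_of_le (hbdd g) l fun k => ?_
    have h1 := toReal_le_mul_add_mul hE.le hB (pairSum_ne_top hc (ht k).1 g)
      (wordSum_ne_top hc (ht k).1) (h k)
    rw [ENNReal.toReal_mul, ENNReal.toReal_ofReal (pow_nonneg (ht0 k).le n)] at h1
    rw [div_le_iff₀ hE, ratio, sub_le_iff_le_add, ← mul_div_assoc, ← mul_div_assoc,
      div_mul_eq_mul_div, ← add_div]
    have := (hz k).le
    gcongr
    linarith
  -- C dominates D, the base in the sharp estimate, as well as the two constants 2C₁ and C₂ of the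
  -- uniform one.
  set C := M.D + 2 * C₁ + C₂ with hC
  have hCD : M.D ≤ C := by linarith
  refine ⟨c, hc, t, fun k => (ht k).1, htl, hbdd, ν, hν0, measurePreserving_limit hc ht hq hν, C,
    by linarith, fun w hw => ?_, fun w hne hw => ?_⟩
  · obtain ⟨Φ, hΦ, hFΦ⟩ := exists_continuous_midWeight (w := w) hR
    set Υ := limsup (fun k => M.ratio c (t k) (wordProd M.s w)) atTop with hΥ
    have hΥ0' : 0 ≤ Υ := hΥ0 _
    have hm : 0 ≤ M.θ ^ wedge w M.x := by positivity
    have hDm : 0 < M.D ^ (M.θ ^ wedge w M.x) := Real.rpow_pos_of_pos (by linarith) _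
    have hDC : M.D ^ (M.θ ^ wedge w M.x) ≤ C ^ (M.θ ^ wedge w M.x) :=
      Real.rpow_le_rpow (by linarith) hCD hm
    constructor
    · have h := lower _ Φ _ _ (wordProd M.s w) w.length hΦ hFΦ (M.midWeight_le M.a w M.A) hDm.le
        fun k => midWeight_lower hc (ht0 k) hw
      rw [Real.rpow_neg (by linarith), inv_mul_le_iff₀ (hDm.trans_le hDC)]
      refine h.trans ?_
      have : 0 ≤ M.gam ^ w.length * (∫⁻ y : markovShift M.τ, midWeight M.R M.a w M.A y ∂ν).toReal :=
        by positivity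
      gcongr
    · refine le_trans ?_ (mul_le_mul_of_nonneg_right hDC hΥ0')
      refine le_of_forall_pos_le_add fun δ hδ => ?_
      -- The integral does not depend on ε, so the loss 1 + ε can be made smaller than any δ.
      set ε := δ / (M.D ^ (M.θ ^ wedge w M.x) * Υ + 1)
      have hε : 0 < ε := by positivity
      obtain ⟨B, hB0, hB⟩ := M.midWeight_upper ht₁ hc (w := w) hε
      have h := upper _ Φ _ _ (wordProd M.s w) w.length hΦ hFΦ
        (by positivity : 0 < (1 + ε) * M.D ^ (M.θ ^ wedge w M.x)) hB0
        fun k => hB (t k) (ht0 k) (ht k).2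
      rw [← hΥ] at h
      have hεI : ε * (M.D ^ (M.θ ^ wedge w M.x) * Υ) ≤ δ := by
        rw [div_mul_eq_mul_div, div_le_iff₀ (by positivity)]
        nlinarith
      linarith
  · obtain ⟨Φ, hΦ, hFΦ⟩ := exists_continuous_cylWeight (w := w) hR
    constructor
    · have h := lower _ Φ _ C₂ (wordProd M.s w) w.length hΦ hFΦ (M.cylWeight_le w) (by linarith)
        fun k => hC₂ c hc (t k) (ht0 k) (ht k).2 w hne hw
      rw [inv_mul_le_iff₀ (by linarith)]
      refine h.trans ?_
      have : 0 ≤ M.gam ^ w.length * (∫⁻ y : markovShift M.τ, cylWeight M.R w y ∂ν).toReal := by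
        positivity
      gcongr
      linarith
    · obtain ⟨B, hB0, hB⟩ := M.cylWeight_upper ht₁ hc (w := w)
        fun t ht htt => hC₁ c hc t ht htt w
      have h := upper _ Φ (2 * C₁) B (wordProd M.s w) w.length hΦ hFΦ (by linarith) hB0
        fun k => hB (t k) (ht0 k) (ht k).2
      refine h.trans (mul_le_mul_of_nonneg_right (by linarith) (hΥ0 _))

end WordSystem

theorem tendsto_sum_tsum_subtype {α : Type*} {s : Set α} {f : α → ENNReal} {U : ℕ → Finset α}
    (hmono : Monotone U) (hU : ∀ N, ∀ z ∈ U N, z ∈ s) (hex : ∀ z ∈ s, ∃ N, z ∈ U N) :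
    Tendsto (fun N => ∑ z ∈ U N, f z) atTop (𝓝 (∑' z : s, f z)) := by
  classical
  have h1 : Tendsto (fun N => (U N).subtype (· ∈ s)) atTop atTop := by
    refine tendsto_atTop_finset_of_monotone (fun N N' h z hz => ?_) fun z => ?_
    · rw [Finset.mem_subtype] at hz ⊢
      exact hmono h hz
    · obtain ⟨N, hN⟩ := hex z z.2
      exact ⟨N, Finset.mem_subtype.2 hN⟩
  have h2 := (ENNReal.summable (f := fun z : s => f z)).hasSum.comp h1
  refine h2.congr fun N => ?_
  exact Finset.sum_subtype_of_mem f (hU N)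

/-! ### Matrix coefficients of the representation -/

section Rep

variable {G : Type*} [Group G] {ι : Type*} {K : ι → Subgroup G}

/-- Orthogonality moves the inverse from the reflected density to the other side, so that pairs of
words appear as products in G. -/
theorem inner_cosetRep_inv (f : CosetSpace K) (g h : G) :
    inner ℝ (cosetRep K g f) (cosetRep K h⁻¹ f) = inner ℝ (cosetRep K (h * g) f) f := by
  rw [← LinearIsometryEquiv.inner_map_map (cosetRep K h) (cosetRep K g f), map_mul]
  congr 1
  change (cosetRep K h * cosetRep K h⁻¹) f = f
  rw [← map_mul, mul_inv_cancel, map_one]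
  rfl

theorem inner_cosetRep_nonneg {f : CosetSpace K} (hf : ∀ p, 0 ≤ (f : (Σ i, G ⧸ K i) → ℝ) p)
    (g : G) : 0 ≤ inner ℝ (cosetRep K g f) f := by
  rw [lp.inner_eq_tsum]
  refine tsum_nonneg fun p => ?_
  exact mul_nonneg (hf p) (hf (g⁻¹ • p))

theorem inner_cosetRep_one (f : CosetSpace K) : inner ℝ (cosetRep K 1 f) f = ‖f‖ ^ 2 := by
  rw [map_one]
  exact real_inner_self_eq_norm_sq f

theorem inner_cosetRep_le (f : CosetSpace K) (g : G) :
    inner ℝ (cosetRep K g f) f ≤ ‖f‖ ^ 2 := by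
  refine (real_inner_le_norm _ _).trans_eq ?_
  rw [LinearIsometryEquiv.norm_map, sq]

end Rep

/-! ### Construction of the word system -/

section Exists

variable {S G : Type*} [Group G] [Finite S] [TopologicalSpace S] [DiscreteTopology S]
  [TopologicalSpace G] [DiscreteTopology G]

theorem exists_wordSystem {τ : S → S → Prop} {R : (ℕ → S) → ℝ} {lo hi θ : ℝ} (hlo : 0 < lo)
    (hlo' : ∀ y, lo ≤ R y) (hhi : ∀ y, R y ≤ hi) (hθ0 : 0 < θ) (hθ1 : θ < 1)
    (hHol : LogHolder τ R θ) {s : S → G}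
    (htrans : TransitiveOn (skewProduct s) (markovShift τ ×ˢ Set.univ)) {A a : S}
    (hA : Admissible τ [A]) {x : ℕ → S} (hx : concat [a] x ∈ markovShift τ) {ψ : G → ℝ}
    (hψ : ∀ g, 0 ≤ ψ g) (hψ1 : 0 < ψ 1) {B : ℝ} (hψB : ∀ g, ψ g ≤ B) :
    ∃ M : WordSystem S G, M.τ = τ ∧ M.R = R ∧ M.s = s ∧ M.A = A ∧ M.a = a ∧ M.x = x ∧ M.ψ = ψ ∧
      M.θ = θ := by
  obtain ⟨D, hD1, hD⟩ := hHol.exists_distortion (fun y => hlo.trans_le (hlo' y)) hθ0 hθ1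
  have ha : Admissible τ [a] := admissible_iff.2 ⟨x, hx⟩
  have hpost : ∀ b, ∃ e : List S, Admissible τ [b] → concat (b :: e) x ∈ markovShift τ ∧
      e.getLast? = some a ∧ wordProd s e = 1 := by
    intro b
    by_cases hb : Admissible τ [b]
    · obtain ⟨e, z, hz, hz0, he⟩ := htrans.exists_word hb ha (s b * (s a)⁻¹)
      refine ⟨e ++ [a], fun _ => ⟨?_, by simp, ?_⟩⟩
      · refine concat_replace (b := a) (y := shift z) ?_ ?_ hx
        · rw [← List.cons_append, List.getLast?_append]; rfl
        · rw [← List.cons_append, concat_append, ← hz0, concat_singleton_shift]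
          exact hz
      · rw [wordProd_cons, mul_right_inj] at he
        rw [wordProd_append, he]
        simp [wordProd]
    · exact ⟨[], fun h => absurd h hb⟩
  have hpre : ∀ b, ∃ e : List S, Admissible τ [b] → (∀ z, concat [b] z ∈ markovShift τ →
      concat (e ++ [b]) z ∈ markovShift τ) ∧ e.head? = some A ∧ wordProd s e = 1 := by
    intro b
    by_cases hb : Admissible τ [b]
    · obtain ⟨e, z, hz, hz0, he⟩ := htrans.exists_word hA hb 1
      refine ⟨A :: e, fun _ => ⟨fun z' hz' => ?_, rfl, he⟩⟩
      refine concat_replace (b := b) (y := shift z) ?_ ?_ hz'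
      · rw [List.getLast?_append]; rfl
      · rw [concat_append, ← hz0, concat_singleton_shift]
        exact hz
    · exact ⟨[], fun h => absurd h hb⟩
  choose post hpost using hpost
  choose pre hpre using hpre
  refine ⟨{
    τ := τ, R := R, s := s, A := A, a := a, x := x, ψ := ψ, lo := lo, hi := hi, D := D, θ := θ
    lo_pos := hlo, lo_le := hlo', le_hi := hhi, one_le_D := hD1, distortion := hD, mem_ax := hx
    post := post, pre := pre
    post_mem := fun b hb => (hpost b hb).1
    post_last := fun b hb => (hpost b hb).2.1
    post_prod := fun b hb => (hpost b hb).2.2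
    pre_mem := fun b z hz => (hpre b (admissible_iff.2 ⟨z, hz⟩)).1 z hz
    pre_head := fun b hb => (hpre b hb).2.1
    pre_prod := fun b hb => (hpre b hb).2.2
    conn := fun g => ?_
    ψ_nonneg := hψ, ψ_one_pos := hψ1, ψbound := B, ψ_le := hψB },
    rfl, rfl, rfl, rfl, rfl, rfl, rfl, rfl⟩
  obtain ⟨e, z, hz, hz0, he⟩ := htrans.exists_word ha hA (s a * g)
  rw [wordProd_cons, mul_right_inj] at he
  refine ⟨e, he, admissible_iff.2 ⟨shift z, ?_⟩⟩
  rw [← List.cons_append, concat_append, ← hz0, concat_singleton_shift]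
  exact hz

end Exists

/-! ### Densities and star coefficients as sums over words -/

namespace WordSystem

variable {S G : Type*} [Group G] [Finite S] {M : WordSystem S G}

theorem mem_wordsBetween {n : ℕ} {w : List S} :
    w ∈ wordsBetween M.τ M.A M.a n ↔ w.length = n ∧ w ∈ M.Words := by
  simp only [wordsBetween, Finset.mem_filter, Set.Finite.mem_toFinset, Set.mem_ofPred_eq, Words]
  refine and_congr_right fun _ => ⟨fun ⟨h1, h2, h3⟩ => ⟨?_, h2, h3⟩,
    fun ⟨h1, h2, h3⟩ => ⟨admissible_iff.2 ⟨_, h1⟩, h2, h3⟩⟩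
  obtain ⟨z, hz⟩ := admissible_iff.1 h1
  exact concat_replace h3 hz M.mem_ax

open Classical in
/-- The words of length at most `N` from `A` to `a`. -/
def wordsUpTo (M : WordSystem S G) (N : ℕ) : Finset (List S) :=
  (Finset.Icc 1 N).biUnion (wordsBetween M.τ M.A M.a)

theorem mem_wordsUpTo {N : ℕ} {w : List S} : w ∈ M.wordsUpTo N ↔ w.length ≤ N ∧ w ∈ M.Words := by
  simp only [wordsUpTo, Finset.mem_biUnion, Finset.mem_Icc, mem_wordsBetween]
  constructor
  · rintro ⟨n, hn, rfl, hw⟩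
    exact ⟨hn.2, hw⟩
  · rintro ⟨hn, hw⟩
    refine ⟨_, ⟨?_, hn⟩, rfl, hw⟩
    rcases w with _ | ⟨b, w⟩
    · have := hw.2.1; simp at this
    · simp

theorem wordsUpTo_mono : Monotone M.wordsUpTo := fun _ _ h _ hw =>
  mem_wordsUpTo.2 ⟨(mem_wordsUpTo.1 hw).1.trans h, (mem_wordsUpTo.1 hw).2⟩

/-- The weight of a word in the partial sums `density`. -/
def densityTerm (M : WordSystem S G) (c : ℕ → ℝ) (t : ℝ) (w : List S) : ℝ :=
  (t ^ w.length)⁻¹ * c w.length * wordWeight M.R w M.x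

open Classical in
theorem density_eq (c : ℕ → ℝ) (N : ℕ) (t : ℝ) (g : G) :
    density M.τ M.R M.s M.A M.a M.x c N t g =
      ∑ w ∈ (M.wordsUpTo N).filter (fun w => wordProd M.s w = g), M.densityTerm c t w := by
  rw [density, wordsUpTo, Finset.filter_biUnion, Finset.sum_biUnion]
  · refine Finset.sum_congr rfl fun n _ => ?_
    rw [Finset.mul_sum]
    refine Finset.sum_congr rfl fun w hw => ?_
    have hl := (mem_wordsBetween.1 (Finset.mem_filter.1 hw).1).1
    rw [densityTerm, wordWeight, hl]
  · intro n _ m _ hnm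
    rw [Function.onFun, Finset.disjoint_left]
    intro w hw hw'
    exact hnm ((mem_wordsBetween.1 (Finset.mem_filter.1 hw).1).1.symm.trans
      (mem_wordsBetween.1 (Finset.mem_filter.1 hw').1).1)

/-- A partial density has finite support in G; grouping words by their group element turns the
series into a finite sum. -/
theorem tsum_density_smul {E : Type*} [AddCommGroup E] [Module ℝ E] [TopologicalSpace E]
    (c : ℕ → ℝ) (N : ℕ) (t : ℝ) (Θ : G → E) :
    ∑' g, density M.τ M.R M.s M.A M.a M.x c N t g • Θ g =
      ∑ w ∈ M.wordsUpTo N, M.densityTerm c t w • Θ (wordProd M.s w) := by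
  classical
  rw [tsum_eq_sum (s := (M.wordsUpTo N).image (wordProd M.s)),
    ← Finset.sum_fiberwise_of_maps_to (s := M.wordsUpTo N)
      (t := (M.wordsUpTo N).image (wordProd M.s)) (g := wordProd M.s)
      fun w hw => Finset.mem_image_of_mem _ hw]
  · refine Finset.sum_congr rfl fun g _ => ?_
    rw [density_eq, Finset.sum_smul]
    refine Finset.sum_congr (by congr) fun w hw => ?_
    rw [(Finset.mem_filter.1 hw).2]
  · intro g hg
    rw [density_eq, Finset.sum_eq_zero, zero_smul]
    intro w hw
    have := Finset.mem_filter.1 hw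
    exact absurd (Finset.mem_image.2 ⟨w, this.1, this.2⟩) hg

variable {ι : Type*} {K : ι → Subgroup G} {f : CosetSpace K}

/-- Both are infima of the same set: for non-negative terms, bounded partial sums mean a finite
series. -/
theorem convParam_eq_gam (hψ : ∀ g, M.ψ g = inner ℝ (cosetRep K g f) f) :
    convParam M.τ M.R M.s M.A M.a M.x f = M.gam := by
  rw [convParam, gam]
  congr 1
  ext t
  simp only [Set.mem_ofPred_eq, convSet]
  refine and_congr_right fun ht => ?_
  have hsum : ∀ N, ∑' h : G, density M.τ M.R M.s M.A M.a M.x (fun _ => 1) N t h *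
      inner ℝ (cosetRep K h f) f = ∑ w ∈ M.wordsUpTo N, M.gibbs t w := by
    intro N
    have := M.tsum_density_smul (fun _ => 1) N t M.ψ
    simp only [smul_eq_mul] at this
    simp only [← hψ]
    rw [this]
    refine Finset.sum_congr rfl fun w _ => ?_
    rw [densityTerm, gibbs]
    ring
  simp only [hsum]
  have hof : ∀ N, ENNReal.ofReal (∑ w ∈ M.wordsUpTo N, M.gibbs t w) =
      ∑ w ∈ M.wordsUpTo N, M.wordTerm (fun _ => 1) t w := by
    intro N
    rw [ENNReal.ofReal_sum_of_nonneg fun w _ => gibbs_nonneg ht w]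
    simp [wordTerm]
  have hlim : Tendsto (fun N => ∑ w ∈ M.wordsUpTo N, M.wordTerm (fun _ => 1) t w) atTop
      (𝓝 (M.wordSum (fun _ => 1) t)) :=
    tendsto_sum_tsum_subtype wordsUpTo_mono (fun N w hw => (mem_wordsUpTo.1 hw).2)
      fun w hw => ⟨w.length, mem_wordsUpTo.2 ⟨le_rfl, hw⟩⟩
  have hmono : Monotone fun N => ∑ w ∈ M.wordsUpTo N, M.wordTerm (fun _ => 1) t w :=
    fun N N' h => Finset.sum_le_sum_of_subset (wordsUpTo_mono h)
  constructor
  · rintro ⟨B, hB⟩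
    refine ne_top_of_le_ne_top (ENNReal.ofReal_ne_top (r := B)) (le_of_tendsto' hlim fun N => ?_)
    rw [← hof]
    exact ENNReal.ofReal_le_ofReal (hB ⟨N, rfl⟩)
  · intro h
    refine ⟨(M.wordSum (fun _ => 1) t).toReal, ?_⟩
    rintro _ ⟨N, rfl⟩
    rw [← ENNReal.ofReal_le_iff_le_toReal h, hof]
    exact hmono.ge_of_tendsto hlim N

theorem starCoeff_eq (hψ : ∀ g, M.ψ g = inner ℝ (cosetRep K g f) f) (c : ℕ → ℝ) (N : ℕ) (t : ℝ)
    (g : G) : starCoeff M.τ M.R M.s M.A M.a M.x f c N t g =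
      ∑ z ∈ M.wordsUpTo N ×ˢ M.wordsUpTo N,
        M.pairWeight t g z.1 z.2 * (c z.1.length * c z.2.length) := by
  have h1 : convVec (density M.τ M.R M.s M.A M.a M.x c N t) f =
      ∑ w ∈ M.wordsUpTo N, M.densityTerm c t w • cosetRep K (wordProd M.s w) f :=
    M.tsum_density_smul c N t fun h => cosetRep K h f
  have h2 : convVec (reflect (density M.τ M.R M.s M.A M.a M.x c N t)) f =
      ∑ w ∈ M.wordsUpTo N, M.densityTerm c t w • cosetRep K (wordProd M.s w)⁻¹ f := by
    rw [← M.tsum_density_smul c N t fun h => cosetRep K h⁻¹ f, convVec,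
      ← (Equiv.inv G).tsum_eq]
    simp [reflect]
  -- The first word v of a pair comes from the reflected density and the second word u from the
  -- density itself, which produces ψ(s(v) g s(u)).
  rw [starCoeff, h1, h2, map_sum, inner_sum, Finset.sum_product]
  refine Finset.sum_congr rfl fun v _ => ?_
  rw [sum_inner]
  refine Finset.sum_congr rfl fun u _ => ?_
  rw [map_smul, real_inner_smul_left, real_inner_smul_right]
  have h3 : cosetRep K g (cosetRep K (wordProd M.s u) f) = cosetRep K (g * wordProd M.s u) f := by
    rw [map_mul]; rfl
  rw [h3, inner_cosetRep_inv, ← hψ, ← mul_assoc (wordProd M.s v), densityTerm, densityTerm,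
    pairWeight]
  ring

theorem tendsto_starCoeff (hψ : ∀ g, M.ψ g = inner ℝ (cosetRep K g f) f) {c : ℕ → ℝ}
    (hc : SlowlyIncreasing c) {t : ℝ} (ht : M.gam < t) (g : G) :
    Tendsto (fun N => starCoeff M.τ M.R M.s M.A M.a M.x f c N t g) atTop
      (𝓝 (M.pairSum c t g).toReal) := by
  have ht0 := M.gam_pos.trans ht
  have hlim : Tendsto (fun N => ∑ z ∈ M.wordsUpTo N ×ˢ M.wordsUpTo N, M.pairTerm c t g z) atTop
      (𝓝 (M.pairSum c t g)) := by
    refine tendsto_sum_tsum_subtype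
      (fun N N' h => Finset.product_subset_product (wordsUpTo_mono h) (wordsUpTo_mono h))
      (fun N z hz => ?_) fun z hz => ⟨max z.1.length z.2.length, ?_⟩
    · rw [Finset.mem_product, mem_wordsUpTo, mem_wordsUpTo] at hz
      exact ⟨hz.1.2, hz.2.2⟩
    · rw [Finset.mem_product, mem_wordsUpTo, mem_wordsUpTo]
      exact ⟨⟨le_max_left _ _, hz.1⟩, ⟨le_max_right _ _, hz.2⟩⟩
  refine ((ENNReal.tendsto_toReal (pairSum_ne_top hc ht g)).comp hlim).congr fun N => ?_
  rw [Function.comp_apply, starCoeff_eq hψ,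
    ENNReal.toReal_sum (f := M.pairTerm c t g) fun _ _ => ENNReal.ofReal_ne_top]
  refine Finset.sum_congr rfl fun z _ => ?_
  rw [pairTerm, ENNReal.toReal_ofReal]
  exact mul_nonneg (pairWeight_nonneg ht0 _ _ _) (mul_nonneg (hc.1 _).le (hc.1 _).le)

theorem isUpsilon_limsup_ratio (hψ : ∀ g, M.ψ g = inner ℝ (cosetRep K g f) f) {c : ℕ → ℝ}
    (hc : SlowlyIncreasing c) {t : ℕ → ℝ} (ht : ∀ k, M.gam < t k)
    (hbdd : ∀ g, Bornology.IsBounded (Set.range fun k => M.ratio c (t k) g)) :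
    IsUpsilon M.τ M.R M.s M.A M.a M.x f c t
      fun g => limsup (fun k => M.ratio c (t k) g) atTop := by
  have hz := fun k => toReal_pairSum_one_pos (M := M) hc (ht k)
  refine ⟨fun k => (tendsto_starCoeff hψ hc (ht k) 1).eventually (lt_mem_nhds (hz k)),
    fun k g => M.ratio c (t k) g, fun k g => ?_, fun g => ⟨hbdd g, rfl⟩⟩
  exact (tendsto_starCoeff hψ hc (ht k) g).div (tendsto_starCoeff hψ hc (ht k) 1) (hz k).ne'

end WordSystem

/-! ### Transfer to the space of all sequences -/

section Final

variable {S : Type*} [Finite S] [TopologicalSpace S] [DiscreteTopology S] [MeasurableSpace S]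
  [MeasurableSingletonClass S]

/-- h is the given integrand and h' the one built from the altered potential: they agree on the
Markov shift, but only h' has a sign everywhere. -/
theorem setIntegral_map_coe {τ : S → S → Prop} (ν : Measure (markovShift τ)) {E : Set (ℕ → S)}
    (hE : MeasurableSet E) {h h' : (ℕ → S) → ℝ} (hh : ∀ y : markovShift τ, h y = h' y)
    (hnn : ∀ y, 0 ≤ h' y) (hcont : Continuous fun y : markovShift τ => h' y) :
    ∫ y in E, h y ∂(ν.map Subtype.val) =
      (∫⁻ y : markovShift τ, E.indicator (fun y => ENNReal.ofReal (h' y)) y ∂ν).toReal := by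
  rw [(MeasurableEmbedding.subtype_coe (isClosed_markovShift τ).measurableSet).setIntegral_map]
  simp only [hh]
  rw [integral_eq_lintegral_of_nonneg_ae (f := fun y : markovShift τ => h' y)
    (Eventually.of_forall fun y => hnn y) hcont.aestronglyMeasurable.restrict,
    ← lintegral_indicator (measurable_subtype_coe hE)]
  rfl

theorem measurePreserving_map_coe {τ : S → S → Prop} {ν : Measure (markovShift τ)}
    (h : MeasurePreserving (shiftOn τ) ν ν) :
    MeasurePreserving shift (ν.map Subtype.val) (ν.map Subtype.val) := by
  have hs : Measurable (shift : (ℕ → S) → ℕ → S) := continuous_shift.measurable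
  refine ⟨hs, ?_⟩
  rw [Measure.map_map hs measurable_subtype_coe]
  conv_rhs => rw [← h.map_eq]
  rw [Measure.map_map measurable_subtype_coe h.measurable]
  rfl

end Final

/-- Every counted word ends in a, so w x lies in the Markov shift and values of the potential
elsewhere never enter. -/
theorem density_congr {S G : Type*} [Finite S] [Group G] {τ : S → S → Prop}
    {R R' : (ℕ → S) → ℝ} (h : ∀ y ∈ markovShift τ, R y = R' y) (s : S → G) (A a : S) {x : ℕ → S}
    (hx : concat [a] x ∈ markovShift τ) : density τ R s A a x = density τ R' s A a x := by
  funext c N t g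
  refine Finset.sum_congr rfl fun n _ => ?_
  congr 1
  refine Finset.sum_congr rfl fun w hw => birkhoffProd_congr h n ?_
  simp only [wordsBetween, Finset.mem_filter, Set.Finite.mem_toFinset, Set.mem_ofPred_eq] at hw
  obtain ⟨z, hz⟩ := admissible_iff.1 hw.1.2.1
  exact concat_replace hw.1.2.2.2 hz hx

end ThermoDensity

end

open ThermoDensity

theorem mainTheorem7
    {S : Type*} [Finite S] [TopologicalSpace S] [DiscreteTopology S]
    [MeasurableSpace S] [MeasurableSingletonClass S]
    {G : Type*} [Group G] [Countable G] [TopologicalSpace G] [DiscreteTopology G]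
    {ι : Type*} [Countable ι] (K : ι → Subgroup G)
    (τ : S → S → Prop) (R : (ℕ → S) → ℝ) (hR : ∀ y ∈ markovShift τ, 0 < R y)
    (θ : ℝ) (hθ0 : 0 < θ) (hθ1 : θ < 1) (hHol : LogHolder τ R θ)
    (s : S → G) (htrans : TransitiveOn (skewProduct s) (markovShift τ ×ˢ Set.univ))
    (A a : S) (hA : Admissible τ [A])
    (x : ℕ → S) (hx : x ∈ shift '' (cyl [a] ∩ markovShift τ))
    (f : CosetSpace K) (hf : ∀ p, 0 ≤ (f : (Σ i, G ⧸ K i) → ℝ) p) (hf0 : f ≠ 0) :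
    ∃ c : ℕ → ℝ, SlowlyIncreasing c ∧
    ∃ t : ℕ → ℝ, (∀ k, convParam τ R s A a x f < t k) ∧
      Tendsto t atTop (𝓝 (convParam τ R s A a x f)) ∧
    ∃ Υ : G → ℝ, IsUpsilon τ R s A a x f c t Υ ∧
    ∃ μ : Measure (ℕ → S), IsFiniteMeasure μ ∧ μ (markovShift τ)ᶜ = 0 ∧
      MeasurePreserving shift μ μ ∧
    ∃ C : ℝ, 1 < C ∧
      -- the sharp estimate, for all words `w` with `a w A` admissible
      (∀ w : List S, Admissible τ (a :: (w ++ [A])) →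
        C ^ (-θ ^ wedge w x) * Υ (wordProd s w) ≤
          convParam τ R s A a x f ^ w.length *
            ∫ y in cyl (a :: (w ++ [A])), (birkhoffProd R w.length (shift y))⁻¹ ∂μ ∧
        convParam τ R s A a x f ^ w.length *
            ∫ y in cyl (a :: (w ++ [A])), (birkhoffProd R w.length (shift y))⁻¹ ∂μ ≤
          C ^ (θ ^ wedge w x) * Υ (wordProd s w)) ∧
      -- the estimate with a uniform constant, for all admissible words
      (∀ w : List S, w ≠ [] → Admissible τ w →
        C⁻¹ * Υ (wordProd s w) ≤
          convParam τ R s A a x f ^ w.length *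
            ∫ y in cyl w, (birkhoffProd R w.length y)⁻¹ ∂μ ∧
        convParam τ R s A a x f ^ w.length *
            ∫ y in cyl w, (birkhoffProd R w.length y)⁻¹ ∂μ ≤
          C * Υ (wordProd s w)) := by
  classical
  have hmem : concat [a] x ∈ markovShift τ := by
    obtain ⟨y, ⟨hya, hy⟩, rfl⟩ := hx
    rwa [show a = y 0 from (hya 0 (by simp)).symm, concat_singleton_shift]
  obtain ⟨B, hB0, hB⟩ := hHol.exists_bound
  -- outside of the Markov shift the values of `R` do not matter
  let R' : (ℕ → S) → ℝ := fun z => if z ∈ markovShift τ then R z else 1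
  have hRR : ∀ z ∈ markovShift τ, R z = R' z := fun z hz => (if_pos hz).symm
  have hHol' : LogHolder τ R' θ := by
    obtain ⟨L, hL⟩ := hHol
    refine ⟨L, fun n hn u hu v hv huv => ?_⟩
    rw [← hRR u hu, ← hRR v hv]
    exact hL n hn u hu v hv huv
  have hlo : ∀ z, Real.exp (-B) ≤ R' z := by
    intro z
    by_cases hz : z ∈ markovShift τ
    · rw [← hRR z hz, ← Real.le_log_iff_exp_le (hR z hz)]
      exact (abs_le.1 (hB z hz)).1
    · simp only [R', if_neg hz]
      exact Real.exp_le_one_iff.2 (by linarith)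
  have hhi : ∀ z, R' z ≤ Real.exp B := by
    intro z
    by_cases hz : z ∈ markovShift τ
    · rw [← hRR z hz, ← Real.log_le_iff_le_exp (hR z hz)]
      exact (abs_le.1 (hB z hz)).2
    · simp only [R', if_neg hz]
      exact Real.one_le_exp hB0
  have hψ1 : 0 < inner ℝ (cosetRep K 1 f) f := by
    rw [inner_cosetRep_one]
    exact pow_pos (norm_pos_iff.2 hf0) 2
  obtain ⟨M, hτ, hMR, hs, hMA, hMa, hMx, hMψ, hMθ⟩ := exists_wordSystem (Real.exp_pos _) hlo hhi
    hθ0 hθ1 hHol' htrans hA hmem (ψ := fun g => inner ℝ (cosetRep K g f) f)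
    (inner_cosetRep_nonneg hf) hψ1 (inner_cosetRep_le f)
  have hψ : ∀ g, M.ψ g = inner ℝ (cosetRep K g f) f := fun g => congrFun hMψ g
  have hdens : density τ R s A a x = density τ M.R s A a x :=
    hMR ▸ density_congr hRR s A a hmem
  have hcont : Continuous fun z : markovShift τ => M.R z :=
    (hHol.continuous hθ0 hθ1 hR).congr fun z => by rw [hMR, hRR z z.2]
  have hRM : ∀ z ∈ markovShift τ, R z = M.R z := fun z hz => by rw [hMR, hRR z hz]
  subst hτ hs hMA hMa hMx hMθ
  have hγ : convParam M.τ R M.s M.A M.a M.x f = M.gam := by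
    rw [← M.convParam_eq_gam hψ, convParam, convParam, hdens]
  obtain ⟨c, hc, t, ht, htl, hbdd, ν, hν, hinv, C, hC, hmid, hcyl⟩ :=
    M.exists_invariant_measure hθ0.le hcont
  have hU := M.isUpsilon_limsup_ratio hψ hc ht hbdd
  refine ⟨c, hc, t, fun k => hγ ▸ ht k, hγ ▸ htl,
    fun g => limsup (fun k => M.ratio c (t k) g) atTop, ?_, ν.map Subtype.val, inferInstance, ?_,
    measurePreserving_map_coe hinv, C, hC, fun w hw => ?_, fun w hw hw' => ?_⟩
  · unfold IsUpsilon starCoeff at hU ⊢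
    rwa [hdens]
  · rw [Measure.map_apply measurable_subtype_coe
      (isClosed_markovShift M.τ).measurableSet.compl]
    convert measure_empty (μ := ν)
    ext z
    simp
  · rw [hγ, setIntegral_map_coe ν (isClopen_cyl _).isOpen.measurableSet
      (h := fun z => (birkhoffProd R w.length (shift z))⁻¹)
      (h' := fun z => (birkhoffProd M.R w.length (shift z))⁻¹)
      (fun z => congrArg (·⁻¹) (birkhoffProd_congr hRM _ (shift_mem z.2)))
      (fun z => (inv_pos.2 (birkhoffProd_pos M.R_pos _ _)).le)
      (((continuous_birkhoffProd hcont w.length).comp (continuous_shiftOn M.τ)).inv₀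
        fun z => (birkhoffProd_pos M.R_pos _ _).ne')]
    exact hmid w hw
  · rw [hγ, setIntegral_map_coe ν (isClopen_cyl _).isOpen.measurableSet
      (h := fun z => (birkhoffProd R w.length z)⁻¹)
      (h' := fun z => (birkhoffProd M.R w.length z)⁻¹)
      (fun z => congrArg (·⁻¹) (birkhoffProd_congr hRM _ z.2))
      (fun z => (inv_pos.2 (birkhoffProd_pos M.R_pos _ _)).le)
      ((continuous_birkhoffProd hcont w.length).inv₀
        fun z => (birkhoffProd_pos M.R_pos _ _).ne')]
    exact hcyl w hw hw'
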